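/- **Setting.** Let $k$ be an algebraically closed field of characteristic $p\ge 3$, and let $X$ be the smooth projective curve over $k$ with function field $F=k(x,y)$, $$y^p-y=\frac{f(x)}{\prod_{i=1}^r(x-\rho_i)^{l_i}},$$ where $r\ge 1$, the $\rho_i\in k$ are distinct, every $l_i$ is prime to $p$, $f\in k[x]$ is prime to $\prod_i(x-\rho_i)^{l_i}$, $f(0)\neq 0$ and $\deg f=\sum_i l_i$. Let $\pi:X\to\mathbb P^1$ be the map given by $x$, let $U_a=X\setminus\pi^{-1}(a)$ for $a\in\{0,\infty\}$, and identify $$H^1(X,\mathcal O_X)=\mathcal O_X(U_0\cap U_\infty)\,/\,\{f_0-f_\infty : f_0\in\mathcal O_X(U_0),\ f_\infty\in\mathcal O_X(U_\infty)\}.$$ For $0\le\mu\le p-1$ put $$m_i^{(\mu)}=\left\lfloor\frac{(p-1-\mu)l_i+(p-1)}{p}\right\rfloor,\qquad g_\mu(x)=\prod_{i=1}^r(x-\rho_i)^{m_i^{(\mu)}},\qquad t^{(\mu)}=\sum_{i=1}^r m_i^{(\mu)}.$$ **Proposition.** 1. For $1\le j\le 2p-3$, $\mathrm{Tr}_{F/k(x)}(y^j)=-1$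 if $j=p-1$, and $\mathrm{Tr}_{F/k(x)}(y^j)=0$ otherwise. 2. The differentials $$\omega_{\mu,\nu}=x^{\nu-1}\frac{y^\mu}{g_\mu(x)}\,dx,\qquad 0\le\mu\le p-1,\ t^{(\mu)}\ge 2,\ 1\le\nu\le t^{(\mu)}-1,$$ form a $k$-basis of $H^0(X,\Omega_X)$. 3. The functions $g_{p-\mu}(x)y^{\mu-1}/x^\nu$ with $1\le\mu\le p$, $t^{(p-\mu)}\ge 2$, $1\le\nu\le t^{(p-\mu)}-1$ lie in $\mathcal O_X(U_0\cap U_\infty)$, and their classes $$h_{\mu,\nu}=\left[\frac{g_{p-\mu}(x)\,y^{\mu-1}}{x^\nu}\right]$$ form a $k$-basis of $H^1(X,\mathcal O_X)$. 4. The formula $\langle\omega,[h]\rangle=\sum_{P\in\pi^{-1}(\infty)}\mathrm{Res}_P(h\,\omega)$ gives a well-defined $k$-bilinear pairing $H^0(X,\Omega_X)\times H^1(X,\mathcal O_X)\to k$, and the two bases are dual to each other under it, after matching the index $\mu$ with $p-\mu$: for all indices as above, $$\langle\omega_{\mu_1,\nu_1},h_{\mu_2,\nu_2}\rangle=\begin{cases}1&\text{if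 }\mu_1=p-\mu_2\text{ and }\nu_1=\nu_2,\\0&\text{otherwise.}\end{cases}$$ -/

import Mathlib

open scoped Polynomial

noncomputable section

namespace ArtinSchreierCurve

/-! ### The abstract nonsingular curve of a function field

A point of the smooth projective curve `X` with function field `F` over the algebraically closed
field `k` is a discrete valuation ring of `F / k`. -/

/-- A point of the curve: a discrete valuation ring of `F` (with fraction field `F`) that
contains `k`. -/
structure Place (k F : Type*) [Field k] [Field F] [Algebra k F] where
  /-- The local ring at the point. -/
  ring : ValuationSubring F
  algebraMap_mem : ∀ c : k, algebraMap k F c ∈ ring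
  isDVR : IsDiscreteValuationRing ring

section Curve

variable {k F : Type*} [Field k] [Field F] [Algebra k F]

/-- `t` is a uniformizer at `P`: a prime element of the discrete valuation ring at `P`. -/
def IsUniformizer (P : Place k F) (t : F) : Prop :=
  ∃ ht : t ∈ P.ring, Irreducible (⟨t, ht⟩ : P.ring)

/-- The points of `X` where the function `x` takes the value `0`. -/
def fibreZero (k : Type*) {F : Type*} [Field k] [Field F] [Algebra k F] (x : F) :
    Set (Place k F) :=
  {P | x ∈ P.ring.nonunits}

/-- The points of `X` where the function `x` has a pole. -/
def fibreInfty (k : Type*) {F : Type*} [Field k] [Field F] [Algebra k F] (x : F) :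
    Set (Place k F) :=
  {P | x⁻¹ ∈ P.ring.nonunits}

/-- `O_X(U)`: the functions that are regular at all points of `U`. -/
def regularFunctions (U : Set (Place k F)) : Submodule k F where
  carrier := {h | ∀ P ∈ U, h ∈ P.ring}
  add_mem' ha hb P hP := P.ring.add_mem _ _ (ha P hP) (hb P hP)
  zero_mem' P _ := P.ring.zero_mem
  smul_mem' c h hh P hP := by
    rw [Algebra.smul_def]
    exact P.ring.mul_mem _ _ (P.algebraMap_mem c) (hh P hP)

/-- The differentials regular at `P`: the stalk at `P` of the sheaf of differentials, i.e. the
image in `Ω[F⁄k]` of the Kähler differentials of the local ring at `P`. It consists of the sums of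
`h da` with `h` and `a` in the local ring. -/
def regularDifferentialsAt (P : Place k F) : Submodule k (Ω[F⁄k]) :=
  Submodule.span k {ω | ∃ h ∈ P.ring, ∃ a ∈ P.ring, ω = h • KaehlerDifferential.D k F a}

/-- `H⁰(X, Ω_X)`: the differentials regular at every point. -/
def H0 (k F : Type*) [Field k] [Field F] [Algebra k F] : Submodule k (Ω[F⁄k]) :=
  ⨅ P : Place k F, regularDifferentialsAt P

/-- `O_X(U_0 ∩ U_∞)`, where `U_a` is the complement of the fibre of `x` over `a`. -/
def cocycles (k : Type*) {F : Type*} [Field k] [Field F] [Algebra k F] (x : F) :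
    Submodule k F :=
  regularFunctions ((fibreZero k x)ᶜ ∩ (fibreInfty k x)ᶜ)

/-- The submodule `{h_0 - h_∞ : h_0 ∈ O_X(U_0), h_∞ ∈ O_X(U_∞)}` of `F`. -/
def coboundaries (k : Type*) {F : Type*} [Field k] [Field F] [Algebra k F] (x : F) :
    Submodule k F :=
  regularFunctions ((fibreZero k x)ᶜ) ⊔ regularFunctions ((fibreInfty k x)ᶜ)

/-- `H¹(X, O_X)`, as first Čech cohomology of the affine covering `{U_0, U_∞}`:
`O_X(U_0 ∩ U_∞) / {h_0 - h_∞}`. -/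
abbrev H1 (k : Type*) {F : Type*} [Field k] [Field F] [Algebra k F] (x : F) : Type _ :=
  (cocycles k x) ⧸ (coboundaries k x).submoduleOf (cocycles k x)

/-- The Laurent series `s = ∑ cᵢ Tⁱ` is the expansion of the function `h` at `P` in powers of the
uniformizer `t`: for every integer `N`, `h - ∑_{i < N} cᵢ tⁱ` vanishes at `P` to order at
least `N`. -/
def IsLaurentExpansion (P : Place k F) (t h : F) (s : LaurentSeries k) : Prop :=
  ∀ N : ℤ, ∃ b ∈ P.ring, h - ∑ i ∈ Finset.Ico s.order N, s.coeff i • t ^ i = b * t ^ N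

/-- `a` is the coefficient of `t⁻¹` in the Laurent expansion of `h`, where `ω = h dt` and `t` is a
uniformizer at `P`. -/
def IsResidue (P : Place k F) (ω : Ω[F⁄k]) (a : k) : Prop :=
  ∃ (t h : F) (s : LaurentSeries k), IsUniformizer P t ∧ ω = h • KaehlerDifferential.D k F t ∧
    IsLaurentExpansion P t h s ∧ s.coeff (-1) = a

/-- The residue of `ω` at `P` (it does not depend on the uniformizer). -/
def residue (P : Place k F) (ω : Ω[F⁄k]) : k :=
  Classical.epsilon (IsResidue P ω)

/-- `∑_{P ∈ π⁻¹(∞)} Res_P(ω)`. -/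
def residueSumInfty (x : F) (ω : Ω[F⁄k]) : k :=
  ∑ᶠ P ∈ fibreInfty k x, residue P ω

end Curve

/-! ### Artin–Schreier data -/

section Data

variable {k : Type*} [Field k] {r : ℕ}

/-- The rational function `f / ∏ (x - ρᵢ)^{lᵢ}`. -/
def rhs (f : k[X]) (ρ : Fin r → k) (l : Fin r → ℕ) : RatFunc k :=
  algebraMap k[X] (RatFunc k) f /
    algebraMap k[X] (RatFunc k) (∏ i, (Polynomial.X - Polynomial.C (ρ i)) ^ l i)

/-- `mᵢ^{(μ)}`, the quotient of `(p - 1 - μ) lᵢ + (p - 1)` by `p` (used for `μ ≤ p - 1`). -/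
def mExp (p : ℕ) (l : Fin r → ℕ) (μ : ℕ) (i : Fin r) : ℕ :=
  ((p - 1 - μ) * l i + (p - 1)) / p

/-- `t^{(μ)} = ∑ mᵢ^{(μ)}`. -/
def tExp (p : ℕ) (l : Fin r → ℕ) (μ : ℕ) : ℕ :=
  ∑ i, mExp p l μ i

/-- `g_μ(x) = ∏ (x - ρᵢ)^{mᵢ^{(μ)}}`. -/
def gPoly (p : ℕ) (ρ : Fin r → k) (l : Fin r → ℕ) (μ : ℕ) : k[X] :=
  ∏ i, (Polynomial.X - Polynomial.C (ρ i)) ^ mExp p l μ i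

/-- The indices `(μ, ν)` of the differentials: `0 ≤ μ ≤ p - 1`, `t^{(μ)} ≥ 2` and
`1 ≤ ν ≤ t^{(μ)} - 1`. -/
abbrev DiffIndex (p : ℕ) (l : Fin r → ℕ) : Type :=
  {q : ℕ × ℕ // q.1 ≤ p - 1 ∧ 2 ≤ tExp p l q.1 ∧ 1 ≤ q.2 ∧ q.2 ≤ tExp p l q.1 - 1}

/-- The indices `(μ, ν)` of the cohomology classes: `1 ≤ μ ≤ p`, `t^{(p-μ)} ≥ 2` and
`1 ≤ ν ≤ t^{(p-μ)} - 1`. -/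
abbrev ClassIndex (p : ℕ) (l : Fin r → ℕ) : Type :=
  {q : ℕ × ℕ // 1 ≤ q.1 ∧ q.1 ≤ p ∧ 2 ≤ tExp p l (p - q.1) ∧
    1 ≤ q.2 ∧ q.2 ≤ tExp p l (p - q.1) - 1}

variable {F : Type*} [Field F] [Algebra k F]

/-- `ω_{μ,ν} = x^{ν-1} y^μ / g_μ(x) dx`. -/
def diffForm (p : ℕ) (ρ : Fin r → k) (l : Fin r → ℕ) (x y : F) (μ ν : ℕ) : Ω[F⁄k] :=
  (x ^ (ν - 1) * y ^ μ / Polynomial.aeval x (gPoly p ρ l μ)) • KaehlerDifferential.D k F x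

/-- `g_{p-μ}(x) y^{μ-1} / x^ν`. -/
def cocycle (p : ℕ) (ρ : Fin r → k) (l : Fin r → ℕ) (x y : F) (μ ν : ℕ) : F :=
  Polynomial.aeval x (gPoly p ρ l (p - μ)) * y ^ (μ - 1) / x ^ ν

end Data

end ArtinSchreierCurve

end

/-! Everything is read off from the coefficients in k(x) of the basis 1, y, …, y^(p-1) of F, tested
along explicit embeddings of F in k((s)). Over a point of the line other than the ρᵢ (infinity
included, because f and the denominator have the same degree) the right-hand side of the equation is
integral; Hensel's lemma gives a root η, and p embeddings send y to η + c with c in the prime field.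
These values differ by nonzero constants, so Lagrange interpolation bounds every coefficient by the
orders of the function at the p points (`UnramifiedFamily.le_orderTop`). Over ρᵢ there is a
parameter with y = s^(-lᵢ) exactly and x - ρᵢ of order p. The terms aⱼ yʲ then have orders distinct
modulo p and cannot cancel (`le_orderTop_ramified_term`); this also makes the Artin–Schreier
polynomial irreducible.

The exponents mᵢ are the roundings that these conditions impose. Functions regular where x is finite
are combinations of xⁿ g_{p-1-j} yʲ with n ≥ 0. Functions regular where x is finite and nonzero are
combinations of the same functions with n any integer. Regular differentials are combinations of the
ω_{μ,ν}, since dx has order (p-1)(lᵢ+1) over ρᵢ and -2 at infinity. This gives the spanning half of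
both bases. The converse, that these functions and forms are regular, concerns arbitrary discrete
valuation rings of F; it follows from the equation by valuation estimates, with the local parameter
T^A y^B, pA - lᵢB = 1, over ρᵢ (`exists_parameter`, `diffForm_mem_of_ramified`).

For the pairing, the poles of x are shown to be exactly the p places of the embeddings at infinity
(`fibreInfty_eq`), and a residue is the constant coefficient of the pullback of the form along s
d/ds (`residue_placeOf`). The sum of residues becomes a sum of (η + c)^(j+μ) over the prime field,
which is -1 for exponent p-1 and 0 for every other exponent up to 2p-3. Hence xⁿ g_{p-1-j} yʲ pairs
with ω_{μ,ν} to 1 when j + μ = p-1 and n = -ν, and to 0 otherwise (`residuePairing_monomialFun`).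
Exponents n ≥ 0 pair to zero, so the pairing descends to H¹ without the residue theorem. The duality
then gives linear independence of both families, without Riemann–Roch. The traces are computed
separately, from the matrix of multiplication by yʲ. -/

noncomputable section

namespace ArtinSchreierCurve

set_option linter.unusedSectionVars false

/-! ### Laurent series, the derivation s d/ds, and residues under change of parameter -/

section LaurentSeries

variable {k : Type*} [Field k]

/-- The structure of `k`-algebra on the Laurent series over `k` that is compatible with the
coefficientwise action of `k`. -/
instance laurentSeriesAlgebra : Algebra k (LaurentSeries k) :=
  HahnSeries.instAlgebra

theorem algebraMap_laurentSeries (c : k) :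
    algebraMap k (LaurentSeries k) c = HahnSeries.C c := rfl

/-- The operator `s d/ds` on Laurent series in `s`. -/
def eulerOperator (k : Type*) [Field k] : LaurentSeries k →ₗ[k] LaurentSeries k where
  toFun f := ⟨fun n => (n : k) * f.coeff n, f.isPWO_support.mono fun n hn hf => hn (by
    simp [show f.coeff n = 0 from hf])⟩
  map_add' f g := by ext n; simp [mul_add]
  map_smul' c f := by ext n; simp [mul_left_comm]

theorem coeff_eulerOperator (f : LaurentSeries k) (n : ℤ) :
    (eulerOperator k f).coeff n = n * f.coeff n := rfl

theorem support_eulerOperator_subset (f : LaurentSeries k) :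
    (eulerOperator k f).support ⊆ f.support := fun n hn hf =>
  hn (by rw [coeff_eulerOperator, show f.coeff n = 0 from hf, mul_zero])

/-- The derivation `s d/ds` of the field of Laurent series in `s`. -/
def eulerDerivation (k : Type*) [Field k] :
    Derivation k (LaurentSeries k) (LaurentSeries k) :=
  Derivation.mk' (eulerOperator k) fun f g => by
    ext n
    rw [smul_eq_mul, smul_eq_mul, mul_comm g, HahnSeries.coeff_add, coeff_eulerOperator,
      HahnSeries.coeff_mul,
      HahnSeries.coeff_mul_right' g.isPWO_support (support_eulerOperator_subset g),
      HahnSeries.coeff_mul_left' f.isPWO_support (support_eulerOperator_subset f),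
      Finset.mul_sum, ← Finset.sum_add_distrib]
    refine Finset.sum_congr rfl fun ij hij => ?_
    rw [Finset.mem_antidiagonal] at hij
    rw [← hij.2.2, coeff_eulerOperator, coeff_eulerOperator]
    push_cast
    ring

@[simp]
theorem coeff_eulerDerivation (f : LaurentSeries k) (n : ℤ) :
    (eulerDerivation k f).coeff n = n * f.coeff n := rfl

theorem one_le_orderTop_eulerDerivation {f : LaurentSeries k} (hf : 0 ≤ f.orderTop) :
    1 ≤ (eulerDerivation k f).orderTop := by
  rw [HahnSeries.le_orderTop_iff_forall]
  intro n hn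
  have hn1 : n < 1 := by exact_mod_cast hn
  rcases eq_or_ne n 0 with rfl | h0
  · simp
  · rw [coeff_eulerDerivation, HahnSeries.coeff_eq_zero_of_lt_orderTop, mul_zero]
    refine lt_of_lt_of_le ?_ hf
    exact_mod_cast (by omega : n < 0)

theorem eulerDerivation_single (n : ℤ) (c : k) :
    eulerDerivation k (HahnSeries.single n c) = HahnSeries.single n (n * c) := by
  ext m
  rw [coeff_eulerDerivation, HahnSeries.coeff_single, HahnSeries.coeff_single]
  split_ifs with h
  · rw [h]
  · simp

theorem eulerDerivation_coe (f : PowerSeries k) :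
    eulerDerivation k (HahnSeries.ofPowerSeries ℤ k f) =
      HahnSeries.ofPowerSeries ℤ k (PowerSeries.X * PowerSeries.derivative k f) := by
  ext n
  rw [coeff_eulerDerivation, PowerSeries.coeff_coe, PowerSeries.coeff_coe]
  split_ifs with h
  · simp
  · obtain ⟨m, rfl⟩ := Int.eq_ofNat_of_zero_le (not_lt.mp h)
    rcases m with _ | m
    · simp
    · simp only [Int.natAbs_natCast, PowerSeries.coeff_succ_X_mul]
      rw [PowerSeries.coeff_derivative]
      push_cast
      ring

/-- The ring of power series, as a valuation subring of the field of Laurent series. -/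
def integralSeries (k : Type*) [Field k] : ValuationSubring (LaurentSeries k) where
  carrier := {f | 0 ≤ f.orderTop}
  mul_mem' {a b} ha hb := by
    change 0 ≤ (a * b).orderTop
    rw [HahnSeries.orderTop_mul]
    exact add_nonneg ha hb
  one_mem' := by simp
  add_mem' {a b} ha hb := by
    change 0 ≤ (a + b).orderTop
    exact le_trans (le_min ha hb) HahnSeries.min_orderTop_le_orderTop_add
  zero_mem' := by simp
  neg_mem' {a} ha := by simpa using ha
  mem_or_inv_mem' a := by
    change 0 ≤ a.orderTop ∨ 0 ≤ a⁻¹.orderTop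
    rcases eq_or_ne a 0 with rfl | h
    · simp
    · have h1 : a.orderTop + a⁻¹.orderTop = 0 := by
        rw [← HahnSeries.orderTop_mul, mul_inv_cancel₀ h, HahnSeries.orderTop_one]
      rw [← HahnSeries.order_eq_orderTop_of_ne_zero h,
        ← HahnSeries.order_eq_orderTop_of_ne_zero (inv_ne_zero h)] at *
      norm_cast at *
      omega

theorem mem_integralSeries {f : LaurentSeries k} : f ∈ integralSeries k ↔ 0 ≤ f.orderTop :=
  Iff.rfl

theorem ofPowerSeries_mem_integralSeries (f : PowerSeries k) :
    HahnSeries.ofPowerSeries ℤ k f ∈ integralSeries k := by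
  rw [mem_integralSeries, HahnSeries.le_orderTop_iff_forall]
  intro n hn
  have : n < 0 := by exact_mod_cast hn
  rw [PowerSeries.coeff_coe, if_pos this]

theorem exists_ofPowerSeries_eq {f : LaurentSeries k} (hf : f ∈ integralSeries k) :
    ∃ g : PowerSeries k, HahnSeries.ofPowerSeries ℤ k g = f := by
  refine ⟨PowerSeries.mk fun n => f.coeff n, ?_⟩
  ext n
  rw [PowerSeries.coeff_coe]
  split_ifs with h
  · rw [HahnSeries.coeff_eq_zero_of_lt_orderTop]
    exact lt_of_lt_of_le (by exact_mod_cast h) hf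
  · rw [PowerSeries.coeff_mk, Int.natAbs_of_nonneg (not_lt.mp h)]

theorem algebraMap_mem_integralSeries (c : k) :
    algebraMap k (LaurentSeries k) c ∈ integralSeries k := by
  rw [algebraMap_laurentSeries, ← HahnSeries.ofPowerSeries_C]
  exact ofPowerSeries_mem_integralSeries _

/-- The coefficient of `X ^ m` in `w ^ m - w ^ (m - 1) * X * w'` vanishes. -/
theorem coeff_pow_eq_coeff_pow_mul_derivative {R : Type*} [CommRing R] (w : PowerSeries R)
    (m : ℕ) : PowerSeries.coeff (m + 1) (w ^ (m + 1)) =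
      PowerSeries.coeff (m + 1) (w ^ m * (PowerSeries.X * PowerSeries.derivative R w)) := by
  -- The identity is (w^(m+1))' = (m+1) w^m w' divided by m+1, which is illegitimate when the
  -- characteristic divides m+1. It is therefore proved for a lift of w over a polynomial ring over
  -- ℤ that surjects onto R.
  let π : MvPolynomial R ℤ →+* R := (MvPolynomial.aeval (R := ℤ) (id : R → R)).toRingHom
  have hπ : Function.Surjective π := fun a => ⟨MvPolynomial.X a, by simp [π]⟩
  obtain ⟨v, rfl⟩ := PowerSeries.map_surjective π hπ w
  have hd : PowerSeries.derivative R (PowerSeries.map π v) =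
      PowerSeries.map π (PowerSeries.derivative _ v) := by
    ext n
    simp [PowerSeries.coeff_derivative]
  rw [hd, ← PowerSeries.map_X π, ← map_mul, ← map_pow, ← map_pow, ← map_mul,
    PowerSeries.coeff_map, PowerSeries.coeff_map]
  congr 1
  have h1 := PowerSeries.coeff_derivative (v ^ (m + 1)) m
  have h2 : PowerSeries.derivative (MvPolynomial R ℤ) (v ^ (m + 1)) =
      ((m + 1 : ℕ) : PowerSeries (MvPolynomial R ℤ)) *
        (v ^ m * PowerSeries.derivative _ v) := by
    rw [Derivation.leibniz_pow]
    simp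
  rw [mul_left_comm, PowerSeries.coeff_succ_X_mul]
  rw [h2, ← map_natCast (PowerSeries.C (R := MvPolynomial R ℤ)), PowerSeries.coeff_C_mul] at h1
  have h3 : ((m + 1 : ℕ) : MvPolynomial R ℤ) ≠ 0 := by
    exact_mod_cast Nat.succ_ne_zero m
  apply mul_left_cancel₀ h3
  rw [h1]
  push_cast
  ring

/-- The residue of `Tⁱ dT` for a power series `T` of order one. -/
theorem coeff_zpow_mul_eulerDerivation {T : LaurentSeries k} (hT : T.orderTop = 1) (m : ℕ) :
    (T ^ (-(m + 1) : ℤ) * eulerDerivation k T).coeff 0 = if m = 0 then 1 else 0 := by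
  set s : LaurentSeries k := HahnSeries.single 1 1 with hs
  have hs0 : s ≠ 0 := by simp [hs]
  have hT0 : T ≠ 0 := by
    rintro rfl
    simp at hT
  -- Writing T = s/w turns the product into s^(-m) (w^m - w^(m-1) s w'), so the coefficient wanted
  -- is that of s^m in the bracket.
  obtain ⟨w, hw⟩ : ∃ w : PowerSeries k, HahnSeries.ofPowerSeries ℤ k w = s * T⁻¹ := by
    apply exists_ofPowerSeries_eq
    have h1 : (s * T⁻¹).orderTop + T.orderTop = s.orderTop := by
      rw [← HahnSeries.orderTop_mul, mul_assoc, inv_mul_cancel₀ hT0, mul_one]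
    rw [hT, hs, HahnSeries.orderTop_single one_ne_zero] at h1
    have h2 : s * T⁻¹ ≠ 0 := mul_ne_zero hs0 (inv_ne_zero hT0)
    rw [mem_integralSeries]
    rw [← hs] at h1
    rw [← HahnSeries.order_eq_orderTop_of_ne_zero h2] at *
    norm_cast at *
    omega
  set w' := HahnSeries.ofPowerSeries ℤ k w with hw'
  have hw0 : w' ≠ 0 := by
    rw [hw]; exact mul_ne_zero hs0 (inv_ne_zero hT0)
  have hTw : T = s * w'⁻¹ := by
    rw [hw]
    field_simp
  have hθs : eulerDerivation k s = s := by
    rw [hs, eulerDerivation_single]; simp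
  have hθw : eulerDerivation k (w'⁻¹) = - (w'⁻¹ ^ 2 * eulerDerivation k w') := by
    rw [Derivation.leibniz_inv]
    simp
  have hθT : eulerDerivation k T = s * w'⁻¹ - s * w'⁻¹ ^ 2 * eulerDerivation k w' := by
    rw [hTw, Derivation.leibniz, hθw, hθs, smul_eq_mul, smul_eq_mul]
    ring
  have hpow : T ^ (-(m + 1) : ℤ) = s ^ (-(m : ℤ)) * (s⁻¹ * w' ^ (m + 1)) := by
    rw [hTw, show (-(m + 1 : ℤ)) = -((m + 1 : ℕ) : ℤ) by push_cast; ring, zpow_neg, zpow_natCast,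
      zpow_neg, zpow_natCast, mul_pow, inv_pow, mul_inv, inv_inv, pow_succ s]
    field_simp
  have key : T ^ (-(m + 1) : ℤ) * eulerDerivation k T =
      s ^ (-(m : ℤ)) * (w' ^ m - w' ^ m * (w'⁻¹ * eulerDerivation k w')) := by
    rw [hpow, hθT]
    field_simp
    ring
  have hsm : s ^ (-(m : ℤ)) = HahnSeries.single (-(m : ℤ)) (1 : k) := by
    exact (RatFunc.single_zpow _).symm
  rcases m with _ | m
  · rw [if_pos rfl, key]
    simp only [Nat.cast_zero, neg_zero, zpow_zero, pow_zero, one_mul]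
    have hw1 : 0 ≤ (w'⁻¹).orderTop := by
      have : T.orderTop = s.orderTop + (w'⁻¹).orderTop := by
        rw [← HahnSeries.orderTop_mul, ← hTw]
      rw [hT, hs, HahnSeries.orderTop_single one_ne_zero] at this
      rw [← HahnSeries.order_eq_orderTop_of_ne_zero (inv_ne_zero hw0)] at *
      norm_cast at *
      omega
    rw [HahnSeries.coeff_sub, HahnSeries.coeff_eq_zero_of_lt_orderTop (x := w'⁻¹ * _)]
    · simp
    · rw [HahnSeries.orderTop_mul]
      have := one_le_orderTop_eulerDerivation (mem_integralSeries.mp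
        (ofPowerSeries_mem_integralSeries w))
      exact lt_of_lt_of_le (by norm_num) (add_le_add hw1 this)
  · rw [if_neg (Nat.succ_ne_zero m), key, hsm]
    have h1 : w' ^ (m + 1) * (w'⁻¹ * eulerDerivation k w') = w' ^ m * eulerDerivation k w' := by
      field_simp
      ring
    rw [h1, HahnSeries.coeff_single_mul, one_mul, hw', eulerDerivation_coe, ← map_pow, ← map_pow,
      ← map_mul, ← map_sub, PowerSeries.coeff_coe, if_neg (by omega)]
    rw [show (0 - -((m + 1 : ℕ) : ℤ)).natAbs = m + 1 by omega, map_sub,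
      coeff_pow_eq_coeff_pow_mul_derivative, sub_self]

end LaurentSeries

/-! ### Points, differentials and residues given by an embedding in Laurent series -/

section Embedding

variable {k F : Type*} [Field k] [Field F] [Algebra k F]

theorem order_inv (f : LaurentSeries k) : (f⁻¹).order = -f.order := by
  rcases eq_or_ne f 0 with rfl | hf
  · simp
  · have := HahnSeries.order_mul (inv_ne_zero hf) hf
    rw [inv_mul_cancel₀ hf, HahnSeries.order_one] at this
    omega

theorem order_div {f g : LaurentSeries k} (hf : f ≠ 0) (hg : g ≠ 0) :
    (f / g).order = f.order - g.order := by
  rw [div_eq_mul_inv, HahnSeries.order_mul hf (inv_ne_zero hg), order_inv, sub_eq_add_neg]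

theorem le_orderTop_iff_order {f : LaurentSeries k} (hf : f ≠ 0) {n : ℤ} :
    (n : WithTop ℤ) ≤ f.orderTop ↔ n ≤ f.order := by
  rw [← HahnSeries.order_eq_orderTop_of_ne_zero hf, WithTop.coe_le_coe]

/-- The point of the curve at which an embedding of the function field in the Laurent series
centres. -/
def placeOf (φ : F →ₐ[k] LaurentSeries k) {z : F} (hz0 : z ≠ 0) (hz : 0 < (φ z).orderTop) :
    Place k F where
  ring := (integralSeries k).comap φ.toRingHom
  algebraMap_mem c := by
    change φ (algebraMap k F c) ∈ integralSeries k
    rw [AlgHom.commutes]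
    exact algebraMap_mem_integralSeries c
  isDVR := by
    have hmem : ∀ w : F, w ∈ (integralSeries k).comap φ.toRingHom ↔ 0 ≤ (φ w).orderTop :=
      fun w => Iff.rfl
    refine { principal := fun I => ?_, not_a_field' := fun h => ?_ }
    · by_cases hI : I = ⊥
      · exact ⟨⟨0, by rw [hI]; exact (Submodule.span_zero_singleton _).symm⟩⟩
      -- A nonzero element of least order generates the ideal.
      obtain ⟨a, ⟨haI, ha0⟩, hmin⟩ :=
        (measure fun a : (integralSeries k).comap φ.toRingHom => (φ (a : F)).order.toNat).wf.has_min
          {a | a ∈ I ∧ a ≠ 0} (Submodule.exists_mem_ne_zero_of_ne_bot hI)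
      have ha0' : (a : F) ≠ 0 := fun h => ha0 (Subtype.ext h)
      have hφa : φ (a : F) ≠ 0 := by simpa using ha0'
      refine ⟨⟨a, le_antisymm (fun b hb => ?_) ?_⟩⟩
      · rcases eq_or_ne b 0 with rfl | hb0
        · exact zero_mem _
        have hb0' : (b : F) ≠ 0 := fun h => hb0 (Subtype.ext h)
        have hφb : φ (b : F) ≠ 0 := by simpa using hb0'
        have hab : (φ (a : F)).order ≤ (φ (b : F)).order := by
          have h1 := hmin b ⟨hb, hb0⟩
          have h2 := HahnSeries.zero_le_orderTop_iff.mp ((hmem a).mp a.2)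
          have h3 := HahnSeries.zero_le_orderTop_iff.mp ((hmem b).mp b.2)
          change ¬ (φ (b : F)).order.toNat < (φ (a : F)).order.toNat at h1
          omega
        have hq : (b : F) / a ∈ (integralSeries k).comap φ.toRingHom := by
          rw [hmem, HahnSeries.zero_le_orderTop_iff, map_div₀, order_div hφb hφa]
          omega
        refine Submodule.mem_span_singleton.mpr ⟨⟨_, hq⟩, Subtype.ext ?_⟩
        exact div_mul_cancel₀ _ ha0'
      · rw [Submodule.span_singleton_le_iff_mem]
        exact haI
    · have hzm : z ∈ (integralSeries k).comap φ.toRingHom := (hmem z).mpr hz.le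
      have hz1 : (⟨z, hzm⟩ : (integralSeries k).comap φ.toRingHom) ∈
          IsLocalRing.maximalIdeal ((integralSeries k).comap φ.toRingHom) := by
        rw [IsLocalRing.mem_maximalIdeal, mem_nonunits_iff]
        intro hu
        obtain ⟨u, hu⟩ := hu.exists_right_inv
        have hu' : z * (u : F) = 1 := congrArg Subtype.val hu
        have h3 := congrArg HahnSeries.orderTop (congrArg φ hu')
        rw [map_mul, map_one, HahnSeries.orderTop_mul, HahnSeries.orderTop_one] at h3
        exact absurd h3 (add_pos_of_pos_of_nonneg hz ((hmem u).mp u.2)).ne'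
      rw [h] at hz1
      exact hz0 (congrArg Subtype.val ((Submodule.mem_bot _).mp hz1))

theorem mem_placeOf {φ : F →ₐ[k] LaurentSeries k} {z : F} {hz0 : z ≠ 0}
    {hz : 0 < (φ z).orderTop} {w : F} :
    w ∈ (placeOf φ hz0 hz).ring ↔ 0 ≤ (φ w).orderTop := Iff.rfl

theorem mem_nonunits_placeOf {φ : F →ₐ[k] LaurentSeries k} {z : F} {hz0 : z ≠ 0}
    {hz : 0 < (φ z).orderTop} {w : F} :
    w ∈ (placeOf φ hz0 hz).ring.nonunits ↔ 0 < (φ w).orderTop := by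
  rcases eq_or_ne w 0 with rfl | hw
  · simp
  have hφw : φ w ≠ 0 := by simpa using hw
  have h1 : w ∈ (placeOf φ hz0 hz).ring.nonunits ↔ w⁻¹ ∉ (placeOf φ hz0 hz).ring := by
    rw [ValuationSubring.mem_nonunits_iff, ← ValuationSubring.valuation_le_one_iff, map_inv₀,
      not_le, one_lt_inv₀]
    exact zero_lt_iff.mpr (by simpa using hw)
  rw [h1, mem_placeOf, map_inv₀, HahnSeries.zero_le_orderTop_iff, order_inv,
    HahnSeries.zero_lt_orderTop_iff hφw]
  omega

/-- The Laurent series as a vector space over an embedded field. -/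
abbrev embeddingModule (φ : F →ₐ[k] LaurentSeries k) : Module F (LaurentSeries k) :=
  Module.compHom _ φ.toRingHom

/-- The derivation `a ↦ s dφ(a)/ds`. -/
def pullbackDerivation (φ : F →ₐ[k] LaurentSeries k) :
    letI := embeddingModule φ
    Derivation k F (LaurentSeries k) :=
  letI := embeddingModule φ
  Derivation.mk' ((eulerDerivation k).toLinearMap ∘ₗ φ.toLinearMap) fun a b => by
    change eulerDerivation k (φ (a * b)) =
      φ a * eulerDerivation k (φ b) + φ b * eulerDerivation k (φ a)
    rw [map_mul, Derivation.leibniz, smul_eq_mul, smul_eq_mul]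

theorem embeddingModule_isScalarTower (φ : F →ₐ[k] LaurentSeries k) :
    letI := embeddingModule φ
    IsScalarTower k F (LaurentSeries k) :=
  let _ := embeddingModule φ
  ⟨fun c a f => by
    change φ (c • a) * f = c • (φ a * f)
    rw [map_smul, smul_mul_assoc]⟩

/-- The map `h da ↦ φ(h) s dφ(a)/ds` from differentials to Laurent series in `s`. -/
def pullback (φ : F →ₐ[k] LaurentSeries k) : Ω[F⁄k] →ₗ[k] LaurentSeries k :=
  letI := embeddingModule φ
  haveI := embeddingModule_isScalarTower φ
  (pullbackDerivation φ).liftKaehlerDifferential.restrictScalars k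

theorem pullback_D (φ : F →ₐ[k] LaurentSeries k) (a : F) :
    pullback φ (KaehlerDifferential.D k F a) = eulerDerivation k (φ a) := by
  let _ := embeddingModule φ
  have := embeddingModule_isScalarTower φ
  change (pullbackDerivation φ).liftKaehlerDifferential (KaehlerDifferential.D k F a) = _
  rw [Derivation.liftKaehlerDifferential_comp_D]
  rfl

theorem pullback_smul (φ : F →ₐ[k] LaurentSeries k) (h : F) (ω : Ω[F⁄k]) :
    pullback φ (h • ω) = φ h * pullback φ ω := by
  let _ := embeddingModule φ
  have := embeddingModule_isScalarTower φ
  change (pullbackDerivation φ).liftKaehlerDifferential (h • ω) = _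
  rw [map_smul]
  rfl

/-- Since s d/ds is used in place of d/ds, pullbacks are shifted by one: it kills constant terms, so
regular forms land in order at least 1, and the residue sits in degree 0. -/
theorem one_le_orderTop_pullback {φ : F →ₐ[k] LaurentSeries k} {P : Place k F}
    (hP : ∀ w ∈ P.ring, 0 ≤ (φ w).orderTop) {ω : Ω[F⁄k]} (hω : ω ∈ regularDifferentialsAt P) :
    1 ≤ (pullback φ ω).orderTop := by
  induction hω using Submodule.span_induction with
  | mem ω h =>
    obtain ⟨h, hh, a, ha, rfl⟩ := h
    rw [pullback_smul, pullback_D, HahnSeries.orderTop_mul]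
    simpa using add_le_add (hP h hh) (one_le_orderTop_eulerDerivation (hP a ha))
  | zero => simp
  | add ω₁ ω₂ _ _ h₁ h₂ =>
    rw [map_add]
    exact le_trans (le_min h₁ h₂) HahnSeries.min_orderTop_le_orderTop_add
  | smul c ω _ h =>
    rw [map_smul]
    exact h.trans (HahnSeries.orderTop_le_orderTop_smul c _)

/-- In the factorization t = z · (t/z) the factor z is not a unit, so irreducibility of t makes t/z
a unit. -/
theorem IsUniformizer.orderTop_eq_one {φ : F →ₐ[k] LaurentSeries k} {z : F} {hz0 : z ≠ 0}
    (hz : (φ z).orderTop = 1) {hz' : 0 < (φ z).orderTop} {t : F}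
    (ht : IsUniformizer (placeOf φ hz0 hz') t) : (φ t).orderTop = 1 := by
  obtain ⟨htm, ht⟩ := ht
  have ht0 : t ≠ 0 := fun h => ht.ne_zero (Subtype.ext h)
  have hφt : φ t ≠ 0 := by simpa using ht0
  have hφz : φ z ≠ 0 := by simpa using hz0
  have h0 : 0 ≤ (φ t).order := HahnSeries.zero_le_orderTop_iff.mp (mem_placeOf.mp htm)
  have hz1 : (φ z).order = 1 := by
    rw [← HahnSeries.order_eq_orderTop_of_ne_zero hφz] at hz
    exact_mod_cast hz
  have h1 : (φ t).order ≠ 0 := fun h => ht.not_isUnit (by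
    refine IsUnit.of_mul_eq_one ⟨t⁻¹, ?_⟩ (Subtype.ext (mul_inv_cancel₀ ht0))
    rw [mem_placeOf, HahnSeries.zero_le_orderTop_iff, map_inv₀, order_inv, h, neg_zero])
  have h2 : t / z ∈ (placeOf φ hz0 hz').ring := by
    rw [mem_placeOf, HahnSeries.zero_le_orderTop_iff, map_div₀, order_div hφt hφz]
    omega
  have hzm : z ∈ (placeOf φ hz0 hz').ring := mem_placeOf.mpr hz'.le
  rcases ht.isUnit_or_isUnit (a := ⟨z, hzm⟩) (b := ⟨t / z, h2⟩)
    (Subtype.ext (by simp [mul_div_cancel₀ _ hz0])) with hu | hu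
  · obtain ⟨u, hu⟩ := hu.exists_right_inv
    have hu' : z * (u : F) = 1 := congrArg Subtype.val hu
    have h3 := congrArg HahnSeries.orderTop (congrArg φ hu')
    rw [map_mul, map_one, HahnSeries.orderTop_mul, HahnSeries.orderTop_one] at h3
    exact absurd h3 (add_pos_of_pos_of_nonneg hz' (mem_placeOf.mp u.2)).ne'
  · obtain ⟨u, hu⟩ := hu.exists_right_inv
    have hu' : t / z * (u : F) = 1 := congrArg Subtype.val hu
    have hu0 : (u : F) ≠ 0 := by
      rintro h
      simp [h] at hu'
    have hφu : φ (u : F) ≠ 0 := by simpa using hu0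
    have h3 := congrArg HahnSeries.order (congrArg φ hu')
    rw [map_mul, map_one, map_div₀, HahnSeries.order_mul (div_ne_zero hφt hφz) hφu,
      HahnSeries.order_one, order_div hφt hφz] at h3
    have h4 : 0 ≤ (φ (u : F)).order :=
      HahnSeries.zero_le_orderTop_iff.mp (mem_placeOf.mp u.2)
    rw [← HahnSeries.order_eq_orderTop_of_ne_zero hφt]
    norm_cast
    omega

theorem coeff_eq_zero_of_one_le {f : LaurentSeries k} (hf : 1 ≤ f.orderTop) : f.coeff 0 = 0 :=
  HahnSeries.coeff_eq_zero_of_lt_orderTop (lt_of_lt_of_le (by norm_num) hf)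

/-- Independence of the uniformizer. The expansion is cut off at order 0: the remainder times dt is
regular and contributes nothing, and among the finitely many terms tⁱ dt with i < 0 only i = -1 has
a residue, by `coeff_zpow_mul_eulerDerivation`. -/
theorem IsResidue.eq_coeff_pullback {φ : F →ₐ[k] LaurentSeries k} {z : F} {hz0 : z ≠ 0}
    (hz : (φ z).orderTop = 1) {hz' : 0 < (φ z).orderTop} {ω : Ω[F⁄k]} {a : k}
    (ha : IsResidue (placeOf φ hz0 hz') ω a) : a = (pullback φ ω).coeff 0 := by
  obtain ⟨t, h, s, ht, rfl, hs, rfl⟩ := ha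
  have ht1 := ht.orderTop_eq_one hz
  obtain ⟨b, hb, hbs⟩ := hs 0
  rw [zpow_zero, mul_one, sub_eq_iff_eq_add] at hbs
  rw [pullback_smul, pullback_D, hbs, map_add, add_mul, map_sum, Finset.sum_mul,
    HahnSeries.coeff_add, HahnSeries.coeff_sum]
  have hreg : (φ b * eulerDerivation k (φ t)).coeff 0 = 0 := by
    apply coeff_eq_zero_of_one_le
    rw [HahnSeries.orderTop_mul]
    have h1 : 0 ≤ (φ t).orderTop := by rw [ht1]; exact zero_le_one
    simpa using add_le_add (mem_placeOf.mp hb) (one_le_orderTop_eulerDerivation h1)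
  have hterm : ∀ i ∈ Finset.Ico s.order 0, (φ (s.coeff i • t ^ i) *
      eulerDerivation k (φ t)).coeff 0 = if i = -1 then s.coeff (-1) else 0 := by
    intro i hi
    obtain ⟨m, rfl⟩ : ∃ m : ℕ, i = -(m + 1) := ⟨(-i - 1).toNat, by
      have := (Finset.mem_Ico.mp hi).2
      omega⟩
    rw [map_smul, smul_mul_assoc, HahnSeries.coeff_smul, map_zpow₀,
      coeff_zpow_mul_eulerDerivation ht1]
    rcases m with _ | m
    · simp
    · rw [if_neg (by omega), if_neg (by push_cast; omega), smul_zero]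
  rw [hreg, zero_add, Finset.sum_congr rfl hterm, Finset.sum_ite_eq']
  split_ifs with h1
  · rfl
  · rw [Finset.mem_Ico, not_and_or, not_le, not_lt] at h1
    exact HahnSeries.coeff_eq_zero_of_lt_order (by omega)

/-- Existence of a residue, which the choice in `residue` needs. When z maps to s, the series φ h is
itself the Laurent expansion of h in powers of z. -/
theorem isResidue_coeff_pullback {φ : F →ₐ[k] LaurentSeries k} {z : F} {hz0 : z ≠ 0}
    (hz : φ z = HahnSeries.single 1 1) {hz' : 0 < (φ z).orderTop} {ω : Ω[F⁄k]} {h : F}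
    (hω : ω = h • KaehlerDifferential.D k F z) :
    IsResidue (placeOf φ hz0 hz') ω ((pullback φ ω).coeff 0) := by
  have hz1 : (φ z).orderTop = 1 := by
    rw [hz, HahnSeries.orderTop_single one_ne_zero]; rfl
  have hpow : ∀ n : ℤ, φ (z ^ n) = HahnSeries.single n 1 := fun n => by
    rw [map_zpow₀, hz, RatFunc.single_zpow n]
  refine ⟨z, h, φ h, ⟨mem_placeOf.mpr hz'.le, ?_⟩, hω, ?_, ?_⟩
  · refine ⟨fun hu => ?_, fun {a b} hab => ?_⟩
    · obtain ⟨u, hu⟩ := hu.exists_right_inv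
      have hu' : z * (u : F) = 1 := congrArg Subtype.val hu
      have h3 := congrArg HahnSeries.orderTop (congrArg φ hu')
      rw [map_mul, map_one, HahnSeries.orderTop_mul, HahnSeries.orderTop_one] at h3
      exact absurd h3 (add_pos_of_pos_of_nonneg hz' (mem_placeOf.mp u.2)).ne'
    · have hab' : z = (a : F) * b := congrArg Subtype.val hab
      have ha0 : (a : F) ≠ 0 := fun h => hz0 (by rw [hab', h, zero_mul])
      have hb0 : (b : F) ≠ 0 := fun h => hz0 (by rw [hab', h, mul_zero])
      have hφa : φ (a : F) ≠ 0 := by simpa using ha0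
      have hφb : φ (b : F) ≠ 0 := by simpa using hb0
      have h3 := congrArg HahnSeries.order (congrArg φ hab')
      rw [hz, map_mul, HahnSeries.order_mul hφa hφb, HahnSeries.order_single one_ne_zero] at h3
      have h4 := HahnSeries.zero_le_orderTop_iff.mp (mem_placeOf.mp a.2)
      have h5 := HahnSeries.zero_le_orderTop_iff.mp (mem_placeOf.mp b.2)
      rcases eq_or_ne (φ (a : F)).order 0 with h6 | h6
      · left
        refine IsUnit.of_mul_eq_one ⟨(a : F)⁻¹, ?_⟩ (Subtype.ext (mul_inv_cancel₀ ha0))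
        rw [mem_placeOf, HahnSeries.zero_le_orderTop_iff, map_inv₀, order_inv, h6, neg_zero]
      · right
        refine IsUnit.of_mul_eq_one ⟨(b : F)⁻¹, ?_⟩ (Subtype.ext (mul_inv_cancel₀ hb0))
        rw [mem_placeOf, HahnSeries.zero_le_orderTop_iff, map_inv₀, order_inv]
        omega
  · intro N
    refine ⟨(h - ∑ i ∈ Finset.Ico (φ h).order N, (φ h).coeff i • z ^ i) * z ^ (-N), ?_, ?_⟩
    · rw [mem_placeOf, map_mul, hpow, HahnSeries.le_orderTop_iff_forall]
      intro i hi
      have hi0 : i < 0 := by exact_mod_cast hi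
      rw [HahnSeries.coeff_mul_single, mul_one, map_sub, map_sum, HahnSeries.coeff_sub,
        HahnSeries.coeff_sum]
      simp only [map_smul, hpow, HahnSeries.coeff_smul, HahnSeries.coeff_single, smul_eq_mul,
        mul_ite, mul_one, mul_zero]
      rw [Finset.sum_ite_eq]
      split_ifs with h1
      · exact sub_self _
      · rw [sub_zero]
        rw [Finset.mem_Ico, not_and_or, not_le, not_lt] at h1
        exact HahnSeries.coeff_eq_zero_of_lt_order (by omega)
    · rw [mul_assoc, ← zpow_add₀ hz0, neg_add_cancel, zpow_zero, mul_one]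
  · rw [hω, pullback_smul, pullback_D, hz, eulerDerivation_single, HahnSeries.coeff_mul_single]
    simp

theorem residue_placeOf {φ : F →ₐ[k] LaurentSeries k} {z : F} {hz0 : z ≠ 0}
    (hz : φ z = HahnSeries.single 1 1) {hz' : 0 < (φ z).orderTop} {ω : Ω[F⁄k]} {h : F}
    (hω : ω = h • KaehlerDifferential.D k F z) :
    residue (placeOf φ hz0 hz') ω = (pullback φ ω).coeff 0 := by
  have hz1 : (φ z).orderTop = 1 := by
    rw [hz, HahnSeries.orderTop_single one_ne_zero]; rfl
  exact IsResidue.eq_coeff_pullback hz1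
    (Classical.epsilon_spec (p := IsResidue (placeOf φ hz0 hz') ω)
      ⟨_, isResidue_coeff_pullback hz hω⟩)

end Embedding

/-! ### Hensel's lemma for power series and the local parameters it yields -/

section Hensel

variable {k : Type*} [Field k]

/-- The map z ↦ c + X Q(z) is a contraction for the X-adic topology, and its iterates converge
because power series are X-adically complete. -/
theorem exists_eq_add_X_mul_eval (Q : (PowerSeries k)[X]) (c : PowerSeries k) :
    ∃ z : PowerSeries k, z = c + PowerSeries.X * Q.eval z := by
  set I : Ideal (PowerSeries k) := Ideal.span {PowerSeries.X} with hI
  let step : PowerSeries k → PowerSeries k := fun z => c + PowerSeries.X * Q.eval z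
  have hstep : ∀ (n : ℕ) (a b : PowerSeries k), a - b ∈ I ^ n → step a - step b ∈ I ^ (n + 1) := by
    intro n a b hab
    have h1 : step a - step b = PowerSeries.X * (Q.eval a - Q.eval b) := by
      simp only [step]; ring
    rw [h1, pow_succ']
    refine Ideal.mul_mem_mul (Ideal.mem_span_singleton_self _) ?_
    exact Ideal.mem_of_dvd _ (Polynomial.sub_dvd_eval_sub a b Q) hab
  let u : ℕ → PowerSeries k := fun n => step^[n] 0
  have hu : ∀ n, u (n + 1) = step (u n) := fun n => Function.iterate_succ_apply' step n 0
  have hsucc : ∀ n, u (n + 1) - u n ∈ I ^ n := by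
    intro n
    induction n with
    | zero => simp
    | succ n ih =>
      have := hu n
      rw [hu (n + 1)]
      nth_rw 2 [hu n]
      exact hstep n _ _ ih
  have hcauchy : ∀ {m n : ℕ}, m ≤ n → u m ≡ u n [SMOD (I ^ m • ⊤ : Ideal (PowerSeries k))] := by
    intro m n hmn
    rw [SModEq.sub_mem, smul_eq_mul, Ideal.mul_top]
    induction n, hmn using Nat.le_induction with
    | base => simp
    | succ n hmn ih =>
      have := Ideal.sub_mem _ ih (Ideal.pow_le_pow_right hmn (hsucc n))
      simpa using this
  obtain ⟨z, hz⟩ := IsPrecomplete.prec' u hcauchy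
  refine ⟨z, ?_⟩
  have hz' : ∀ n, u n - z ∈ I ^ n := fun n => by
    have := hz n
    rwa [SModEq.sub_mem, smul_eq_mul, Ideal.mul_top] at this
  rw [← sub_eq_zero]
  refine IsHausdorff.haus' (I := I) _ fun n => ?_
  rw [SModEq.zero, smul_eq_mul, Ideal.mul_top]
  have h1 := Ideal.pow_le_pow_right n.le_succ (hstep n _ _ (hz' n))
  have h2 := Ideal.pow_le_pow_right n.le_succ (hz' (n + 1))
  have h3 := Ideal.sub_mem _ h1 h2
  rw [hu, sub_sub_sub_cancel_left] at h3
  exact h3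

/-- Hensel's lemma for power series. -/
theorem exists_eval_eq_zero (G : (PowerSeries k)[X]) (c : k)
    (h0 : (G.map PowerSeries.constantCoeff).eval c = 0)
    (h1 : (Polynomial.derivative (G.map PowerSeries.constantCoeff)).eval c ≠ 0) :
    ∃ w : PowerSeries k, G.eval w = 0 ∧ PowerSeries.constantCoeff w = c := by
  have hcc : ∀ H : (PowerSeries k)[X], PowerSeries.constantCoeff (H.eval (PowerSeries.C c)) =
      (H.map PowerSeries.constantCoeff).eval c := fun H => by
    rw [Polynomial.eval_map, ← Polynomial.eval₂_at_apply, PowerSeries.constantCoeff_C]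
  obtain ⟨g0, hg0⟩ : PowerSeries.X ∣ G.eval (PowerSeries.C c) := by
    rw [PowerSeries.X_dvd_iff, hcc, h0]
  obtain ⟨g1, hg1⟩ : ∃ g1, (Polynomial.derivative G).eval (PowerSeries.C c) * g1 = 1 := by
    apply IsUnit.exists_right_inv
    rw [PowerSeries.isUnit_iff_constantCoeff, hcc, ← Polynomial.derivative_map]
    exact h1.isUnit
  -- With w = c + X z, Taylor expansion reads G(w) = G(c) + G'(c) X z + Q(z) X² z². Dividing by X
  -- and by the unit G'(c) turns G(w) = 0 into a fixed point equation for z.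
  obtain ⟨Q, hQ⟩ := Polynomial.binomExpansion (G.map Polynomial.C)
    (Polynomial.C (PowerSeries.C c)) (Polynomial.C PowerSeries.X * Polynomial.X)
  obtain ⟨z, hz⟩ := exists_eq_add_X_mul_eval (-Polynomial.C g1 * Q * Polynomial.X ^ 2) (-g1 * g0)
  refine ⟨PowerSeries.C c + PowerSeries.X * z, ?_, by simp⟩
  have h2 := congrArg (Polynomial.eval z) hQ
  rw [Polynomial.derivative_map] at h2
  simp only [Polynomial.eval_map, Polynomial.eval_add, Polynomial.eval_mul, Polynomial.eval_pow,
    Polynomial.eval_C, Polynomial.eval_X] at h2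
  rw [← Polynomial.coe_evalRingHom, Polynomial.hom_eval₂, Polynomial.hom_eval₂,
    Polynomial.hom_eval₂] at h2
  have h3 : (Polynomial.evalRingHom z).comp Polynomial.C = RingHom.id (PowerSeries k) := by
    ext a; simp
  simp only [h3, Polynomial.eval₂_id, map_add, map_mul, Polynomial.coe_evalRingHom,
    Polynomial.eval_C, Polynomial.eval_X] at h2
  rw [h2, hg0]
  have h4 := congrArg (fun a => (Polynomial.derivative G).eval (PowerSeries.C c) * a) hz
  simp only [Polynomial.eval_mul, Polynomial.eval_neg, Polynomial.eval_C, Polynomial.eval_pow,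
    Polynomial.eval_X] at h4
  linear_combination PowerSeries.X * h4 +
    (- PowerSeries.X * g0 - PowerSeries.X ^ 2 * Q.eval z * z ^ 2) * hg1

/-- The derivative of Y^p - Y - q is -1, so any root of the reduction lifts. -/
theorem exists_pow_sub_self_eq [IsAlgClosed k] {p : ℕ} (hp : 2 ≤ p) [CharP k p]
    (q : PowerSeries k) : ∃ η : PowerSeries k, η ^ p - η = q := by
  obtain ⟨c, hc⟩ := IsAlgClosed.exists_root (Polynomial.X ^ p - Polynomial.X -
      Polynomial.C (PowerSeries.constantCoeff q)) (by
      rw [sub_sub]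
      have h1 : (Polynomial.X + Polynomial.C (PowerSeries.constantCoeff q)).degree <
          ((Polynomial.X : k[X]) ^ p).degree := by
        rw [Polynomial.degree_X_add_C, Polynomial.degree_X_pow]
        exact_mod_cast hp
      rw [Polynomial.degree_sub_eq_left_of_degree_lt h1, Polynomial.degree_X_pow]
      exact_mod_cast (by omega : p ≠ 0))
  obtain ⟨η, hη, -⟩ := exists_eval_eq_zero
    (Polynomial.X ^ p - Polynomial.X - Polynomial.C q) c
    (by simpa using hc) (by simp [Polynomial.derivative_X_pow])
  refine ⟨η, ?_⟩
  simpa [sub_eq_zero] using hη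

/-- With x = ρ + s^p w and y = s^(-l), the equation y^p - y = f / ((x - ρ)^l M) becomes the
displayed one after clearing denominators. Modulo s it reads f(ρ) = w^l M(ρ), which has a simple
nonzero root because l is invertible in k. -/
theorem exists_ramified_parameter [IsAlgClosed k] {p l : ℕ} (hp : 2 ≤ p) (hl : (l : k) ≠ 0)
    (f M : k[X]) (ρ : k) (hf : f.eval ρ ≠ 0) (hM : M.eval ρ ≠ 0) :
    ∃ w : PowerSeries k, PowerSeries.constantCoeff w ≠ 0 ∧
      Polynomial.aeval (PowerSeries.C ρ + PowerSeries.X ^ p * w) f =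
        (1 - PowerSeries.X ^ ((p - 1) * l)) * w ^ l *
          Polynomial.aeval (PowerSeries.C ρ + PowerSeries.X ^ p * w) M := by
  have hl0 : l ≠ 0 := by rintro rfl; simp at hl
  obtain ⟨c, hc⟩ := IsAlgClosed.exists_pow_nat_eq (f.eval ρ / M.eval ρ) (Nat.pos_of_ne_zero hl0)
  have hc0 : c ≠ 0 := by
    rintro rfl
    rw [zero_pow hl0] at hc
    exact div_ne_zero hf hM hc.symm
  let lin : (PowerSeries k)[X] :=
    Polynomial.C (PowerSeries.C ρ) + Polynomial.C (PowerSeries.X ^ p) * Polynomial.X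
  let G : (PowerSeries k)[X] := (f.map PowerSeries.C).comp lin -
    Polynomial.C (1 - PowerSeries.X ^ ((p - 1) * l)) * Polynomial.X ^ l *
      (M.map PowerSeries.C).comp lin
  have hcomp : ∀ P : k[X], ((P.map PowerSeries.C).comp lin).map PowerSeries.constantCoeff =
      Polynomial.C (P.eval ρ) := by
    intro P
    have h1 : (PowerSeries.constantCoeff (R := k)).comp PowerSeries.C = RingHom.id k := by
      ext; simp
    rw [Polynomial.map_comp, Polynomial.map_map, h1, Polynomial.map_id]
    have h2 : lin.map PowerSeries.constantCoeff = Polynomial.C ρ := by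
      simp [lin, show p ≠ 0 by omega]
    rw [h2, Polynomial.comp_C]
  have hG : G.map PowerSeries.constantCoeff = Polynomial.C (f.eval ρ) -
      Polynomial.X ^ l * Polynomial.C (M.eval ρ) := by
    have h0 : (p - 1) * l ≠ 0 := mul_ne_zero (by omega) hl0
    simp only [G, Polynomial.map_sub, Polynomial.map_mul, hcomp]
    simp [h0]
  obtain ⟨w, hw, hwc⟩ := exists_eval_eq_zero G c
    (by
      rw [hG]
      simp only [Polynomial.eval_sub, Polynomial.eval_mul, Polynomial.eval_pow,
        Polynomial.eval_C, Polynomial.eval_X, hc]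
      field_simp
      ring)
    (by
      rw [hG]
      simp only [Polynomial.derivative_sub, Polynomial.derivative_mul, Polynomial.derivative_C,
        Polynomial.derivative_X_pow, mul_zero, add_zero, zero_sub]
      rw [Polynomial.eval_neg, neg_ne_zero]
      simp only [Polynomial.eval_mul, Polynomial.eval_pow, Polynomial.eval_C, Polynomial.eval_X]
      exact mul_ne_zero (mul_ne_zero hl (pow_ne_zero _ hc0)) hM)
  refine ⟨w, hwc ▸ hc0, ?_⟩
  have hev : ∀ P : k[X], ((P.map PowerSeries.C).comp lin).eval w =
      Polynomial.aeval (PowerSeries.C ρ + PowerSeries.X ^ p * w) P := by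
    intro P
    rw [Polynomial.eval_comp, Polynomial.eval_map]
    simp only [lin, Polynomial.eval_add, Polynomial.eval_mul, Polynomial.eval_C,
      Polynomial.eval_X]
    rfl
  have h := hw
  simp only [G, Polynomial.eval_sub, Polynomial.eval_mul, hev, Polynomial.eval_C,
    Polynomial.eval_pow, Polynomial.eval_X] at h
  exact sub_eq_zero.mp h

end Hensel

/-! ### Orders of rational functions of a Laurent series -/

section Orders

variable {k : Type*} [Field k]

theorem orderTop_algebraMap {c : k} (hc : c ≠ 0) :
    (algebraMap k (LaurentSeries k) c).orderTop = 0 := by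
  rw [algebraMap_laurentSeries, HahnSeries.C_apply, HahnSeries.orderTop_single hc]
  rfl

theorem order_algebraMap (c : k) : (algebraMap k (LaurentSeries k) c).order = 0 := by
  rw [algebraMap_laurentSeries]
  exact HahnSeries.order_C

/-- If nonzero terms of a sum have distinct orders, the order of the sum bounds the orders of
the terms. -/
theorem le_orderTop_of_le_orderTop_sum {ι : Type*} {S : Finset ι} {g : ι → LaurentSeries k}
    (hg : ∀ i ∈ S, ∀ j ∈ S, g i ≠ 0 → g j ≠ 0 → (g i).order = (g j).order → i = j) {N : ℤ}
    (hN : N ≤ (∑ i ∈ S, g i).orderTop) {i : ι} (hi : i ∈ S) : N ≤ (g i).orderTop := by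
  classical
  by_contra hlt
  have hgi : g i ≠ 0 := by
    intro h
    simp [h] at hlt
  rw [le_orderTop_iff_order hgi, not_le] at hlt
  obtain ⟨m, hm, hmin⟩ := (S.filter fun j => g j ≠ 0).exists_min_image (fun j => (g j).order)
    ⟨i, Finset.mem_filter.mpr ⟨hi, hgi⟩⟩
  rw [Finset.mem_filter] at hm
  have hmN : (g m).order < N :=
    lt_of_le_of_lt (hmin i (Finset.mem_filter.mpr ⟨hi, hgi⟩)) hlt
  have h1 : (∑ i ∈ S, g i).coeff (g m).order = (g m).coeff (g m).order := by
    rw [HahnSeries.coeff_sum]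
    refine Finset.sum_eq_single_of_mem m hm.1 fun j hj hjm => ?_
    by_cases hgj : g j = 0
    · simp [hgj]
    refine HahnSeries.coeff_eq_zero_of_lt_order
      (lt_of_le_of_ne (hmin j (Finset.mem_filter.mpr ⟨hj, hgj⟩)) fun h => hjm ?_)
    exact (hg m hm.1 j hj hm.2 hgj h).symm
  rw [HahnSeries.coeff_eq_zero_of_lt_orderTop (lt_of_lt_of_le (by exact_mod_cast hmN) hN)] at h1
  exact HahnSeries.coeff_order_eq_zero.not.mpr hm.2 h1.symm

variable [IsAlgClosed k]

theorem aeval_eq_prod_roots {A : Type*} [CommRing A] [Algebra k A] (a : A) (P : k[X]) :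
    Polynomial.aeval a P = algebraMap k A P.leadingCoeff *
      (P.roots.map fun r => a - algebraMap k A r).prod := by
  conv_lhs => rw [(IsAlgClosed.splits P).eq_prod_roots]
  rw [map_mul, Polynomial.aeval_C, map_multiset_prod, Multiset.map_map]
  simp

theorem order_aeval {ξ : LaurentSeries k} (hξ : ∀ r, ξ ≠ algebraMap k _ r) {P : k[X]}
    (hP : P ≠ 0) : Polynomial.aeval ξ P ≠ 0 ∧ (Polynomial.aeval ξ P).order =
      (P.roots.map fun r => (ξ - algebraMap k _ r).order).sum := by
  have hl : algebraMap k (LaurentSeries k) P.leadingCoeff ≠ 0 := by simpa using hP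
  have key : ∀ s : Multiset k, (s.map fun r => ξ - algebraMap k _ r).prod ≠ 0 ∧
      (s.map fun r => ξ - algebraMap k _ r).prod.order =
        (s.map fun r => (ξ - algebraMap k _ r).order).sum := by
    intro s
    induction s using Multiset.induction with
    | empty => simp
    | cons a s ih =>
      have ha := sub_ne_zero.mpr (hξ a)
      simp only [Multiset.map_cons, Multiset.prod_cons, Multiset.sum_cons]
      exact ⟨mul_ne_zero ha ih.1, by rw [HahnSeries.order_mul ha ih.1, ih.2]⟩
  rw [aeval_eq_prod_roots]
  refine ⟨mul_ne_zero hl (key _).1, ?_⟩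
  rw [HahnSeries.order_mul hl (key _).1, order_algebraMap, zero_add, (key _).2]

/-- The centre of the parameter `ξ` is the point `α` of the line, with ramification index `e`. -/
structure CentredAt {k : Type*} [Field k] (ξ : LaurentSeries k) (α : k) (e : ℕ) : Prop where
  pos : 0 < e
  order_sub : (ξ - algebraMap k _ α).order = e

theorem CentredAt.sub_ne_zero {k : Type*} [Field k] {ξ : LaurentSeries k} {α : k} {e : ℕ}
    (h : CentredAt ξ α e) : ξ - algebraMap k _ α ≠ 0 := by
  intro h0
  have := h.order_sub
  rw [h0, HahnSeries.order_zero] at this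
  have := h.pos
  omega

theorem CentredAt.order_sub_of_ne {k : Type*} [Field k] {ξ : LaurentSeries k} {α : k} {e : ℕ}
    (h : CentredAt ξ α e) {r : k} (hr : r ≠ α) : ξ - algebraMap k _ r ≠ 0 ∧
      (ξ - algebraMap k _ r).order = 0 := by
  have h1 : ξ - algebraMap k _ r = (ξ - algebraMap k _ α) + algebraMap k _ (α - r) := by
    rw [map_sub]; ring
  have h2 : (ξ - algebraMap k _ r).orderTop = 0 := by
    rw [h1, HahnSeries.orderTop_add_eq_right, orderTop_algebraMap (_root_.sub_ne_zero.mpr hr.symm)]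
    rw [orderTop_algebraMap (_root_.sub_ne_zero.mpr hr.symm), HahnSeries.zero_lt_orderTop_iff
      h.sub_ne_zero, h.order_sub]
    exact_mod_cast h.pos
  have h3 : ξ - algebraMap k _ r ≠ 0 := by
    intro h0
    simp [h0] at h2
  refine ⟨h3, ?_⟩
  rw [← HahnSeries.order_eq_orderTop_of_ne_zero h3] at h2
  exact_mod_cast h2

theorem CentredAt.ne_algebraMap {k : Type*} [Field k] {ξ : LaurentSeries k} {α : k} {e : ℕ}
    (h : CentredAt ξ α e) (r : k) : ξ ≠ algebraMap k _ r := by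
  rw [← _root_.sub_ne_zero]
  by_cases hr : r = α
  · exact hr ▸ h.sub_ne_zero
  · exact (h.order_sub_of_ne hr).1

theorem CentredAt.order_aeval {ξ : LaurentSeries k} {α : k} {e : ℕ} (h : CentredAt ξ α e)
    {P : k[X]} (hP : P ≠ 0) :
    (Polynomial.aeval ξ P).order = e * (P.rootMultiplicity α : ℤ) := by
  classical
  rw [(ArtinSchreierCurve.order_aeval h.ne_algebraMap hP).2, ← Polynomial.count_roots]
  induction P.roots using Multiset.induction with
  | empty => simp
  | cons a s ih =>
    rw [Multiset.map_cons, Multiset.sum_cons, ih, Multiset.count_cons]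
    by_cases ha : a = α
    · subst ha
      rw [h.order_sub, if_pos rfl]
      push_cast
      ring
    · rw [(h.order_sub_of_ne ha).2, if_neg (Ne.symm ha)]
      simp

theorem CentredAt.orderTop_aeval_nonneg {ξ : LaurentSeries k} {α : k} {e : ℕ}
    (h : CentredAt ξ α e) (P : k[X]) : 0 ≤ (Polynomial.aeval ξ P).orderTop := by
  rcases eq_or_ne P 0 with rfl | hP
  · simp
  rw [HahnSeries.zero_le_orderTop_iff, h.order_aeval hP]
  positivity

theorem CentredAt.orderTop_aeval_eq_zero {ξ : LaurentSeries k} {α : k} {e : ℕ}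
    (h : CentredAt ξ α e) {P : k[X]} (hP : P.eval α ≠ 0) :
    (Polynomial.aeval ξ P).orderTop = 0 := by
  have hP0 : P ≠ 0 := by rintro rfl; simp at hP
  rw [← HahnSeries.order_eq_orderTop_of_ne_zero
    (ArtinSchreierCurve.order_aeval h.ne_algebraMap hP0).1, h.order_aeval hP0,
    Polynomial.rootMultiplicity_eq_zero hP]
  simp

theorem order_aeval_of_order_eq_neg_one {ξ : LaurentSeries k} (hξ : ξ.order = -1) {P : k[X]}
    (hP : P ≠ 0) : Polynomial.aeval ξ P ≠ 0 ∧ (Polynomial.aeval ξ P).order = -P.natDegree := by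
  have hξ0 : ξ ≠ 0 := by rintro rfl; simp at hξ
  have h1 : ∀ r : k, (ξ - algebraMap k _ r).orderTop = (-1 : ℤ) := by
    intro r
    have h2 : ξ.orderTop = (-1 : ℤ) := by
      rw [← HahnSeries.order_eq_orderTop_of_ne_zero hξ0, hξ]
    rw [HahnSeries.orderTop_sub, h2]
    rw [h2]
    refine lt_of_lt_of_le ?_ (mem_integralSeries.mp (algebraMap_mem_integralSeries r))
    exact_mod_cast (by norm_num : (-1 : ℤ) < 0)
  have h2 : ∀ r : k, ξ ≠ algebraMap k _ r := by
    intro r h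
    have := h1 r
    rw [h, sub_self, HahnSeries.orderTop_zero] at this
    exact WithTop.coe_ne_top this.symm
  refine ⟨(order_aeval h2 hP).1, ?_⟩
  rw [(order_aeval h2 hP).2, (IsAlgClosed.splits P).natDegree_eq_card_roots]
  have h3 : ∀ r : k, (ξ - algebraMap k _ r).order = -1 := by
    intro r
    have := h1 r
    rw [← HahnSeries.order_eq_orderTop_of_ne_zero (sub_ne_zero.mpr (h2 r))] at this
    exact_mod_cast this
  simp [h3]

section RatFunc

theorem algHom_ratFunc_apply {k : Type*} [Field k] {A : Type*} [Field A] [Algebra k A] (τ : RatFunc k →ₐ[k] A)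
    (b : RatFunc k) : τ b = Polynomial.aeval (τ RatFunc.X) b.num /
      Polynomial.aeval (τ RatFunc.X) b.denom := by
  conv_lhs => rw [← RatFunc.num_div_denom b]
  rw [map_div₀, Polynomial.aeval_algHom_apply, Polynomial.aeval_algHom_apply,
    RatFunc.aeval_X_left_eq_algebraMap, RatFunc.aeval_X_left_eq_algebraMap]

theorem CentredAt.order_apply {τ : RatFunc k →ₐ[k] LaurentSeries k} {α : k} {e : ℕ}
    (h : CentredAt (τ RatFunc.X) α e) {b : RatFunc k} (hb : b ≠ 0) :
    (τ b).order = e * ((b.num.rootMultiplicity α : ℤ) - b.denom.rootMultiplicity α) := by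
  have hn := RatFunc.num_ne_zero hb
  have hd := RatFunc.denom_ne_zero b
  rw [algHom_ratFunc_apply, order_div (ArtinSchreierCurve.order_aeval h.ne_algebraMap hn).1
    (ArtinSchreierCurve.order_aeval h.ne_algebraMap hd).1, h.order_aeval hn, h.order_aeval hd]
  ring

/-- A pole of b at α costs at least e in order, so any bound strictly better than -e excludes it.
This slack absorbs the rounding in the exponents `mExp`. -/
theorem CentredAt.eval_denom_ne_zero {τ : RatFunc k →ₐ[k] LaurentSeries k} {α : k} {e : ℕ}
    (h : CentredAt (τ RatFunc.X) α e) {b : RatFunc k} {N : ℤ} (hN : -e < N)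
    (hb : N ≤ (τ b).orderTop) : b.denom.eval α ≠ 0 := by
  intro hd
  have hb0 : b ≠ 0 := by
    rintro rfl
    simp at hd
  have hn : b.num.eval α ≠ 0 := by
    intro hn
    obtain ⟨u, v, huv⟩ := RatFunc.isCoprime_num_denom b
    have := congrArg (Polynomial.eval α) huv
    simp [hn, hd] at this
  have h1 : 0 < b.denom.rootMultiplicity α :=
    (Polynomial.rootMultiplicity_pos (RatFunc.denom_ne_zero b)).mpr hd
  rw [le_orderTop_iff_order (by simpa using hb0), h.order_apply hb0,
    Polynomial.rootMultiplicity_eq_zero hn] at hb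
  have h2 : (1 : ℤ) ≤ b.denom.rootMultiplicity α := by exact_mod_cast h1
  have h3 := h.pos
  push_cast at hb
  nlinarith

theorem denom_eq_X_pow {b : RatFunc k} (h : ∀ α ≠ 0, b.denom.eval α ≠ 0) :
    ∃ n, b.denom = Polynomial.X ^ n := by
  have h1 := (IsAlgClosed.splits b.denom).eq_prod_roots
  rw [(RatFunc.monic_denom b).leadingCoeff, map_one, one_mul] at h1
  refine ⟨Multiset.card b.denom.roots, ?_⟩
  have h2 : b.denom.roots = Multiset.replicate (Multiset.card b.denom.roots) 0 := by
    rw [Multiset.eq_replicate]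
    refine ⟨rfl, fun r hr => ?_⟩
    by_contra h0
    exact h r h0 (Polynomial.isRoot_of_mem_roots hr)
  conv_lhs => rw [h1, h2]
  simp

theorem denom_eq_one {b : RatFunc k} (h : ∀ α, b.denom.eval α ≠ 0) : b.denom = 1 := by
  obtain ⟨n, hn⟩ := denom_eq_X_pow fun α _ => h α
  rcases n with _ | n
  · simpa using hn
  · exact absurd (by simp [hn]) (h 0)

theorem exists_algHom_ratFunc {A : Type*} [Field A] [Algebra k A] {ξ : A}
    (hξ : ∀ r, ξ ≠ algebraMap k _ r) : ∃ τ : RatFunc k →ₐ[k] A, τ RatFunc.X = ξ := by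
  refine ⟨RatFunc.liftAlgHom (Polynomial.aeval ξ) fun P hP => ?_, ?_⟩
  · rw [Submonoid.mem_comap, mem_nonZeroDivisors_iff_ne_zero]
    have hP0 : P ≠ 0 := nonZeroDivisors.ne_zero hP
    change Polynomial.aeval ξ P ≠ 0
    rw [aeval_eq_prod_roots]
    refine mul_ne_zero (by simpa using hP0) (Multiset.prod_ne_zero ?_)
    rw [Multiset.mem_map]
    rintro ⟨r, -, hr⟩
    exact hξ r (sub_eq_zero.mp hr)
  · rw [← RatFunc.algebraMap_X, RatFunc.liftAlgHom_apply, RatFunc.num_algebraMap,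
      RatFunc.denom_algebraMap]
    simp

end RatFunc

end Orders

/-! ### The Artin–Schreier data -/

section Setup

variable {k F : Type*} [Field k] [Field F] [Algebra (RatFunc k) F]

/-- The denominator `∏ (x - ρᵢ)^{lᵢ}`. -/
def poleDenom {r : ℕ} (ρ : Fin r → k) (l : Fin r → ℕ) : k[X] :=
  ∏ i, (Polynomial.X - Polynomial.C (ρ i)) ^ l i

/-- The hypotheses on the extension `k(x, y)` of `k(x)`. -/
structure IsArtinSchreier (p : ℕ) {r : ℕ} (ρ : Fin r → k) (l : Fin r → ℕ) (f : k[X]) (x y : F) :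
    Prop where
  three_le : 3 ≤ p
  pos : 0 < r
  injective : Function.Injective ρ
  coprime : ∀ i, Nat.Coprime (l i) p
  isCoprime : IsCoprime f (poleDenom ρ l)
  natDegree_eq : f.natDegree = ∑ i, l i
  x_eq : x = algebraMap (RatFunc k) F RatFunc.X
  equation : y ^ p - y = algebraMap (RatFunc k) F (rhs f ρ l)
  adjoin_eq_top : IntermediateField.adjoin (RatFunc k) {y} = ⊤

section PoleDenom

variable {r : ℕ} {ρ : Fin r → k} {l : Fin r → ℕ}

theorem poleDenom_ne_zero : poleDenom ρ l ≠ 0 :=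
  Finset.prod_ne_zero_iff.mpr fun _ _ => pow_ne_zero _ (Polynomial.X_sub_C_ne_zero _)

theorem natDegree_poleDenom : (poleDenom ρ l).natDegree = ∑ i, l i := by
  rw [poleDenom, Polynomial.natDegree_prod_of_monic _ _ fun i _ =>
    (Polynomial.monic_X_sub_C _).pow _]
  simp

theorem eval_prod_X_sub_C_ne_zero {S : Finset (Fin r)} (m : Fin r → ℕ) {α : k}
    (hα : ∀ i ∈ S, α ≠ ρ i) :
    (∏ i ∈ S, (Polynomial.X - Polynomial.C (ρ i)) ^ m i).eval α ≠ 0 := by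
  rw [Polynomial.eval_prod, Finset.prod_ne_zero_iff]
  intro i hi
  simpa using pow_ne_zero _ (sub_ne_zero.mpr (hα i hi))

theorem eval_poleDenom_ne_zero {α : k} (hα : ∀ i, α ≠ ρ i) : (poleDenom ρ l).eval α ≠ 0 :=
  eval_prod_X_sub_C_ne_zero l fun i _ => hα i

/-- The denominator without its factor at `ρᵢ`. -/
def poleDenomErase (ρ : Fin r → k) (l : Fin r → ℕ) (i : Fin r) : k[X] :=
  ∏ j ∈ Finset.univ.erase i, (Polynomial.X - Polynomial.C (ρ j)) ^ l j

theorem mul_poleDenomErase (i : Fin r) :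
    (Polynomial.X - Polynomial.C (ρ i)) ^ l i * poleDenomErase ρ l i = poleDenom ρ l := by
  rw [poleDenom, poleDenomErase]
  exact Finset.mul_prod_erase Finset.univ
    (fun j => (Polynomial.X - Polynomial.C (ρ j) : k[X]) ^ l j) (Finset.mem_univ i)

theorem eval_poleDenomErase_ne_zero (hρ : Function.Injective ρ) (i : Fin r) :
    (poleDenomErase ρ l i).eval (ρ i) ≠ 0 :=
  eval_prod_X_sub_C_ne_zero l fun _ hj => hρ.ne (Finset.ne_of_mem_erase hj).symm

end PoleDenom

variable {p : ℕ} {r : ℕ} {ρ : Fin r → k} {l : Fin r → ℕ} {f : k[X]} {x y : F}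

namespace IsArtinSchreier

theorem l_pos (S : IsArtinSchreier p ρ l f x y) (i : Fin r) : 0 < l i := by
  rcases Nat.eq_zero_or_pos (l i) with h | h
  · have := S.coprime i
    rw [h, Nat.coprime_zero_left] at this
    have := S.three_le
    omega
  · exact h

theorem eval_f_ne_zero (S : IsArtinSchreier p ρ l f x y) (i : Fin r) : f.eval (ρ i) ≠ 0 := by
  intro h0
  obtain ⟨u, v, huv⟩ := S.isCoprime
  have h1 := congrArg (Polynomial.eval (ρ i)) huv
  rw [← mul_poleDenomErase i] at h1
  simp [h0, (S.l_pos i).ne'] at h1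

theorem f_ne_zero (S : IsArtinSchreier p ρ l f x y) : f ≠ 0 := by
  rintro rfl
  exact S.eval_f_ne_zero ⟨0, S.pos⟩ (by simp)

theorem coe_l_ne_zero [CharP k p] (S : IsArtinSchreier p ρ l f x y) (i : Fin r) :
    (l i : k) ≠ 0 := by
  rw [Ne, CharP.cast_eq_zero_iff k p]
  intro h
  have h1 := (S.coprime i).symm.eq_one_of_dvd h
  have := S.three_le
  omega

variable [Algebra k F] [IsScalarTower k (RatFunc k) F]

theorem aeval_eq (S : IsArtinSchreier p ρ l f x y) (P : k[X]) :
    Polynomial.aeval x P = algebraMap (RatFunc k) F (algebraMap k[X] (RatFunc k) P) := by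
  rw [S.x_eq]
  exact (Polynomial.aeval_algHom_apply (IsScalarTower.toAlgHom k (RatFunc k) F) RatFunc.X P).trans
    (by rw [RatFunc.aeval_X_left_eq_algebraMap]; rfl)

theorem aeval_ne_zero (S : IsArtinSchreier p ρ l f x y) {P : k[X]} (hP : P ≠ 0) :
    Polynomial.aeval x P ≠ 0 := by
  rw [S.aeval_eq]
  simpa using hP

theorem algebraMap_rhs (S : IsArtinSchreier p ρ l f x y) :
    y ^ p - y = Polynomial.aeval x f / Polynomial.aeval x (poleDenom ρ l) := by
  rw [S.equation, S.aeval_eq, S.aeval_eq, ← map_div₀]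
  rfl

theorem equation_mul (S : IsArtinSchreier p ρ l f x y) :
    (y ^ p - y) * Polynomial.aeval x (poleDenom ρ l) = Polynomial.aeval x f := by
  rw [S.algebraMap_rhs, div_mul_cancel₀]
  exact S.aeval_ne_zero poleDenom_ne_zero

end IsArtinSchreier

end Setup

/-! ### Local analysis at the ramified points -/

section Ramified

variable {k : Type*} [Field k]

theorem aeval_ofPowerSeries (g : PowerSeries k) (P : k[X]) :
    Polynomial.aeval (HahnSeries.ofPowerSeries ℤ k g) P =
      HahnSeries.ofPowerSeries ℤ k (Polynomial.aeval g P) := by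
  rw [Polynomial.aeval_def, Polynomial.aeval_def, Polynomial.hom_eval₂]
  congr 1
  ext c : 1
  rw [algebraMap_laurentSeries, ← HahnSeries.ofPowerSeries_C]
  rfl

theorem orderTop_ofPowerSeries_eq_zero {w : PowerSeries k}
    (hw : PowerSeries.constantCoeff w ≠ 0) :
    (HahnSeries.ofPowerSeries ℤ k w).orderTop = 0 := by
  refine le_antisymm ?_ (ofPowerSeries_mem_integralSeries w)
  have h1 := HahnSeries.orderTop_le_of_coeff_ne_zero (x := HahnSeries.ofPowerSeries ℤ k w) (g := 0)
    (by rw [PowerSeries.coeff_coe]; simpa using hw)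
  exact_mod_cast h1

theorem pow_single (n : ℤ) (m : ℕ) :
    (HahnSeries.single n (1 : k)) ^ m = HahnSeries.single (m * n) 1 := by
  rw [HahnSeries.single_pow, one_pow, nsmul_eq_mul]

variable {p : ℕ} {r : ℕ} {ρ : Fin r → k} {l : Fin r → ℕ} {f : k[X]}

/-- The image of y is to be the monomial s^(-lᵢ) itself, not merely a series with that leading term;
the parameter is adapted to y, and x is solved for. -/
theorem exists_ramified_algHom [IsAlgClosed k] (hp : 2 ≤ p) (hρ : Function.Injective ρ)
    (i : Fin r) (hl : (l i : k) ≠ 0) (hf : f.eval (ρ i) ≠ 0) :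
    ∃ τ : RatFunc k →ₐ[k] LaurentSeries k, CentredAt (τ RatFunc.X) (ρ i) p ∧
      (HahnSeries.single (-(l i : ℤ)) (1 : k)) ^ p - HahnSeries.single (-(l i : ℤ)) 1 =
        Polynomial.aeval (τ RatFunc.X) f / Polynomial.aeval (τ RatFunc.X) (poleDenom ρ l) := by
  obtain ⟨w, hw, h⟩ := exists_ramified_parameter hp hl f (poleDenomErase ρ l i) (ρ i) hf
    (eval_poleDenomErase_ne_zero hρ i)
  set ξ : LaurentSeries k :=
    HahnSeries.ofPowerSeries ℤ k (PowerSeries.C (ρ i) + PowerSeries.X ^ p * w) with hξ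
  have hsub : ξ - algebraMap k _ (ρ i) =
      HahnSeries.single (p : ℤ) 1 * HahnSeries.ofPowerSeries ℤ k w := by
    rw [hξ, map_add, HahnSeries.ofPowerSeries_C, algebraMap_laurentSeries, add_sub_cancel_left,
      map_mul, HahnSeries.ofPowerSeries_X_pow]
  have hc : CentredAt ξ (ρ i) p := by
    refine ⟨by omega, ?_⟩
    have h0 : HahnSeries.ofPowerSeries ℤ k w ≠ 0 := by
      intro h0
      have := orderTop_ofPowerSeries_eq_zero hw
      rw [h0, HahnSeries.orderTop_zero] at this
      exact WithTop.top_ne_zero this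
    have h1 := orderTop_ofPowerSeries_eq_zero hw
    rw [← HahnSeries.order_eq_orderTop_of_ne_zero h0] at h1
    have h2 : (HahnSeries.ofPowerSeries ℤ k w).order = 0 := by exact_mod_cast h1
    rw [hsub, HahnSeries.order_mul (by simp) h0, HahnSeries.order_single one_ne_zero, h2,
      add_zero]
  obtain ⟨τ, hτ⟩ := exists_algHom_ratFunc hc.ne_algebraMap
  refine ⟨τ, hτ ▸ hc, ?_⟩
  rw [hτ, eq_div_iff (order_aeval hc.ne_algebraMap poleDenom_ne_zero).1, ← mul_poleDenomErase i,
    map_mul, map_pow, map_sub, Polynomial.aeval_X, Polynomial.aeval_C, hsub, hξ,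
    aeval_ofPowerSeries, aeval_ofPowerSeries, h, map_mul (HahnSeries.ofPowerSeries ℤ k),
    map_mul (HahnSeries.ofPowerSeries ℤ k), map_sub (HahnSeries.ofPowerSeries ℤ k),
    map_one (HahnSeries.ofPowerSeries ℤ k), HahnSeries.ofPowerSeries_X_pow,
    map_pow (HahnSeries.ofPowerSeries ℤ k), mul_pow, pow_single, pow_single]
  have h1 : ((HahnSeries.single ((p : ℤ) * -(l i : ℤ)) (1 : k)) -
      HahnSeries.single (-(l i : ℤ)) 1) * HahnSeries.single ((l i : ℤ) * (p : ℤ)) 1 =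
      1 - HahnSeries.single (((p - 1) * l i : ℕ) : ℤ) 1 := by
    rw [sub_mul, HahnSeries.single_mul_single, HahnSeries.single_mul_single, one_mul,
      show (p : ℤ) * -(l i : ℤ) + (l i : ℤ) * p = 0 by ring, HahnSeries.single_zero_one]
    congr 3
    push_cast [show 1 ≤ p by omega]
    ring
  rw [← h1]
  ring

theorem order_ramified_term {τ : RatFunc k →ₐ[k] LaurentSeries k} [IsAlgClosed k] {i : Fin r}
    (hτ : CentredAt (τ RatFunc.X) (ρ i) p) {b : RatFunc k} (hb : b ≠ 0) (j : ℕ) :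
    ∃ n : ℤ, (τ b).order = p * n ∧
      (τ b * (HahnSeries.single (-(l i : ℤ)) (1 : k)) ^ j).order = p * n - l i * j := by
  refine ⟨_, hτ.order_apply hb, ?_⟩
  rw [pow_single, HahnSeries.order_mul (by simpa using hb) (by simp), hτ.order_apply hb,
    HahnSeries.order_single one_ne_zero]
  ring

/-- The j-th term has order congruent to -lᵢ j modulo p. As lᵢ is prime to p, these orders are
distinct for 0 ≤ j < p, so no cancellation occurs. -/
theorem le_orderTop_ramified_term [IsAlgClosed k] {τ : RatFunc k →ₐ[k] LaurentSeries k}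
    {i : Fin r} (hl : (l i).Coprime p)
    (hτ : CentredAt (τ RatFunc.X) (ρ i) p) {a : ℕ → RatFunc k} {N : ℤ}
    (h : N ≤ (∑ j ∈ Finset.range p,
      τ (a j) * (HahnSeries.single (-(l i : ℤ)) (1 : k)) ^ j).orderTop) {j : ℕ} (hj : j < p) :
    N ≤ (τ (a j) * (HahnSeries.single (-(l i : ℤ)) (1 : k)) ^ j).orderTop := by
  refine le_orderTop_of_le_orderTop_sum
    (g := fun j => τ (a j) * (HahnSeries.single (-(l i : ℤ)) (1 : k)) ^ j)
    (fun m hm n hn hm0 hn0 hmn => ?_) h (Finset.mem_range.mpr hj)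
  have ham : a m ≠ 0 := by rintro h; simp [h] at hm0
  have han : a n ≠ 0 := by rintro h; simp [h] at hn0
  obtain ⟨u, -, hu⟩ := order_ramified_term (l := l) hτ ham m
  obtain ⟨v, -, hv⟩ := order_ramified_term (l := l) hτ han n
  simp only [hu, hv] at hmn
  have h1 : (p : ℤ) ∣ (l i : ℤ) * (m - n) := ⟨u - v, by linear_combination -hmn⟩
  have h2 : (p : ℤ) ∣ (m : ℤ) - n := by
    refine IsCoprime.dvd_of_dvd_mul_left ?_ h1
    exact Nat.isCoprime_iff_coprime.mpr hl.symm
  rw [Finset.mem_range] at hm hn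
  obtain ⟨c, hc⟩ := h2
  have hc0 : c = 0 := by
    by_contra hc0
    rcases lt_or_gt_of_ne hc0 with h | h
    · nlinarith
    · nlinarith
  rw [hc0] at hc
  omega

/-- Total ramification: a vanishing sum would bound each term from below by any integer, in
particular by one more than its own order. -/
theorem eval_ramified_ne_zero [IsAlgClosed k] {τ : RatFunc k →ₐ[k] LaurentSeries k}
    {i : Fin r} (hl : (l i).Coprime p)
    (hτ : CentredAt (τ RatFunc.X) (ρ i) p) {P : (RatFunc k)[X]} (hP : P ≠ 0)
    (hdeg : P.natDegree < p) :
    P.eval₂ τ.toRingHom (HahnSeries.single (-(l i : ℤ)) (1 : k)) ≠ 0 := by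
  intro h0
  rw [Polynomial.eval₂_eq_sum_range' _ hdeg] at h0
  apply hP
  ext j
  rw [Polynomial.coeff_zero]
  by_cases hj : j < p
  · by_contra hne
    obtain ⟨n, -, hn⟩ := order_ramified_term (l := l) hτ hne j
    have h1 := le_orderTop_ramified_term (N := p * n - l i * j + 1) hl hτ
      (a := fun j => P.coeff j) (by
        change _ ≤ (∑ j ∈ Finset.range p, τ.toRingHom (P.coeff j) * _).orderTop
        rw [h0, HahnSeries.orderTop_zero]
        exact le_top) hj
    rw [le_orderTop_iff_order (mul_ne_zero (by simpa using hne) (pow_ne_zero _ (by simp))), hn]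
      at h1
    omega
  · exact Polynomial.coeff_eq_zero_of_natDegree_lt (by omega)

end Ramified

/-- A polynomial of small degree with integral values at points whose differences are units has
integral coefficients. -/
theorem mem_of_forall_sum_mem {A ι : Type*} [Field A] [Fintype ι] [DecidableEq ι] (O : Subring A)
    {v : ι → A} (hv : Function.Injective v) (hvO : ∀ a, v a ∈ O)
    (hinv : ∀ a b, a ≠ b → (v a - v b)⁻¹ ∈ O) {c : ℕ → A}
    (hc : ∀ a, ∑ j ∈ Finset.range (Fintype.card ι), c j * v a ^ j ∈ O) {j : ℕ}
    (hj : j < Fintype.card ι) : c j ∈ O := by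
  set P : A[X] := ∑ j ∈ Finset.range (Fintype.card ι), Polynomial.C (c j) * Polynomial.X ^ j
    with hP
  have heval : ∀ a, P.eval a = ∑ j ∈ Finset.range (Fintype.card ι), c j * a ^ j := fun a => by
    simp [hP, Polynomial.eval_finsetSum]
  have hdeg : P.degree < (Finset.univ : Finset ι).card := by
    rw [Finset.card_univ, hP]
    refine lt_of_le_of_lt (Polynomial.degree_sum_le _ _) ((Finset.sup_lt_iff ?_).mpr ?_)
    · exact WithBot.bot_lt_coe _
    · intro b hb
      refine lt_of_le_of_lt (Polynomial.degree_C_mul_X_pow_le _ _) ?_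
      exact_mod_cast Finset.mem_range.mp hb
  have hC : ∀ a ∈ O, Polynomial.C a ∈ Polynomial.lifts O.subtype := fun a ha =>
    Polynomial.C_mem_lifts O.subtype ⟨a, ha⟩
  have hlift : P ∈ Polynomial.lifts O.subtype := by
    rw [Lagrange.eq_interpolate (s := Finset.univ) hv.injOn hdeg, Lagrange.interpolate_apply]
    refine Subsemiring.sum_mem _ fun i _ => Subsemiring.mul_mem _ (hC _ ?_) ?_
    · rw [heval]
      exact hc i
    · refine Subsemiring.prod_mem _ fun m hm => Subsemiring.mul_mem _ (hC _ ?_) ?_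
      · exact hinv _ _ (Finset.ne_of_mem_erase hm).symm
      · rw [sub_eq_add_neg, ← Polynomial.C_neg]
        exact Subsemiring.add_mem _ (Polynomial.X_mem_lifts _) (hC _ (O.neg_mem (hvO m)))
  rw [Polynomial.lifts_iff_coeff_lifts] at hlift
  obtain ⟨d, hd⟩ := hlift j
  have hcoeff : P.coeff j = c j := by
    rw [hP, Polynomial.finsetSum_coeff]
    simp only [Polynomial.coeff_C_mul_X_pow]
    rw [Finset.sum_ite_eq, if_pos (Finset.mem_range.mpr hj)]
  rw [← hcoeff, ← hd]
  exact d.2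

/-! ### Irreducibility of the equation, the power basis, and embeddings of F -/

section Setup

variable {k F : Type*} [Field k] [Field F] [Algebra (RatFunc k) F]
  {p : ℕ} {r : ℕ} {ρ : Fin r → k} {l : Fin r → ℕ} {f : k[X]} {x y : F}

theorem apply_rhs {A : Type*} [Field A] [Algebra k A] (τ : RatFunc k →ₐ[k] A) :
    τ (rhs f ρ l) = Polynomial.aeval (τ RatFunc.X) f /
      Polynomial.aeval (τ RatFunc.X) (poleDenom ρ l) := by
  rw [Polynomial.aeval_algHom_apply, Polynomial.aeval_algHom_apply,
    RatFunc.aeval_X_left_eq_algebraMap, RatFunc.aeval_X_left_eq_algebraMap, ← map_div₀]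
  rfl

/-- The Artin–Schreier polynomial `Y ^ p - Y - f / ∏ (x - ρᵢ)^{lᵢ}`. -/
def artinSchreierPoly (p : ℕ) (ρ : Fin r → k) (l : Fin r → ℕ) (f : k[X]) : (RatFunc k)[X] :=
  Polynomial.X ^ p - Polynomial.X - Polynomial.C (rhs f ρ l)

theorem artinSchreierPoly_eq : artinSchreierPoly p ρ l f =
    Polynomial.X ^ p - (Polynomial.X + Polynomial.C (rhs f ρ l)) :=
  sub_sub _ _ _

theorem degree_X_add_C_lt (hp : 2 ≤ p) :
    (Polynomial.X + Polynomial.C (rhs f ρ l)).degree < (p : WithBot ℕ) := by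
  rw [Polynomial.degree_X_add_C]
  exact_mod_cast hp

theorem monic_artinSchreierPoly (hp : 2 ≤ p) : (artinSchreierPoly p ρ l f).Monic := by
  rw [artinSchreierPoly_eq]
  exact Polynomial.monic_X_pow_sub (lt_of_lt_of_le (degree_X_add_C_lt hp) le_rfl)

theorem natDegree_artinSchreierPoly (hp : 2 ≤ p) : (artinSchreierPoly p ρ l f).natDegree = p := by
  rw [artinSchreierPoly_eq]
  exact Polynomial.natDegree_eq_of_degree_eq_some (by
    rw [Polynomial.degree_sub_eq_left_of_degree_lt, Polynomial.degree_X_pow]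
    rw [Polynomial.degree_X_pow]
    exact degree_X_add_C_lt hp)

theorem eval₂_artinSchreierPoly {A : Type*} [CommRing A] (τ : RatFunc k →+* A) (η : A) :
    (artinSchreierPoly p ρ l f).eval₂ τ η = η ^ p - η - τ (rhs f ρ l) := by
  simp [artinSchreierPoly]

namespace IsArtinSchreier

theorem aeval_artinSchreierPoly (S : IsArtinSchreier p ρ l f x y) :
    Polynomial.aeval y (artinSchreierPoly p ρ l f) = 0 := by
  rw [Polynomial.aeval_def, eval₂_artinSchreierPoly, S.equation, sub_self]

theorem isIntegral (S : IsArtinSchreier p ρ l f x y) : IsIntegral (RatFunc k) y :=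
  ⟨_, monic_artinSchreierPoly (by have := S.three_le; omega), S.aeval_artinSchreierPoly⟩

/-- If the minimal polynomial had degree less than p, the Artin–Schreier polynomial would be a
product of two factors of degree less than p. It vanishes at s^(-lᵢ), while neither factor can, by
`eval_ramified_ne_zero`. -/
theorem minpoly_eq [IsAlgClosed k] [CharP k p] (S : IsArtinSchreier p ρ l f x y) :
    minpoly (RatFunc k) y = artinSchreierPoly p ρ l f := by
  have hp : 2 ≤ p := by have := S.three_le; omega
  set i : Fin r := ⟨0, S.pos⟩
  obtain ⟨τ, hτ, hη⟩ := exists_ramified_algHom hp S.injective i (S.coe_l_ne_zero i)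
    (S.eval_f_ne_zero i)
  obtain ⟨n, hn⟩ := minpoly.dvd _ _ S.aeval_artinSchreierPoly
  have hm := minpoly.monic S.isIntegral
  have hg := monic_artinSchreierPoly (ρ := ρ) (l := l) (f := f) hp
  have hnm : n.Monic := hm.of_mul_monic_left (hn ▸ hg)
  have hdeg := congrArg Polynomial.natDegree hn
  rw [natDegree_artinSchreierPoly hp, hm.natDegree_mul hnm] at hdeg
  have hroot := eval₂_artinSchreierPoly (p := p) (ρ := ρ) (l := l) (f := f) τ.toRingHom
    (HahnSeries.single (-(l i : ℤ)) (1 : k))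
  rw [hη] at hroot
  change _ = _ - τ (rhs f ρ l) at hroot
  rw [apply_rhs, sub_self, hn, Polynomial.eval₂_mul] at hroot
  have hpos := minpoly.natDegree_pos S.isIntegral
  by_cases hlt : (minpoly (RatFunc k) y).natDegree < p
  · rcases mul_eq_zero.mp hroot with h | h
    · exact absurd h (eval_ramified_ne_zero (S.coprime i) hτ hm.ne_zero hlt)
    · exact absurd h (eval_ramified_ne_zero (S.coprime i) hτ hnm.ne_zero (by omega))
  · have : n.natDegree = 0 := by omega
    rw [hnm.natDegree_eq_zero.mp this, mul_one] at hn
    exact hn.symm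

theorem adjoin_eq_top' (S : IsArtinSchreier p ρ l f x y) :
    Algebra.adjoin (RatFunc k) {y} = ⊤ := by
  rw [← IntermediateField.adjoin_simple_toSubalgebra_of_isAlgebraic S.isIntegral.isAlgebraic,
    S.adjoin_eq_top, IntermediateField.top_toSubalgebra]

theorem exists_sum_eq (S : IsArtinSchreier p ρ l f x y) (h : F) : ∃ a : ℕ → RatFunc k,
    h = ∑ j ∈ Finset.range p, algebraMap (RatFunc k) F (a j) * y ^ j := by
  have hp : 2 ≤ p := by have := S.three_le; omega
  have hg := monic_artinSchreierPoly (ρ := ρ) (l := l) (f := f) hp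
  have hmem : h ∈ Algebra.adjoin (RatFunc k) {y} := S.adjoin_eq_top' ▸ Algebra.mem_top
  rw [Algebra.adjoin_singleton_eq_range_aeval] at hmem
  obtain ⟨P, rfl⟩ := hmem
  refine ⟨(P %ₘ artinSchreierPoly p ρ l f).coeff, ?_⟩
  change Polynomial.aeval y P = _
  rw [← Polynomial.aeval_modByMonic_eq_self_of_root S.aeval_artinSchreierPoly,
    Polynomial.aeval_eq_sum_range' (n := p)]
  · simp only [Algebra.smul_def]
  · refine lt_of_lt_of_eq (Polynomial.natDegree_modByMonic_lt _ hg fun h1 => ?_)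
      (natDegree_artinSchreierPoly hp)
    have := natDegree_artinSchreierPoly (ρ := ρ) (l := l) (f := f) hp
    rw [h1, Polynomial.natDegree_one] at this
    omega

/-- The power basis of `k(x, y)` over `k(x)` given by `y`. -/
def powerBasis (S : IsArtinSchreier p ρ l f x y) : PowerBasis (RatFunc k) F :=
  PowerBasis.ofAdjoinEqTop S.isIntegral S.adjoin_eq_top'

theorem powerBasis_gen (S : IsArtinSchreier p ρ l f x y) : S.powerBasis.gen = y :=
  PowerBasis.ofAdjoinEqTop_gen _ _

variable [Algebra k F] [IsScalarTower k (RatFunc k) F] [IsAlgClosed k] [CharP k p]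

theorem exists_embedding {A : Type*} [Field A] [Algebra k A] (S : IsArtinSchreier p ρ l f x y)
    (τ : RatFunc k →ₐ[k] A) {η : A}
    (hη : η ^ p - η = Polynomial.aeval (τ RatFunc.X) f /
      Polynomial.aeval (τ RatFunc.X) (poleDenom ρ l)) :
    ∃ φ : F →ₐ[k] A, (∀ b, φ (algebraMap (RatFunc k) F b) = τ b) ∧ φ y = η := by
  let _ : Algebra (RatFunc k) A := τ.toRingHom.toAlgebra
  have h0 : Polynomial.aeval η (minpoly (RatFunc k) S.powerBasis.gen) = 0 := by
    rw [S.powerBasis_gen, S.minpoly_eq, Polynomial.aeval_def, eval₂_artinSchreierPoly, hη]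
    exact sub_eq_zero.mpr (apply_rhs τ).symm
  let ψ : F →ₐ[RatFunc k] A := S.powerBasis.lift η h0
  have hψ : ∀ b, ψ (algebraMap (RatFunc k) F b) = τ b := fun b => ψ.commutes b
  refine ⟨{ ψ.toRingHom with commutes' := fun c => ?_ }, hψ, ?_⟩
  · change ψ (algebraMap k F c) = algebraMap k A c
    rw [IsScalarTower.algebraMap_apply k (RatFunc k) F, hψ, τ.commutes]
  · change ψ y = η
    conv_lhs => rw [← S.powerBasis_gen]
    exact S.powerBasis.lift_gen η h0

end IsArtinSchreier

end Setup

/-! ### Constants of the prime field -/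

section Shift

variable {k : Type*} [Field k] (p : ℕ) [Fact p.Prime] [CharP k p]

/-- The elements of the prime field as constant Laurent series. -/
def primeConst : ZMod p →+* LaurentSeries k :=
  (algebraMap k (LaurentSeries k)).comp (ZMod.castHom (dvd_refl p) k)

theorem primeConst_pow (a : ZMod p) : (primeConst p a : LaurentSeries k) ^ p = primeConst p a := by
  rw [← map_pow, ZMod.pow_card]

theorem primeConst_nonneg (a : ZMod p) : 0 ≤ (primeConst p a : LaurentSeries k).orderTop :=
  algebraMap_mem_integralSeries _

end Shift

section Order

variable {k : Type*} [Field k]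

theorem orderTop_div_of_eq_zero {g h : LaurentSeries k} (hh : h.orderTop = 0) :
    (g / h).orderTop = g.orderTop := by
  have h0 : h ≠ 0 := by rintro rfl; simp at hh
  conv_rhs => rw [← div_mul_cancel₀ g h0, HahnSeries.orderTop_mul, hh, add_zero]

theorem le_orderTop_mul_single {g : LaurentSeries k} {N m : ℤ} :
    ((N + m : ℤ) : WithTop ℤ) ≤ (g * HahnSeries.single m 1).orderTop ↔ N ≤ g.orderTop := by
  rcases eq_or_ne g 0 with rfl | hg
  · simp
  have h1 : g * HahnSeries.single m 1 ≠ 0 := mul_ne_zero hg (by simp)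
  rw [le_orderTop_iff_order h1, le_orderTop_iff_order hg,
    HahnSeries.order_mul hg (by simp), HahnSeries.order_single one_ne_zero]
  omega

theorem le_orderTop_iff_mem {g : LaurentSeries k} {N : ℤ} :
    N ≤ g.orderTop ↔ HahnSeries.single (-N) 1 * g ∈ integralSeries k := by
  rw [← le_orderTop_mul_single (m := -N), add_neg_cancel, mul_comm]
  rfl

end Order

/-! ### Conditions that regularity over a finite point imposes on the coefficients -/

section Setup

variable {k F : Type*} [Field k] [Field F] [Algebra k F] [Algebra (RatFunc k) F]
  [IsScalarTower k (RatFunc k) F] [IsAlgClosed k]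
  {p : ℕ} [Fact p.Prime] [CharP k p] {r : ℕ} {ρ : Fin r → k} {l : Fin r → ℕ} {f : k[X]} {x y : F}

theorem rootMultiplicity_poleDenom {k : Type*} [Field k] {ρ : Fin r → k}
    (hρ : Function.Injective ρ) (m : Fin r → ℕ) (i : Fin r) :
    (poleDenom ρ m).rootMultiplicity (ρ i) = m i := by
  rw [← mul_poleDenomErase i, Polynomial.rootMultiplicity_mul (by
    rw [mul_poleDenomErase]; exact poleDenom_ne_zero), Polynomial.rootMultiplicity_X_sub_C_pow,
    Polynomial.rootMultiplicity_eq_zero (eval_poleDenomErase_ne_zero hρ i), add_zero]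

theorem gPoly_eq_poleDenom {k : Type*} [Field k] {ρ : Fin r → k} (μ : ℕ) :
    gPoly p ρ l μ = poleDenom ρ (mExp p l μ) := rfl

/-- The embeddings over an unramified point of the line. -/
structure UnramifiedFamily (x y : F) (τ : RatFunc k →ₐ[k] LaurentSeries k)
    (φ : ZMod p → F →ₐ[k] LaurentSeries k) (η : LaurentSeries k) : Prop where
  nonneg : 0 ≤ η.orderTop
  apply_algebraMap : ∀ a b, φ a (algebraMap (RatFunc k) F b) = τ b
  apply_y : ∀ a, φ a y = η + primeConst p a

namespace IsArtinSchreier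

theorem apply_x (S : IsArtinSchreier p ρ l f x y) {A : Type*} [Field A] [Algebra k A]
    {φ : F →ₐ[k] A} {τ : RatFunc k →ₐ[k] A}
    (h : ∀ b, φ (algebraMap (RatFunc k) F b) = τ b) : φ x = τ RatFunc.X := by
  rw [S.x_eq, h]

/-- One root η comes from Hensel's lemma; the others are its translates by the prime field, because
Frobenius is additive and fixes that field. -/
theorem exists_unramifiedFamily (S : IsArtinSchreier p ρ l f x y)
    {τ : RatFunc k →ₐ[k] LaurentSeries k} (hτ : 0 ≤ (Polynomial.aeval (τ RatFunc.X) f /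
      Polynomial.aeval (τ RatFunc.X) (poleDenom ρ l)).orderTop) :
    ∃ (φ : ZMod p → F →ₐ[k] LaurentSeries k) (η : LaurentSeries k),
      UnramifiedFamily x y τ φ η := by
  have hp : 2 ≤ p := by have := S.three_le; omega
  have := charP_of_injective_algebraMap (algebraMap k (LaurentSeries k)).injective p
  obtain ⟨q, hq⟩ := exists_ofPowerSeries_eq (mem_integralSeries.mpr hτ)
  obtain ⟨η, hη⟩ := exists_pow_sub_self_eq hp q
  have hη' : ∀ a : ZMod p, (HahnSeries.ofPowerSeries ℤ k η + primeConst p a) ^ p -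
      (HahnSeries.ofPowerSeries ℤ k η + primeConst p a) = Polynomial.aeval (τ RatFunc.X) f /
      Polynomial.aeval (τ RatFunc.X) (poleDenom ρ l) := fun a => by
    rw [add_pow_char, primeConst_pow, add_sub_add_right_eq_sub, ← hq, ← hη, map_sub, map_pow]
  choose φ hφ1 hφ2 using fun a => S.exists_embedding τ (hη' a)
  exact ⟨φ, _, ofPowerSeries_mem_integralSeries η, hφ1, hφ2⟩

theorem exists_algHom_centredAt (α : k) :
    ∃ τ : RatFunc k →ₐ[k] LaurentSeries k, CentredAt (τ RatFunc.X) α 1 ∧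
      τ RatFunc.X = algebraMap k _ α + HahnSeries.single 1 1 := by
  have hc : CentredAt (algebraMap k (LaurentSeries k) α + HahnSeries.single 1 1) α 1 := by
    refine ⟨one_pos, ?_⟩
    rw [add_sub_cancel_left, HahnSeries.order_single one_ne_zero]
    rfl
  obtain ⟨τ, hτ⟩ := exists_algHom_ratFunc hc.ne_algebraMap
  exact ⟨τ, hτ ▸ hc, hτ⟩

theorem orderTop_rhs_nonneg {τ : RatFunc k →ₐ[k] LaurentSeries k} {α : k}
    (hτ : CentredAt (τ RatFunc.X) α 1) (hα : ∀ i, α ≠ ρ i) :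
    0 ≤ (Polynomial.aeval (τ RatFunc.X) f /
      Polynomial.aeval (τ RatFunc.X) (poleDenom ρ l)).orderTop := by
  rw [orderTop_div_of_eq_zero (hτ.orderTop_aeval_eq_zero (eval_poleDenom_ne_zero hα))]
  exact hτ.orderTop_aeval_nonneg f

end IsArtinSchreier

/-- The conjugates η + c are integral and their differences are nonzero constants, hence units.
After scaling by s^(-N), Lagrange interpolation recovers the coefficients from the p values without
leaving the power series. -/
theorem UnramifiedFamily.le_orderTop {τ : RatFunc k →ₐ[k] LaurentSeries k}
    {φ : ZMod p → F →ₐ[k] LaurentSeries k} {η : LaurentSeries k}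
    (hφ : UnramifiedFamily x y τ φ η) {a : ℕ → RatFunc k} {N : ℤ}
    (h : ∀ c, N ≤ (φ c (∑ j ∈ Finset.range p,
      algebraMap (RatFunc k) F (a j) * y ^ j)).orderTop) {j : ℕ} (hj : j < p) :
    N ≤ (τ (a j)).orderTop := by
  rw [le_orderTop_iff_mem]
  refine mem_of_forall_sum_mem (integralSeries k).toSubring (ι := ZMod p)
    (v := fun a => η + primeConst p a) (c := fun j => HahnSeries.single (-N) 1 * τ (a j))
    (fun b c hbc => ?_) (fun c => ?_) (fun b c hbc => ?_) (fun c => ?_) ?_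
  · exact (primeConst p).injective (add_left_cancel hbc)
  · exact add_mem (mem_integralSeries.mpr hφ.nonneg)
      (mem_integralSeries.mpr (primeConst_nonneg p c))
  · rw [add_sub_add_left_eq_sub, ← map_sub, ← map_inv₀]
    exact primeConst_nonneg p _
  · have h1 := le_orderTop_iff_mem.mp (h c)
    rw [map_sum, Finset.mul_sum] at h1
    simp only [map_mul, map_pow, hφ.apply_algebraMap, hφ.apply_y, ← mul_assoc] at h1
    rw [ZMod.card]
    exact h1
  · rwa [ZMod.card]

namespace IsArtinSchreier

section Finite

variable {τ : RatFunc k →ₐ[k] LaurentSeries k} {φ : F →ₐ[k] LaurentSeries k} {α : k} {e : ℕ}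

theorem apply_sub (S : IsArtinSchreier p ρ l f x y)
    (h : ∀ b, φ (algebraMap (RatFunc k) F b) = τ b) :
    φ (x - algebraMap k F α) = τ RatFunc.X - algebraMap k _ α := by
  rw [map_sub, S.apply_x h, φ.commutes]

theorem sub_ne_zero_of_centredAt (S : IsArtinSchreier p ρ l f x y)
    (h : ∀ b, φ (algebraMap (RatFunc k) F b) = τ b) (hτ : CentredAt (τ RatFunc.X) α e) :
    x - algebraMap k F α ≠ 0 := by
  intro h0
  have h1 := S.apply_sub (α := α) h
  rw [h0, map_zero] at h1
  exact hτ.sub_ne_zero h1.symm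

theorem orderTop_sub_pos (S : IsArtinSchreier p ρ l f x y)
    (h : ∀ b, φ (algebraMap (RatFunc k) F b) = τ b) (hτ : CentredAt (τ RatFunc.X) α e) :
    0 < (φ (x - algebraMap k F α)).orderTop := by
  rw [S.apply_sub h, HahnSeries.zero_lt_orderTop_iff hτ.sub_ne_zero, hτ.order_sub]
  exact_mod_cast hτ.pos

/-- The point above `α` given by an embedding centred at `α`. -/
def finitePlace (S : IsArtinSchreier p ρ l f x y)
    (h : ∀ b, φ (algebraMap (RatFunc k) F b) = τ b) (hτ : CentredAt (τ RatFunc.X) α e) :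
    Place k F :=
  placeOf φ (S.sub_ne_zero_of_centredAt h hτ) (S.orderTop_sub_pos h hτ)

theorem mem_nonunits_finitePlace (S : IsArtinSchreier p ρ l f x y)
    (h : ∀ b, φ (algebraMap (RatFunc k) F b) = τ b) (hτ : CentredAt (τ RatFunc.X) α e) :
    x - algebraMap k F α ∈ (S.finitePlace h hτ).ring.nonunits :=
  mem_nonunits_placeOf.mpr (S.orderTop_sub_pos h hτ)

end Finite

theorem eval_denom_ne_zero_of_unramified (S : IsArtinSchreier p ρ l f x y) {α : k}
    (hα : ∀ i, α ≠ ρ i) {a : ℕ → RatFunc k}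
    (h : ∀ P : Place k F, x - algebraMap k F α ∈ P.ring.nonunits →
      ∑ j ∈ Finset.range p, algebraMap (RatFunc k) F (a j) * y ^ j ∈ P.ring)
    {j : ℕ} (hj : j < p) : (a j).denom.eval α ≠ 0 := by
  obtain ⟨τ, hτ, -⟩ := exists_algHom_centredAt α
  obtain ⟨φ, η, hφ⟩ := S.exists_unramifiedFamily (orderTop_rhs_nonneg hτ hα)
  refine hτ.eval_denom_ne_zero (N := 0) (by norm_num) (hφ.le_orderTop (fun c => ?_) hj)
  exact mem_placeOf.mp (h _ (S.mem_nonunits_finitePlace (hφ.apply_algebraMap c) hτ))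

theorem eval_denom_ne_zero_of_unramified_differential (S : IsArtinSchreier p ρ l f x y) {α : k}
    (hα : ∀ i, α ≠ ρ i) {a : ℕ → RatFunc k}
    (h : ∀ P : Place k F, (∑ j ∈ Finset.range p, algebraMap (RatFunc k) F (a j) * y ^ j) •
      KaehlerDifferential.D k F x ∈ regularDifferentialsAt P)
    {j : ℕ} (hj : j < p) : (a j).denom.eval α ≠ 0 := by
  obtain ⟨τ, hτ, hτX⟩ := exists_algHom_centredAt α
  obtain ⟨φ, η, hφ⟩ := S.exists_unramifiedFamily (orderTop_rhs_nonneg hτ hα)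
  refine hτ.eval_denom_ne_zero (N := 0) (by norm_num) (hφ.le_orderTop (fun c => ?_) hj)
  have h1 := one_le_orderTop_pullback (φ := φ c) (fun w hw => mem_placeOf.mp hw)
    (h (S.finitePlace (hφ.apply_algebraMap c) hτ))
  rw [pullback_smul, pullback_D, S.apply_x (hφ.apply_algebraMap c), hτX, map_add,
    Derivation.map_algebraMap, zero_add, eulerDerivation_single, Int.cast_one, one_mul] at h1
  exact le_orderTop_mul_single.mp (by rw [zero_add]; exact h1)

theorem D_pow_sub (y : F) :
    KaehlerDifferential.D k F (y ^ p - y) = -KaehlerDifferential.D k F y := by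
  have : CharP F p := charP_of_injective_algebraMap (algebraMap k F).injective p
  rw [map_sub, Derivation.leibniz_pow, ← Nat.cast_smul_eq_nsmul F, CharP.cast_eq_zero, zero_smul,
    zero_sub]

/-- This is the differential of (y^p - y) T^lᵢ M = f, multiplied by T, where d(y^p - y) = -dy. The
form is chosen so that the coefficient of dx is lᵢ f plus a multiple of T, which is a unit over ρᵢ.
-/
theorem smul_D_y (S : IsArtinSchreier p ρ l f x y) (i : Fin r) :
    ((x - algebraMap k F (ρ i)) ^ (l i + 1) * Polynomial.aeval x (poleDenomErase ρ l i)) •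
        KaehlerDifferential.D k F y =
      ((l i : F) * Polynomial.aeval x f + (x - algebraMap k F (ρ i)) *
        ((y ^ p - y) * (x - algebraMap k F (ρ i)) ^ l i *
          Polynomial.aeval x (Polynomial.derivative (poleDenomErase ρ l i)) -
          Polynomial.aeval x (Polynomial.derivative f))) • KaehlerDifferential.D k F x := by
  set T := x - algebraMap k F (ρ i) with hT
  have h1 : (y ^ p - y) * (T ^ l i * Polynomial.aeval x (poleDenomErase ρ l i)) =
      Polynomial.aeval x f := by
    rw [← S.equation_mul, ← mul_poleDenomErase i]
    simp [hT]
  have hDT : KaehlerDifferential.D k F T = KaehlerDifferential.D k F x := by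
    rw [hT, map_sub, Derivation.map_algebraMap, sub_zero]
  have hpow : T ^ (l i - 1) * T = T ^ l i := by
    rw [← pow_succ, Nat.sub_add_cancel (S.l_pos i)]
  have h2 := congrArg (KaehlerDifferential.D k F) h1
  rw [Derivation.leibniz, D_pow_sub, Derivation.leibniz, Derivation.leibniz_pow, hDT,
    Derivation.map_aeval, Derivation.map_aeval] at h2
  rw [← h1]
  have h3 : (y ^ p - y) * (T ^ l i * Polynomial.aeval x (poleDenomErase ρ l i)) =
    (y ^ p - y) * (T ^ (l i - 1) * T * Polynomial.aeval x (poleDenomErase ρ l i)) := by rw [hpow]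
  rw [h3]
  have h4 := congrArg (fun ω => T • ω) h2
  simp only [← Nat.cast_smul_eq_nsmul F] at h4
  rw [pow_succ]
  rw [← hpow] at h4 ⊢
  clear_value T
  linear_combination (norm := module) (-1 : F) • h4

/-- As x - ρᵢ has order p, its leading term is killed by the derivation, so the order of dx is found
through dy: y = s^(-lᵢ) has derivative -lᵢ s^(-lᵢ) ≠ 0, and `smul_D_y` relates the two. The value is
(p-1)(lᵢ+1), the exponent of the different, plus the shift by one of s d/ds. -/
theorem order_eulerDerivation_ramified (S : IsArtinSchreier p ρ l f x y) {i : Fin r}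
    {τ : RatFunc k →ₐ[k] LaurentSeries k} {φ : F →ₐ[k] LaurentSeries k}
    (hτ : CentredAt (τ RatFunc.X) (ρ i) p) (h : ∀ b, φ (algebraMap (RatFunc k) F b) = τ b)
    (hy : φ y = HahnSeries.single (-(l i : ℤ)) 1) :
    ∃ n : ℤ, n = p * (l i + 1) - l i ∧ (eulerDerivation k (φ x)).orderTop = n := by
  have hx := S.apply_x h
  have hsub := S.apply_sub (α := ρ i) h
  have haeval : ∀ P : k[X], φ (Polynomial.aeval x P) = Polynomial.aeval (τ RatFunc.X) P :=
    fun P => by rw [← Polynomial.aeval_algHom_apply, hx]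
  have h1 := congrArg (pullback φ) (S.smul_D_y i)
  rw [pullback_smul, pullback_smul, pullback_D, pullback_D, hy, eulerDerivation_single] at h1
  have hl : ((-(l i : ℤ) : ℤ) : k) ≠ 0 := by
    push_cast
    exact neg_ne_zero.mpr (S.coe_l_ne_zero i)
  have hT0 : (φ (x - algebraMap k F (ρ i))).orderTop = (p : ℤ) := by
    rw [hsub, ← HahnSeries.order_eq_orderTop_of_ne_zero hτ.sub_ne_zero, hτ.order_sub]
  have hM := hτ.orderTop_aeval_eq_zero (eval_poleDenomErase_ne_zero (l := l) S.injective i)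
  have hf := hτ.orderTop_aeval_eq_zero (S.eval_f_ne_zero i)
  have hq : (φ ((y ^ p - y) * (x - algebraMap k F (ρ i)) ^ l i)).orderTop = 0 := by
    have h2 := congrArg φ S.equation_mul
    have h4 : Polynomial.aeval x (poleDenom ρ l) = (x - algebraMap k F (ρ i)) ^ l i *
        Polynomial.aeval x (poleDenomErase ρ l i) := by
      rw [← mul_poleDenomErase i]
      simp
    rw [h4, ← mul_assoc, map_mul, haeval, haeval] at h2
    have h3 := congrArg HahnSeries.orderTop h2
    rwa [HahnSeries.orderTop_mul, hM, hf, add_zero] at h3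
  have hB : (φ ((l i : F) * Polynomial.aeval x f + (x - algebraMap k F (ρ i)) *
        ((y ^ p - y) * (x - algebraMap k F (ρ i)) ^ l i *
          Polynomial.aeval x (Polynomial.derivative (poleDenomErase ρ l i)) -
          Polynomial.aeval x (Polynomial.derivative f)))).orderTop = 0 := by
    have hlf : (φ ((l i : F) * Polynomial.aeval x f)).orderTop = 0 := by
      rw [map_mul, haeval, HahnSeries.orderTop_mul, hf, add_zero, map_natCast,
        ← map_natCast (algebraMap k (LaurentSeries k)),
        orderTop_algebraMap (S.coe_l_ne_zero i)]
    rw [map_add, HahnSeries.orderTop_add_eq_left, hlf]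
    rw [hlf, map_mul, HahnSeries.orderTop_mul, hT0]
    refine lt_of_lt_of_le (b := ((p : ℤ) : WithTop ℤ) + 0) ?_ (add_le_add le_rfl ?_)
    · rw [add_zero]
      exact_mod_cast hτ.pos
    · rw [map_sub]
      refine (integralSeries k).sub_mem ?_ ?_
      · rw [map_mul]
        refine (integralSeries k).mul_mem _ _ (mem_integralSeries.mpr hq.ge) ?_
        rw [haeval]
        exact hτ.orderTop_aeval_nonneg _
      · rw [haeval]
        exact hτ.orderTop_aeval_nonneg _
  have h2 := congrArg HahnSeries.orderTop h1
  have hsubne : φ (x - algebraMap k F (ρ i)) ≠ 0 := by rw [hsub]; exact hτ.sub_ne_zero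
  have hMne : Polynomial.aeval (τ RatFunc.X) (poleDenomErase ρ l i) ≠ 0 := by
    intro h0
    simp [h0] at hM
  have hTord : (φ (x - algebraMap k F (ρ i))).order = p := by rw [hsub, hτ.order_sub]
  rw [HahnSeries.orderTop_mul, HahnSeries.orderTop_mul, hB, zero_add, map_mul, map_pow, haeval,
    HahnSeries.orderTop_mul, hM, add_zero, HahnSeries.orderTop_single (by simpa using hl),
    ← HahnSeries.order_eq_orderTop_of_ne_zero (pow_ne_zero _ hsubne), HahnSeries.order_pow,
    hTord, ← WithTop.coe_add] at h2
  refine ⟨_, ?_, h2.symm⟩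
  rw [nsmul_eq_mul]
  push_cast
  ring

/-- The order condition at a ramified point. -/
theorem eval_denom_ne_zero_of_ramified (S : IsArtinSchreier p ρ l f x y) {i : Fin r}
    {τ : RatFunc k →ₐ[k] LaurentSeries k} {φ : F →ₐ[k] LaurentSeries k}
    (hτ : CentredAt (τ RatFunc.X) (ρ i) p) (h : ∀ b, φ (algebraMap (RatFunc k) F b) = τ b)
    (hy : φ y = HahnSeries.single (-(l i : ℤ)) 1) {a : ℕ → RatFunc k} {G : RatFunc k} {N n : ℤ}
    (hN : N ≤ (φ (∑ j ∈ Finset.range p, algebraMap (RatFunc k) F (a j) * y ^ j)).orderTop)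
    {j : ℕ} (hj : j < p) {b : RatFunc k} (hb : a j = b * G) (hG : G ≠ 0)
    (hGn : (τ G).order = n) (hlt : n < N + l i * j + p) : b.denom.eval (ρ i) ≠ 0 := by
  rcases eq_or_ne b 0 with rfl | hb0
  · simp
  simp only [map_sum, map_mul, map_pow, h, hy] at hN
  have h1 := le_orderTop_ramified_term (S.coprime i) hτ hN hj
  have hτb : τ b ≠ 0 := by simpa using hb0
  have hτG : τ G ≠ 0 := by simpa using hG
  rw [hb, map_mul, pow_single, le_orderTop_iff_order
    (mul_ne_zero (mul_ne_zero hτb hτG) (by simp)), HahnSeries.order_mul (mul_ne_zero hτb hτG)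
    (by simp), HahnSeries.order_mul hτb hτG, hGn, HahnSeries.order_single one_ne_zero] at h1
  refine hτ.eval_denom_ne_zero (N := N + l i * j - n) (by linarith) ?_
  rw [le_orderTop_iff_order hτb]
  linarith

end IsArtinSchreier

end Setup

/-! ### Valuations of x - α at an arbitrary point -/

section Valuation

variable {k F : Type*} [Field k] [Field F] [Algebra k F]

namespace Place

theorem valuation_algebraMap (P : Place k F) {c : k} (hc : c ≠ 0) :
    P.ring.valuation (algebraMap k F c) = 1 := by
  have h1 := (P.ring.valuation_le_one_iff _).mpr (P.algebraMap_mem c)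
  have h2 := (P.ring.valuation_le_one_iff _).mpr (P.algebraMap_mem c⁻¹)
  refine le_antisymm h1 ?_
  rw [map_inv₀, map_inv₀] at h2
  have h0 : P.ring.valuation (algebraMap k F c) ≠ 0 := by simpa using hc
  exact (inv_le_one₀ (zero_lt_iff.mpr h0)).mp h2

theorem valuation_sub_eq_one (P : Place k F) {x : F} {α β : k}
    (hα : P.ring.valuation (x - algebraMap k F α) < 1) (hβ : β ≠ α) :
    P.ring.valuation (x - algebraMap k F β) = 1 := by
  have h1 : x - algebraMap k F β = (x - algebraMap k F α) + algebraMap k F (α - β) := by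
    rw [map_sub]; ring
  have h2 := P.valuation_algebraMap (sub_ne_zero.mpr hβ.symm)
  rw [h1, Valuation.map_add_eq_of_lt_right _ (by rw [h2]; exact hα), h2]

theorem mem_ring_iff (P : Place k F) {x : F} : x ∈ P.ring ↔ P.ring.valuation x ≤ 1 :=
  (P.ring.valuation_le_one_iff _).symm

theorem mem_nonunits_iff (P : Place k F) {x : F} :
    x ∈ P.ring.nonunits ↔ P.ring.valuation x < 1 := Iff.rfl

theorem mem_of_mem_nonunits (P : Place k F) {x : F} {α : k}
    (h : x - algebraMap k F α ∈ P.ring.nonunits) : x ∈ P.ring := by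
  have h1 : x - algebraMap k F α ∈ P.ring := P.mem_ring_iff.mpr (P.mem_nonunits_iff.mp h).le
  simpa using P.ring.add_mem _ _ h1 (P.algebraMap_mem α)

theorem not_mem_fibreInfty (P : Place k F) {x : F} (hx : x ≠ 0) (h : x ∈ P.ring) :
    P ∈ (fibreInfty k x)ᶜ := by
  intro (h1 : x⁻¹ ∈ P.ring.nonunits)
  rw [mem_nonunits_iff, map_inv₀] at h1
  rw [mem_ring_iff] at h
  have h0 : P.ring.valuation x ≠ 0 := by simpa using hx
  exact absurd ((inv_lt_one₀ (zero_lt_iff.mpr h0)).mp h1) (not_lt.mpr h)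

theorem not_mem_fibreZero (P : Place k F) {x : F} {α : k} (hα : α ≠ 0)
    (h : x - algebraMap k F α ∈ P.ring.nonunits) : P ∈ (fibreZero k x)ᶜ := by
  intro (h1 : x ∈ P.ring.nonunits)
  have h2 := P.valuation_sub_eq_one (P.mem_nonunits_iff.mp h) hα.symm
  rw [map_zero, sub_zero] at h2
  exact absurd (P.mem_nonunits_iff.mp h1) (by rw [h2]; exact lt_irrefl _)

end Place

end Valuation

/-! ### Where the exponents of g_μ come from -/

section Setup

variable {k F : Type*} [Field k] [Field F] [Algebra k F] [Algebra (RatFunc k) F]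
  [IsScalarTower k (RatFunc k) F] [IsAlgClosed k]
  {p : ℕ} [Fact p.Prime] [CharP k p] {r : ℕ} {ρ : Fin r → k} {l : Fin r → ℕ} {f : k[X]} {x y : F}

theorem apply_algebraMap_polynomial {A : Type*} [Field A] [Algebra k A] (τ : RatFunc k →ₐ[k] A)
    (P : k[X]) : τ (algebraMap k[X] (RatFunc k) P) = Polynomial.aeval (τ RatFunc.X) P := by
  rw [Polynomial.aeval_algHom_apply, RatFunc.aeval_X_left_eq_algebraMap]

theorem eval_denom_ne_zero_of_mul {α : k} {b G : RatFunc k}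
    (hG : ∀ τ : RatFunc k →ₐ[k] LaurentSeries k, CentredAt (τ RatFunc.X) α 1 →
      (τ G).orderTop = 0) (h : (b * G).denom.eval α ≠ 0) : b.denom.eval α ≠ 0 := by
  obtain ⟨τ, hτ, -⟩ := IsArtinSchreier.exists_algHom_centredAt α
  refine hτ.eval_denom_ne_zero (N := 0) (by norm_num) ?_
  have h1 : 0 ≤ (τ (b * G)).orderTop := by
    rw [algHom_ratFunc_apply, orderTop_div_of_eq_zero (hτ.orderTop_aeval_eq_zero h)]
    exact hτ.orderTop_aeval_nonneg _
  rw [map_mul, HahnSeries.orderTop_mul, hG τ hτ, add_zero] at h1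
  exact h1

theorem gPoly_ne_zero {μ : ℕ} : gPoly p ρ l μ ≠ 0 := poleDenom_ne_zero

theorem natDegree_gPoly {μ : ℕ} : (gPoly p ρ l μ).natDegree = tExp p l μ := natDegree_poleDenom

theorem eval_gPoly_ne_zero {α : k} (hα : ∀ i, α ≠ ρ i) (μ : ℕ) : (gPoly p ρ l μ).eval α ≠ 0 :=
  eval_poleDenom_ne_zero hα

theorem algebraMap_gPoly_ne_zero (μ : ℕ) :
    algebraMap k[X] (RatFunc k) (gPoly p ρ l μ) ≠ 0 := by
  simpa using gPoly_ne_zero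

theorem order_apply_gPoly (hρ : Function.Injective ρ) {i : Fin r}
    {τ : RatFunc k →ₐ[k] LaurentSeries k} {e : ℕ} (hτ : CentredAt (τ RatFunc.X) (ρ i) e) (μ : ℕ) :
    (τ (algebraMap k[X] (RatFunc k) (gPoly p ρ l μ))).order = e * mExp p l μ i := by
  rw [apply_algebraMap_polynomial, hτ.order_aeval gPoly_ne_zero, gPoly_eq_poleDenom,
    rootMultiplicity_poleDenom hρ]

theorem orderTop_apply_gPoly {α : k} (hα : ∀ i, α ≠ ρ i) {τ : RatFunc k →ₐ[k] LaurentSeries k}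
    (hτ : CentredAt (τ RatFunc.X) α 1) (μ : ℕ) :
    (τ (algebraMap k[X] (RatFunc k) (gPoly p ρ l μ))).orderTop = 0 := by
  rw [apply_algebraMap_polynomial]
  exact hτ.orderTop_aeval_eq_zero (eval_gPoly_ne_zero hα μ)

namespace IsArtinSchreier

theorem x_ne_zero (S : IsArtinSchreier p ρ l f x y) : x ≠ 0 := by
  have := S.aeval_ne_zero Polynomial.X_ne_zero
  rwa [Polynomial.aeval_X] at this

theorem exists_ramified_embedding (S : IsArtinSchreier p ρ l f x y) (i : Fin r) :
    ∃ (τ : RatFunc k →ₐ[k] LaurentSeries k) (φ : F →ₐ[k] LaurentSeries k),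
      CentredAt (τ RatFunc.X) (ρ i) p ∧ (∀ b, φ (algebraMap (RatFunc k) F b) = τ b) ∧
      φ y = HahnSeries.single (-(l i : ℤ)) 1 := by
  obtain ⟨τ, hτ, hη⟩ := exists_ramified_algHom (p := p) (by have := S.three_le; omega) S.injective i
    (S.coe_l_ne_zero i) (S.eval_f_ne_zero i)
  obtain ⟨φ, hφ1, hφ2⟩ := S.exists_embedding τ hη
  exact ⟨τ, φ, hτ, hφ1, hφ2⟩

/-- Over ρᵢ the order of g_{p-1-j} yʲ is p mᵢ - lᵢ j, which the floor in the definition of mᵢ keeps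
strictly below p. A pole of aⱼ would lower it by at least p and make the term irregular. -/
theorem eval_denom_ne_zero (S : IsArtinSchreier p ρ l f x y) {α : k} {a : ℕ → RatFunc k}
    (h : ∀ P : Place k F, x - algebraMap k F α ∈ P.ring.nonunits →
      ∑ j ∈ Finset.range p, algebraMap (RatFunc k) F (a j *
        algebraMap k[X] (RatFunc k) (gPoly p ρ l (p - 1 - j))) * y ^ j ∈ P.ring)
    {j : ℕ} (hj : j < p) : (a j).denom.eval α ≠ 0 := by
  by_cases hα : ∀ i, α ≠ ρ i
  · exact eval_denom_ne_zero_of_mul (fun τ hτ => orderTop_apply_gPoly hα hτ _)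
      (S.eval_denom_ne_zero_of_unramified (a := fun j => a j *
        algebraMap k[X] (RatFunc k) (gPoly p ρ l (p - 1 - j))) hα h hj)
  · push Not at hα
    obtain ⟨i, rfl⟩ := hα
    obtain ⟨τ, φ, hτ, hφ, hy⟩ := S.exists_ramified_embedding i
    refine S.eval_denom_ne_zero_of_ramified hτ hφ hy (N := 0)
      (mem_placeOf.mp (h _ (S.mem_nonunits_finitePlace hφ hτ))) hj rfl
      (algebraMap_gPoly_ne_zero _) (order_apply_gPoly S.injective hτ _) ?_
    have h1 : p * mExp p l (p - 1 - j) i ≤ j * l i + (p - 1) := by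
      rw [mExp, show p - 1 - (p - 1 - j) = j by omega]
      exact Nat.mul_div_le _ _
    have h2 : p * mExp p l (p - 1 - j) i < l i * j + p := by
      have := S.three_le
      rw [mul_comm (l i)]
      omega
    rw [zero_add]
    exact_mod_cast h2

theorem eval_denom_ne_zero_differential (S : IsArtinSchreier p ρ l f x y) {a : ℕ → RatFunc k}
    (h : ∀ P : Place k F, (∑ j ∈ Finset.range p, algebraMap (RatFunc k) F (a j *
        (algebraMap k[X] (RatFunc k) (gPoly p ρ l j))⁻¹) * y ^ j) •
      KaehlerDifferential.D k F x ∈ regularDifferentialsAt P)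
    {j : ℕ} (hj : j < p) (α : k) : (a j).denom.eval α ≠ 0 := by
  by_cases hα : ∀ i, α ≠ ρ i
  · refine eval_denom_ne_zero_of_mul (fun τ hτ => ?_)
      (S.eval_denom_ne_zero_of_unramified_differential (a := fun j => a j *
        (algebraMap k[X] (RatFunc k) (gPoly p ρ l j))⁻¹) hα h hj)
    rw [map_inv₀, ← one_div, orderTop_div_of_eq_zero (orderTop_apply_gPoly hα hτ _),
      HahnSeries.orderTop_one]
  · push Not at hα
    obtain ⟨i, rfl⟩ := hα
    obtain ⟨τ, φ, hτ, hφ, hy⟩ := S.exists_ramified_embedding i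
    obtain ⟨n, hn, hθ⟩ := S.order_eulerDerivation_ramified hτ hφ hy
    have h1 := one_le_orderTop_pullback (φ := φ) (fun w hw => mem_placeOf.mp hw)
      (h (S.finitePlace hφ hτ))
    rw [pullback_smul, pullback_D, HahnSeries.orderTop_mul, hθ,
      ← HahnSeries.orderTop_single (Γ := ℤ) (a := n) (one_ne_zero (α := k)),
      ← HahnSeries.orderTop_mul] at h1
    have hN := (le_orderTop_mul_single (N := 1 - n) (m := n)).mp (by rw [sub_add_cancel]; exact h1)
    refine S.eval_denom_ne_zero_of_ramified hτ hφ hy hN hj rfl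
      (inv_ne_zero (algebraMap_gPoly_ne_zero _)) (n := -(p * mExp p l j i)) ?_ ?_
    · rw [map_inv₀, order_inv, order_apply_gPoly S.injective hτ]
    -- With n = p(lᵢ+1) - lᵢ and the bound 1 - n on the function, the inequality required is (p-1-j)
    -- lᵢ ≤ p mᵢ, which is what rounding up provides.
    · have h2 : (p - 1 - j) * l i + (p - 1) < p * mExp p l j i + p := by
        rw [mExp]
        exact Nat.lt_mul_div_succ _ (by omega)
      have h3 : ((p : ℤ) - 1 - j) * l i + (p - 1) < p * mExp p l j i + p := by
        have : ((p - 1 - j : ℕ) : ℤ) = p - 1 - j := by omega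
        rw [← this]
        have h4 : ((p - 1 : ℕ) : ℤ) = p - 1 := by omega
        rw [← h4]
        exact_mod_cast h2
      rw [hn]
      linarith

end IsArtinSchreier

end Setup

/-! ### The points at infinity; spanning sets for regular functions and differentials -/

section Setup

variable {k F : Type*} [Field k] [Field F] [Algebra k F] [Algebra (RatFunc k) F]
  [IsScalarTower k (RatFunc k) F] [IsAlgClosed k]
  {p : ℕ} [Fact p.Prime] [CharP k p] {r : ℕ} {ρ : Fin r → k} {l : Fin r → ℕ} {f : k[X]} {x y : F}

/-- A family of embeddings over the point at infinity of the line, with parameter `1 / x`. -/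
structure InfinityFamily (x y : F) (τ : RatFunc k →ₐ[k] LaurentSeries k)
    (φ : ZMod p → F →ₐ[k] LaurentSeries k) (η : LaurentSeries k) : Prop extends
    UnramifiedFamily x y τ φ η where
  apply_X : τ RatFunc.X = HahnSeries.single (-1) 1

namespace IsArtinSchreier

/-- The equality of the degrees of f and of the denominator makes the right-hand side integral at
infinity, so infinity splits into p points with common parameter 1/x. -/
theorem exists_infinityFamily (S : IsArtinSchreier p ρ l f x y) :
    ∃ (τ : RatFunc k →ₐ[k] LaurentSeries k) (φ : ZMod p → F →ₐ[k] LaurentSeries k)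
      (η : LaurentSeries k), InfinityFamily x y τ φ η := by
  have hord : (HahnSeries.single (-1 : ℤ) (1 : k)).order = -1 :=
    HahnSeries.order_single one_ne_zero
  have hne : ∀ r : k, (HahnSeries.single (-1 : ℤ) (1 : k)) ≠ algebraMap k _ r := by
    intro r h
    have := congrArg HahnSeries.order h
    rw [hord, order_algebraMap] at this
    omega
  obtain ⟨τ, hτ⟩ := exists_algHom_ratFunc hne
  have h1 : 0 ≤ (Polynomial.aeval (τ RatFunc.X) f /
      Polynomial.aeval (τ RatFunc.X) (poleDenom ρ l)).orderTop := by
    rw [hτ]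
    obtain ⟨h2, h3⟩ := order_aeval_of_order_eq_neg_one hord S.f_ne_zero
    obtain ⟨h4, h5⟩ := order_aeval_of_order_eq_neg_one hord (poleDenom_ne_zero (ρ := ρ) (l := l))
    rw [HahnSeries.zero_le_orderTop_iff, order_div h2 h4, h3, h5, S.natDegree_eq,
      natDegree_poleDenom, sub_self]
  obtain ⟨φ, η, h⟩ := S.exists_unramifiedFamily h1
  exact ⟨τ, φ, η, h, hτ⟩

section Infinity

variable {τ : RatFunc k →ₐ[k] LaurentSeries k} {φ : ZMod p → F →ₐ[k] LaurentSeries k}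
  {η : LaurentSeries k}

theorem apply_inv_x (S : IsArtinSchreier p ρ l f x y) (h : InfinityFamily x y τ φ η) (c : ZMod p) :
    φ c x⁻¹ = HahnSeries.single 1 1 := by
  rw [map_inv₀, S.apply_x (h.apply_algebraMap c), h.apply_X, HahnSeries.inv_single, inv_one,
    neg_neg]

theorem orderTop_inv_x_pos (S : IsArtinSchreier p ρ l f x y) (h : InfinityFamily x y τ φ η)
    (c : ZMod p) : 0 < (φ c x⁻¹).orderTop := by
  rw [S.apply_inv_x h, HahnSeries.orderTop_single one_ne_zero]
  exact_mod_cast one_pos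

/-- The points at infinity of the curve. -/
def infinityPlace (S : IsArtinSchreier p ρ l f x y) (h : InfinityFamily x y τ φ η) (c : ZMod p) :
    Place k F :=
  placeOf (φ c) (inv_ne_zero S.x_ne_zero) (S.orderTop_inv_x_pos h c)

theorem mem_infinityPlace (S : IsArtinSchreier p ρ l f x y) (h : InfinityFamily x y τ φ η)
    {c : ZMod p} {w : F} : w ∈ (S.infinityPlace h c).ring ↔ 0 ≤ (φ c w).orderTop := Iff.rfl

theorem mem_nonunits_infinityPlace (S : IsArtinSchreier p ρ l f x y)
    (h : InfinityFamily x y τ φ η) {c : ZMod p} {w : F} :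
    w ∈ (S.infinityPlace h c).ring.nonunits ↔ 0 < (φ c w).orderTop := mem_nonunits_placeOf

theorem pullback_D_x (S : IsArtinSchreier p ρ l f x y) (h : InfinityFamily x y τ φ η)
    (c : ZMod p) : pullback (φ c) (KaehlerDifferential.D k F x) =
      -HahnSeries.single (-1) 1 := by
  rw [pullback_D, S.apply_x (h.apply_algebraMap c), h.apply_X, eulerDerivation_single]
  simp

end Infinity

/-- Regularity at finite points makes the numerators over g_j polynomials; regularity at infinity
bounds their degrees by t^(j) - 2. The monomials of such polynomials are exactly the x^(ν-1)
allowed. -/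
theorem mem_span_diffForm (S : IsArtinSchreier p ρ l f x y) {u : F}
    (h : u • KaehlerDifferential.D k F x ∈ H0 k F) : u • KaehlerDifferential.D k F x ∈
      Submodule.span k (Set.range fun i : DiffIndex p l =>
        diffForm p ρ l x y i.1.1 i.1.2) := by
  rw [H0, Submodule.mem_iInf] at h
  obtain ⟨b, hb⟩ := S.exists_sum_eq u
  obtain ⟨a, ha⟩ : ∃ a : ℕ → RatFunc k, ∀ j, b j = a j *
      (algebraMap k[X] (RatFunc k) (gPoly p ρ l j))⁻¹ :=
    ⟨fun j => b j * algebraMap k[X] (RatFunc k) (gPoly p ρ l j), fun j =>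
      (mul_inv_cancel_right₀ (algebraMap_gPoly_ne_zero _) _).symm⟩
  simp only [ha] at hb
  rw [hb] at h ⊢
  obtain ⟨τ, φ, η, hφ⟩ := S.exists_infinityFamily
  -- The form dx pulls back to -s^(-1), and regular forms have order at least 1; hence the bound 2.
  have hinf : ∀ j < p, 2 ≤ (τ (a j * (algebraMap k[X] (RatFunc k) (gPoly p ρ l j))⁻¹)).orderTop := by
    intro j hj
    refine hφ.le_orderTop (N := 2) (a := fun j => a j *
      (algebraMap k[X] (RatFunc k) (gPoly p ρ l j))⁻¹) (fun c => ?_) hj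
    have h1 := one_le_orderTop_pullback (φ := φ c) (fun w hw => mem_placeOf.mp hw)
      (h (S.infinityPlace hφ c))
    rw [pullback_smul, S.pullback_D_x hφ, mul_neg, HahnSeries.orderTop_neg] at h1
    exact (le_orderTop_mul_single (N := 2) (m := -1)).mp h1
  rw [Finset.sum_smul]
  refine Submodule.sum_mem _ fun j hj => ?_
  rw [Finset.mem_range] at hj
  have hden := denom_eq_one fun α => S.eval_denom_ne_zero_differential h hj α
  have hnum : a j = algebraMap k[X] (RatFunc k) (a j).num := by
    conv_lhs => rw [← RatFunc.num_div_denom (a j), hden, map_one, div_one]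
  set P := (a j).num with hP
  rcases eq_or_ne P 0 with hP0 | hP0
  · rw [hnum, hP0]
    simp
  have hord : (HahnSeries.single (-1 : ℤ) (1 : k)).order = -1 :=
    HahnSeries.order_single one_ne_zero
  have hdeg : P.natDegree + 2 ≤ tExp p l j := by
    have h1 := hinf j hj
    obtain ⟨h2, h3⟩ := order_aeval_of_order_eq_neg_one hord hP0
    obtain ⟨h4, h5⟩ := order_aeval_of_order_eq_neg_one hord (gPoly_ne_zero (p := p) (ρ := ρ)
      (l := l) (μ := j))
    rw [hnum, map_mul, map_inv₀, apply_algebraMap_polynomial, apply_algebraMap_polynomial,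
      hφ.apply_X, ← div_eq_mul_inv] at h1
    have h6 := (le_orderTop_iff_order (div_ne_zero h2 h4) (n := 2)).mp h1
    rw [order_div h2 h4, h3, h5, natDegree_gPoly] at h6
    omega
  rw [hnum, map_mul, map_inv₀, ← S.aeval_eq, ← S.aeval_eq, Polynomial.aeval_eq_sum_range,
    Finset.sum_mul, Finset.sum_mul, Finset.sum_smul]
  refine Submodule.sum_mem _ fun i hi => ?_
  rw [Finset.mem_range] at hi
  have h7 : (P.coeff i • x ^ i * (Polynomial.aeval x (gPoly p ρ l j))⁻¹ * y ^ j) •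
      KaehlerDifferential.D k F x = P.coeff i • diffForm p ρ l x y j (i + 1) := by
    rw [diffForm, Nat.add_sub_cancel, ← smul_assoc]
    congr 1
    rw [smul_mul_assoc, smul_mul_assoc]
    congr 1
    ring
  rw [h7]
  exact Submodule.smul_mem _ _ (Submodule.subset_span
    ⟨⟨(j, i + 1), by dsimp only; omega, by dsimp only; omega, by dsimp only; omega,
      by dsimp only; omega⟩, rfl⟩)

end IsArtinSchreier

/-- The functions `xⁿ g_{p-1-j}(x) yʲ`. -/
def monomialFun (p : ℕ) (ρ : Fin r → k) (l : Fin r → ℕ) (x y : F) (j : ℕ) (n : ℤ) : F :=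
  x ^ n * Polynomial.aeval x (gPoly p ρ l (p - 1 - j)) * y ^ j

namespace IsArtinSchreier

theorem mem_span_monomialFun_aux (S : IsArtinSchreier p ρ l f x y) {u : F} {N : Set ℤ}
    {a : ℕ → RatFunc k} (hu : u = ∑ j ∈ Finset.range p, algebraMap (RatFunc k) F (a j *
        algebraMap k[X] (RatFunc k) (gPoly p ρ l (p - 1 - j))) * y ^ j)
    (ha : ∀ j < p, ∃ m : ℕ, (a j).denom = Polynomial.X ^ m ∧ ∀ i : ℕ, (i : ℤ) - m ∈ N) :
    u ∈ Submodule.span k {w | ∃ j < p, ∃ n ∈ N, w = monomialFun p ρ l x y j n} := by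
  rw [hu]
  refine Submodule.sum_mem _ fun j hj => ?_
  rw [Finset.mem_range] at hj
  obtain ⟨m, hm, hN⟩ := ha j hj
  have hnum : algebraMap (RatFunc k) F (a j) = Polynomial.aeval x (a j).num / x ^ m := by
    conv_lhs => rw [← RatFunc.num_div_denom (a j), hm, map_div₀, ← S.aeval_eq, ← S.aeval_eq,
      map_pow, Polynomial.aeval_X]
  rw [map_mul, ← S.aeval_eq, hnum, Polynomial.aeval_eq_sum_range, Finset.sum_div, Finset.sum_mul,
    Finset.sum_mul]
  refine Submodule.sum_mem _ fun i _ => ?_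
  have h7 : (a j).num.coeff i • x ^ i / x ^ m *
      Polynomial.aeval x (gPoly p ρ l (p - 1 - j)) * y ^ j =
      (a j).num.coeff i • monomialFun p ρ l x y j (i - m) := by
    rw [monomialFun, zpow_sub₀ S.x_ne_zero, zpow_natCast, zpow_natCast, smul_div_assoc,
      smul_mul_assoc, smul_mul_assoc]
  rw [h7]
  exact Submodule.smul_mem _ _ (Submodule.subset_span ⟨j, hj, _, hN i, rfl⟩)

theorem exists_sum_gPoly_eq (S : IsArtinSchreier p ρ l f x y) (u : F) : ∃ a : ℕ → RatFunc k,
    u = ∑ j ∈ Finset.range p, algebraMap (RatFunc k) F (a j *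
      algebraMap k[X] (RatFunc k) (gPoly p ρ l (p - 1 - j))) * y ^ j := by
  obtain ⟨b, hb⟩ := S.exists_sum_eq u
  obtain ⟨a, ha⟩ : ∃ a : ℕ → RatFunc k, ∀ j, b j = a j *
      algebraMap k[X] (RatFunc k) (gPoly p ρ l (p - 1 - j)) :=
    ⟨fun j => b j * (algebraMap k[X] (RatFunc k) (gPoly p ρ l (p - 1 - j)))⁻¹, fun j =>
      (inv_mul_cancel_right₀ (algebraMap_gPoly_ne_zero _) _).symm⟩
  simp only [ha] at hb
  exact ⟨a, hb⟩

theorem mem_span_of_mem_cocycles (S : IsArtinSchreier p ρ l f x y) {u : F}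
    (hu : u ∈ cocycles k x) :
    u ∈ Submodule.span k {w | ∃ j < p, ∃ n ∈ (Set.univ : Set ℤ), w = monomialFun p ρ l x y j n} := by
  obtain ⟨a, ha⟩ := S.exists_sum_gPoly_eq (ρ := ρ) (l := l) u
  refine S.mem_span_monomialFun_aux ha fun j hj => ?_
  obtain ⟨m, hm⟩ := denom_eq_X_pow fun α hα => S.eval_denom_ne_zero (α := α) (a := a)
    (fun P hP => by
      rw [← ha]
      exact hu P ⟨P.not_mem_fibreZero hα hP,
        P.not_mem_fibreInfty S.x_ne_zero (P.mem_of_mem_nonunits hP)⟩) hj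
  exact ⟨m, hm, fun i => Set.mem_univ _⟩

theorem mem_span_of_regular (S : IsArtinSchreier p ρ l f x y) {u : F}
    (hu : u ∈ regularFunctions ((fibreInfty k x)ᶜ)) :
    u ∈ Submodule.span k {w | ∃ j < p, ∃ n ∈ Set.Ici (0 : ℤ), w = monomialFun p ρ l x y j n} := by
  obtain ⟨a, ha⟩ := S.exists_sum_gPoly_eq (ρ := ρ) (l := l) u
  refine S.mem_span_monomialFun_aux ha fun j hj => ?_
  have hm := denom_eq_one fun α => S.eval_denom_ne_zero (α := α) (a := a)
    (fun P hP => by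
      rw [← ha]
      exact hu P (P.not_mem_fibreInfty S.x_ne_zero (P.mem_of_mem_nonunits hP))) hj
  exact ⟨0, by rw [hm, pow_zero], fun i => by simp⟩

/-- The form dx generates all differentials: dy = -d(y^p - y) is the negative of the differential of
a rational function of x. -/
theorem exists_smul_D (S : IsArtinSchreier p ρ l f x y) (ω : Ω[F⁄k]) :
    ∃ u : F, ω = u • KaehlerDifferential.D k F x := by
  set M := Submodule.span F {KaehlerDifferential.D k F x} with hM
  have hx : KaehlerDifferential.D k F x ∈ M := Submodule.mem_span_singleton_self _
  have hrat : ∀ b, KaehlerDifferential.D k F (algebraMap (RatFunc k) F b) ∈ M := by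
    intro b
    have h1 : algebraMap (RatFunc k) F b =
        Polynomial.aeval x b.num / Polynomial.aeval x b.denom := by
      rw [S.aeval_eq, S.aeval_eq, ← map_div₀, RatFunc.num_div_denom]
    rw [h1, Derivation.leibniz_div, Derivation.map_aeval, Derivation.map_aeval]
    exact M.smul_mem _ (M.sub_mem (M.smul_mem _ (M.smul_mem _ hx))
      (M.smul_mem _ (M.smul_mem _ hx)))
  have hy : KaehlerDifferential.D k F y ∈ M := by
    have h1 := hrat (rhs f ρ l)
    rw [← S.equation, D_pow_sub] at h1
    simpa using h1
  have hall : ∀ u, KaehlerDifferential.D k F u ∈ M := by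
    intro u
    obtain ⟨b, rfl⟩ := S.exists_sum_eq u
    rw [map_sum]
    refine M.sum_mem fun j _ => ?_
    rw [Derivation.leibniz, Derivation.leibniz_pow, ← Nat.cast_smul_eq_nsmul F]
    exact M.add_mem (M.smul_mem _ (M.smul_mem _ (M.smul_mem _ hy))) (M.smul_mem _ (hrat _))
  have hω : ω ∈ M := by
    have h1 : ω ∈ Submodule.span F (Set.range (KaehlerDifferential.D k F)) := by
      rw [KaehlerDifferential.span_range_derivation]; trivial
    refine Submodule.span_le.mpr ?_ h1
    rintro _ ⟨u, rfl⟩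
    exact hall u
  obtain ⟨u, hu⟩ := Submodule.mem_span_singleton.mp hω
  exact ⟨u, hu.symm⟩

end IsArtinSchreier

end Setup

/-! ### Valuations of polynomials in x and of y at an arbitrary point -/

section Valuation

variable {k F : Type*} [Field k] [Field F] [Algebra k F]

namespace Place

theorem exists_not_mem (P : Place k F) : ∃ z, z ∉ P.ring := by
  by_contra! h
  have := P.isDVR
  obtain ⟨z, hz, hz0⟩ := Submodule.exists_mem_ne_zero_of_ne_bot
    (IsDiscreteValuationRing.not_a_field P.ring)
  rw [IsLocalRing.mem_maximalIdeal, _root_.mem_nonunits_iff] at hz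
  refine hz (IsUnit.of_mul_eq_one ⟨(z : F)⁻¹, h _⟩ (Subtype.ext ?_))
  exact mul_inv_cancel₀ fun h0 => hz0 (Subtype.ext h0)

theorem ext_ring {P Q : Place k F} (h : P.ring = Q.ring) : P = Q := by
  cases P
  cases Q
  simpa using h

theorem valuation_aeval [IsAlgClosed k] (P : Place k F) (x : F) {G : k[X]} (hG : G ≠ 0) :
    P.ring.valuation (Polynomial.aeval x G) =
      (G.roots.map fun r => P.ring.valuation (x - algebraMap k F r)).prod := by
  rw [aeval_eq_prod_roots, map_mul, P.valuation_algebraMap (by simpa using hG), one_mul,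
    map_multiset_prod, Multiset.map_map]
  rfl

theorem valuation_aeval_eq_one [IsAlgClosed k] (P : Place k F) {x : F} {G : k[X]} (hG : G ≠ 0)
    (h : ∀ r, G.IsRoot r → P.ring.valuation (x - algebraMap k F r) = 1) :
    P.ring.valuation (Polynomial.aeval x G) = 1 := by
  rw [P.valuation_aeval x hG]
  refine Multiset.prod_eq_one fun v hv => ?_
  obtain ⟨r, hr, rfl⟩ := Multiset.mem_map.mp hv
  exact h r (Polynomial.isRoot_of_mem_roots hr)

theorem valuation_aeval_of_centre [IsAlgClosed k] (P : Place k F) {x : F} {α : k}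
    (hα : P.ring.valuation (x - algebraMap k F α) < 1) {G : k[X]} (hG : G.eval α ≠ 0) :
    P.ring.valuation (Polynomial.aeval x G) = 1 := by
  refine P.valuation_aeval_eq_one (by rintro rfl; simp at hG) fun r hr => ?_
  exact P.valuation_sub_eq_one hα fun h => hG (h ▸ hr)

theorem valuation_sub_of_one_lt (P : Place k F) {x : F} (hx : 1 < P.ring.valuation x) (r : k) :
    P.ring.valuation (x - algebraMap k F r) = P.ring.valuation x := by
  rw [Valuation.map_sub_eq_of_lt_left]
  exact lt_of_le_of_lt ((P.ring.valuation_le_one_iff _).mpr (P.algebraMap_mem r)) hx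

theorem valuation_aeval_of_one_lt [IsAlgClosed k] (P : Place k F) {x : F}
    (hx : 1 < P.ring.valuation x) {G : k[X]} (hG : G ≠ 0) :
    P.ring.valuation (Polynomial.aeval x G) = P.ring.valuation x ^ G.natDegree := by
  rw [P.valuation_aeval x hG, (IsAlgClosed.splits G).natDegree_eq_card_roots]
  simp only [P.valuation_sub_of_one_lt hx, Multiset.map_const', Multiset.prod_replicate]

theorem valuation_le_one_of_pow_sub (P : Place k F) {y : F} {p : ℕ} (hp : 2 ≤ p)
    (h : P.ring.valuation (y ^ p - y) ≤ 1) : P.ring.valuation y ≤ 1 := by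
  by_contra! hy
  have h1 : P.ring.valuation y < P.ring.valuation (y ^ p) := by
    rw [map_pow]
    exact lt_self_pow₀ hy (by omega)
  rw [Valuation.map_sub_eq_of_lt_left _ h1] at h
  exact absurd h (not_le.mpr (hy.trans h1))

theorem valuation_pow_sub (P : Place k F) {y : F} {p : ℕ} (hp : 2 ≤ p)
    (h : 1 < P.ring.valuation (y ^ p - y)) :
    1 < P.ring.valuation y ∧ P.ring.valuation (y ^ p - y) = P.ring.valuation y ^ p := by
  have hy : 1 < P.ring.valuation y := by
    by_contra! hy
    have h1 : y ∈ P.ring := P.mem_ring_iff.mpr hy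
    exact absurd (P.mem_ring_iff.mp (P.ring.sub_mem (pow_mem h1 p) h1)) (not_le.mpr h)
  have h1 : P.ring.valuation y < P.ring.valuation (y ^ p) := by
    rw [map_pow]
    exact lt_self_pow₀ hy (by omega)
  rw [Valuation.map_sub_eq_of_lt_left _ h1, map_pow]
  exact ⟨hy, rfl⟩

theorem mem_of_not_mem_fibreInfty (P : Place k F) {x : F}
    (h : P ∈ (fibreInfty k x)ᶜ) : P.ring.valuation x ≤ 1 := by
  by_contra! h1
  refine h (P.mem_nonunits_iff.mpr ?_)
  rw [map_inv₀]
  exact inv_lt_one_of_one_lt₀ h1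

theorem one_lt_of_mem_fibreInfty (P : Place k F) {x : F} (hx : x ≠ 0)
    (h : P ∈ fibreInfty k x) : 1 < P.ring.valuation x := by
  have h1 : x⁻¹ ∈ P.ring.nonunits := h
  rw [P.mem_nonunits_iff, map_inv₀] at h1
  exact (inv_lt_one₀ (zero_lt_iff.mpr (by simpa using hx))).mp h1

theorem one_le_of_not_mem_fibreZero (P : Place k F) {x : F}
    (h : P ∈ (fibreZero k x)ᶜ) : 1 ≤ P.ring.valuation x :=
  not_lt.mp fun h1 => h (P.mem_nonunits_iff.mpr h1)

end Place

theorem zpow_le_one_of_le_one {Γ : Type*} [LinearOrderedCommGroupWithZero Γ] {σ : Γ}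
    (hσ : σ ≤ 1) {n : ℤ} (hn : 0 ≤ n) : σ ^ n ≤ 1 := by
  obtain ⟨m, rfl⟩ := Int.eq_ofNat_of_zero_le hn
  rw [zpow_natCast]
  exact pow_le_one₀ zero_le hσ

end Valuation

/-! ### Regularity of the functions xⁿ g_{p-1-j} yʲ -/

section Setup

variable {k F : Type*} [Field k] [Field F] [Algebra k F] [Algebra (RatFunc k) F]
  [IsScalarTower k (RatFunc k) F] [IsAlgClosed k]
  {p : ℕ} [Fact p.Prime] [CharP k p] {r : ℕ} {ρ : Fin r → k} {l : Fin r → ℕ} {f : k[X]} {x y : F}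

namespace IsArtinSchreier

theorem algebraMap_eq (S : IsArtinSchreier p ρ l f x y) (b : RatFunc k) :
    algebraMap (RatFunc k) F b = Polynomial.aeval x b.num / Polynomial.aeval x b.denom := by
  rw [S.aeval_eq, S.aeval_eq, ← map_div₀, RatFunc.num_div_denom]

theorem valuation_equation (S : IsArtinSchreier p ρ l f x y) (P : Place k F) :
    P.ring.valuation (y ^ p - y) = P.ring.valuation (Polynomial.aeval x f) /
      P.ring.valuation (Polynomial.aeval x (poleDenom ρ l)) := by
  rw [S.algebraMap_rhs, map_div₀]

/-- Without a centre every nonzero polynomial in x would be a unit, so y would be integral and the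
ring would be all of F, contradicting that it is not a field. -/
theorem exists_centre (S : IsArtinSchreier p ρ l f x y) (P : Place k F)
    (hx : P.ring.valuation x ≤ 1) : ∃ α, P.ring.valuation (x - algebraMap k F α) < 1 := by
  by_contra! h
  have h1 : ∀ α, P.ring.valuation (x - algebraMap k F α) = 1 := fun α =>
    le_antisymm (P.mem_ring_iff.mp
      (P.ring.sub_mem (P.mem_ring_iff.mpr hx) (P.algebraMap_mem α))) (h α)
  have h2 : ∀ G : k[X], G ≠ 0 → P.ring.valuation (Polynomial.aeval x G) = 1 := fun G hG =>
    P.valuation_aeval_eq_one hG fun r _ => h1 r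
  have hy : P.ring.valuation y ≤ 1 := by
    refine P.valuation_le_one_of_pow_sub (p := p) (by have := S.three_le; omega) ?_
    rw [S.valuation_equation, h2 _ S.f_ne_zero, h2 _ poleDenom_ne_zero, div_one]
  obtain ⟨z, hz⟩ := P.exists_not_mem
  apply hz
  obtain ⟨b, rfl⟩ := S.exists_sum_eq z
  refine sum_mem fun j _ => mul_mem ?_ (pow_mem (P.mem_ring_iff.mpr hy) j)
  rw [P.mem_ring_iff, S.algebraMap_eq, map_div₀, h2 _ (RatFunc.denom_ne_zero _), div_one]
  rcases eq_or_ne (b j).num 0 with h0 | h0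
  · simp [h0]
  · exact (h2 _ h0).le

theorem valuation_y_of_unramified (S : IsArtinSchreier p ρ l f x y) (P : Place k F) {α : k}
    (hα : P.ring.valuation (x - algebraMap k F α) < 1) (hne : ∀ i, α ≠ ρ i) :
    P.ring.valuation y ≤ 1 := by
  refine P.valuation_le_one_of_pow_sub (p := p) (by have := S.three_le; omega) ?_
  have hx : x ∈ P.ring := P.mem_of_mem_nonunits hα
  rw [S.valuation_equation, P.valuation_aeval_of_centre hα (eval_poleDenom_ne_zero hne), div_one]
  rw [← P.mem_ring_iff, Polynomial.aeval_eq_sum_range]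
  refine sum_mem fun i _ => ?_
  rw [Algebra.smul_def]
  exact mul_mem (P.algebraMap_mem _) (pow_mem hx i)

theorem valuation_y_of_infinity (S : IsArtinSchreier p ρ l f x y) (P : Place k F)
    (hx : 1 < P.ring.valuation x) : P.ring.valuation y ≤ 1 := by
  refine P.valuation_le_one_of_pow_sub (p := p) (by have := S.three_le; omega) ?_
  rw [S.valuation_equation, P.valuation_aeval_of_one_lt hx S.f_ne_zero,
    P.valuation_aeval_of_one_lt hx poleDenom_ne_zero, S.natDegree_eq, natDegree_poleDenom,
    div_self]
  exact pow_ne_zero _ (zero_lt_one.trans hx).ne'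

/-- A local parameter `T ^ A * y ^ B` with `p * A - lᵢ * B = 1` at a ramified point. -/
theorem exists_parameter (S : IsArtinSchreier p ρ l f x y) (P : Place k F) {i : Fin r}
    (hi : P.ring.valuation (x - algebraMap k F (ρ i)) < 1) :
    ∃ A B : ℤ, ∃ σ : P.ring.ValueGroup, (p : ℤ) * A - l i * B = 1 ∧
      σ = P.ring.valuation ((x - algebraMap k F (ρ i)) ^ A * y ^ B) ∧ σ ≠ 0 ∧ σ < 1 ∧
      P.ring.valuation (x - algebraMap k F (ρ i)) = σ ^ (p : ℤ) ∧
      P.ring.valuation y = σ ^ (-(l i : ℤ)) := by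
  set T := x - algebraMap k F (ρ i) with hT
  have hp : 2 ≤ p := by have := S.three_le; omega
  have hT0 : T ≠ 0 := by
    have := S.aeval_ne_zero (Polynomial.X_sub_C_ne_zero (ρ i))
    simpa using this
  have hvT0 : P.ring.valuation T ≠ 0 := by simpa using hT0
  -- Bézout: a lᵢ + b p = 1, so A = b and B = -a. The equation gives v(y)^p = v(T)^(-lᵢ), from which
  -- v(T) and v(y) are both powers of the value of T^A y^B.
  obtain ⟨a, b, hab⟩ := Nat.isCoprime_iff_coprime.mpr (S.coprime i)
  have hM := P.valuation_aeval_of_centre hi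
    (eval_poleDenomErase_ne_zero (l := l) S.injective i)
  have hf := P.valuation_aeval_of_centre hi (S.eval_f_ne_zero i)
  have hq : P.ring.valuation (y ^ p - y) = P.ring.valuation T ^ (-(l i : ℤ)) := by
    rw [S.valuation_equation, hf, ← mul_poleDenomErase i]
    simp only [map_mul, map_pow, map_sub, Polynomial.aeval_X, Polynomial.aeval_C]
    rw [hM, mul_one, zpow_neg, zpow_natCast, one_div]
  have hq1 : 1 < P.ring.valuation (y ^ p - y) := by
    rw [hq, zpow_neg, zpow_natCast, one_lt_inv₀ (pow_pos (zero_lt_iff.mpr hvT0) _)]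
    exact pow_lt_one₀ zero_le hi (S.l_pos i).ne'
  obtain ⟨hy1, hy⟩ := P.valuation_pow_sub hp hq1
  rw [hq] at hy
  have hvy0 : P.ring.valuation y ≠ 0 := (zero_lt_one.trans hy1).ne'
  refine ⟨b, -a, _, by linear_combination hab, rfl, ?_, ?_⟩
  · rw [map_mul, map_zpow₀, map_zpow₀]
    exact mul_ne_zero (zpow_ne_zero _ hvT0) (zpow_ne_zero _ hvy0)
  have hyz : P.ring.valuation y ^ (p : ℤ) = P.ring.valuation T ^ (-(l i : ℤ)) := by
    rw [zpow_natCast, hy]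
  have h1 : P.ring.valuation T = P.ring.valuation (T ^ b * y ^ (-a)) ^ (p : ℤ) := by
    rw [map_mul, map_zpow₀, map_zpow₀, mul_zpow, ← zpow_mul, ← zpow_mul, mul_comm (-a),
      zpow_mul (P.ring.valuation y), hyz, ← zpow_mul, ← zpow_add₀ hvT0,
      show b * p + -(l i : ℤ) * -a = 1 by linear_combination hab, zpow_one]
  refine ⟨?_, h1, ?_⟩
  · rw [h1, zpow_natCast] at hi
    exact (pow_lt_one_iff_of_nonneg zero_le (by omega)).mp hi
  · rw [map_mul, map_zpow₀, map_zpow₀, mul_zpow, ← zpow_mul, ← zpow_mul, mul_comm b,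
      zpow_mul (P.ring.valuation T), ← hyz, ← zpow_mul, ← zpow_add₀ hvy0,
      show (p : ℤ) * b + -a * -(l i : ℤ) = 1 by linear_combination hab, zpow_one]

theorem valuation_gPoly (S : IsArtinSchreier p ρ l f x y) (P : Place k F) {i : Fin r}
    (hi : P.ring.valuation (x - algebraMap k F (ρ i)) < 1) (μ : ℕ) :
    P.ring.valuation (Polynomial.aeval x (gPoly p ρ l μ)) =
      P.ring.valuation (x - algebraMap k F (ρ i)) ^ mExp p l μ i := by
  rw [gPoly_eq_poleDenom, ← mul_poleDenomErase i]
  simp only [map_mul, map_pow, map_sub, Polynomial.aeval_X, Polynomial.aeval_C]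
  rw [P.valuation_aeval_of_centre hi (eval_poleDenomErase_ne_zero S.injective i), mul_one]

theorem mul_mExp_le {j : ℕ} (hp : 0 < p) (i : Fin r) :
    p * mExp p l j i ≤ (p - 1 - j) * l i + (p - 1) ∧
      (p - 1 - j) * l i ≤ p * mExp p l j i := by
  refine ⟨Nat.mul_div_le _ _, ?_⟩
  have := Nat.lt_mul_div_succ ((p - 1 - j) * l i + (p - 1)) hp
  rw [mul_add] at this
  change _ < p * mExp p l j i + p * 1 at this
  omega

/-- Over ρᵢ the exponent of the local parameter is p mᵢ - lᵢ j, with mᵢ the exponent in g_{p-1-j};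
it is nonnegative because mᵢ is lᵢ j / p rounded up. -/
theorem valuation_gPoly_mul_pow_le_one (S : IsArtinSchreier p ρ l f x y) (P : Place k F)
    (hx : P.ring.valuation x ≤ 1) {j : ℕ} (hj : j < p) :
    P.ring.valuation (Polynomial.aeval x (gPoly p ρ l (p - 1 - j)) * y ^ j) ≤ 1 := by
  obtain ⟨α, hα⟩ := S.exists_centre P hx
  by_cases hne : ∀ i, α ≠ ρ i
  · rw [map_mul, map_pow, P.valuation_aeval_of_centre hα (eval_gPoly_ne_zero hne _), one_mul]
    exact pow_le_one₀ zero_le (S.valuation_y_of_unramified P hα hne)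
  · push Not at hne
    obtain ⟨i, rfl⟩ := hne
    obtain ⟨A, B, σ, -, -, hσ0, hσ1, hT, hy⟩ := S.exists_parameter P hα
    have hp := S.three_le
    rw [map_mul, map_pow, S.valuation_gPoly P hα, hT, hy, ← zpow_natCast, ← zpow_natCast,
      ← zpow_mul, ← zpow_mul, ← zpow_add₀ hσ0]
    refine zpow_le_one_of_le_one hσ1.le ?_
    have h1 := (mul_mExp_le (p := p) (l := l) (j := p - 1 - j) (by omega) i).2
    rw [show p - 1 - (p - 1 - j) = j by omega] at h1
    have h2 : (j : ℤ) * l i ≤ p * mExp p l (p - 1 - j) i := by exact_mod_cast h1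
    linarith

theorem monomialFun_mem_of_le_one (S : IsArtinSchreier p ρ l f x y) (P : Place k F)
    (hx : P.ring.valuation x ≤ 1) {j : ℕ} (hj : j < p) {n : ℤ}
    (hn : P.ring.valuation (x ^ n) ≤ 1) : monomialFun p ρ l x y j n ∈ P.ring := by
  rw [P.mem_ring_iff, monomialFun, mul_assoc, map_mul]
  exact mul_le_one' hn (S.valuation_gPoly_mul_pow_le_one P hx hj)

theorem monomialFun_mem_regular_infty (S : IsArtinSchreier p ρ l f x y) {j : ℕ} (hj : j < p)
    {n : ℤ} (hn : 0 ≤ n) : monomialFun p ρ l x y j n ∈ regularFunctions ((fibreInfty k x)ᶜ) := by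
  intro P hP
  have hx := P.mem_of_not_mem_fibreInfty hP
  refine S.monomialFun_mem_of_le_one P hx hj ?_
  rw [map_zpow₀]
  exact zpow_le_one_of_le_one hx hn

theorem monomialFun_mem_cocycles (S : IsArtinSchreier p ρ l f x y) {j : ℕ} (hj : j < p)
    (n : ℤ) : monomialFun p ρ l x y j n ∈ cocycles k x := by
  rintro P ⟨hP0, hP⟩
  have hx := P.mem_of_not_mem_fibreInfty hP
  refine S.monomialFun_mem_of_le_one P hx hj ?_
  rw [map_zpow₀, le_antisymm hx (P.one_le_of_not_mem_fibreZero hP0), one_zpow]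

/-- At infinity y is integral and g has a pole of order t in 1/x, which xⁿ cancels exactly when n ≤
-t. -/
theorem monomialFun_mem_regular_zero (S : IsArtinSchreier p ρ l f x y) {j : ℕ} (hj : j < p)
    {n : ℤ} (hn : n ≤ -(tExp p l (p - 1 - j) : ℤ)) :
    monomialFun p ρ l x y j n ∈ regularFunctions ((fibreZero k x)ᶜ) := by
  intro P hP
  by_cases hP' : P ∈ fibreInfty k x
  · have hx := P.one_lt_of_mem_fibreInfty S.x_ne_zero hP'
    have hy := S.valuation_y_of_infinity P hx
    rw [P.mem_ring_iff, monomialFun, map_mul, map_mul, map_zpow₀, map_pow,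
      P.valuation_aeval_of_one_lt hx gPoly_ne_zero, natDegree_gPoly, ← zpow_natCast,
      ← zpow_add₀ (zero_lt_one.trans hx).ne']
    refine mul_le_one' ?_ (pow_le_one₀ zero_le hy)
    rw [← neg_neg (n + _), ← inv_zpow']
    exact zpow_le_one_of_le_one (inv_lt_one_of_one_lt₀ hx).le (by omega)
  · exact S.monomialFun_mem_cocycles hj n P ⟨hP, hP'⟩

end IsArtinSchreier

end Setup

/-! ### Regularity of the differentials ω_{μ,ν} -/

namespace Place

variable {k F : Type*} [Field k] [Field F] [Algebra k F]

theorem smul_D_mem (P : Place k F) {u a : F} (hu : P.ring.valuation u ≤ 1)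
    (ha : P.ring.valuation a ≤ 1) :
    u • KaehlerDifferential.D k F a ∈ regularDifferentialsAt P :=
  Submodule.subset_span ⟨u, P.mem_ring_iff.mpr hu, a, P.mem_ring_iff.mpr ha, rfl⟩

theorem valuation_aeval_le_one (P : Place k F) {x : F} (hx : P.ring.valuation x ≤ 1) (G : k[X]) :
    P.ring.valuation (Polynomial.aeval x G) ≤ 1 := by
  rw [← P.mem_ring_iff] at hx ⊢
  rw [Polynomial.aeval_eq_sum_range]
  refine sum_mem fun i _ => ?_
  rw [Algebra.smul_def]
  exact mul_mem (P.algebraMap_mem _) (pow_mem hx i)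

theorem valuation_le_one_of_sub (P : Place k F) {x : F} {α : k}
    (h : P.ring.valuation (x - algebraMap k F α) < 1) : P.ring.valuation x ≤ 1 :=
  P.mem_ring_iff.mp (P.mem_of_mem_nonunits h)

end Place

section Setup

variable {k F : Type*} [Field k] [Field F] [Algebra k F] [Algebra (RatFunc k) F]
  [IsScalarTower k (RatFunc k) F] [IsAlgClosed k]
  {p : ℕ} [Fact p.Prime] [CharP k p] {r : ℕ} {ρ : Fin r → k} {l : Fin r → ℕ} {f : k[X]} {x y : F}

theorem smul_D_eq_smul_D_inv (hx : x ≠ 0) (u : F) :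
    u • KaehlerDifferential.D k F x = -(u * x ^ 2) • KaehlerDifferential.D k F x⁻¹ := by
  rw [Derivation.leibniz_inv, smul_smul]
  congr 1
  field_simp

namespace IsArtinSchreier

theorem diffForm_mem_of_infinity (S : IsArtinSchreier p ρ l f x y) (P : Place k F)
    (hx : 1 < P.ring.valuation x) {μ ν : ℕ} (h2 : 1 ≤ ν)
    (h3 : ν + 1 ≤ tExp p l μ) : diffForm p ρ l x y μ ν ∈ regularDifferentialsAt P := by
  rw [diffForm, smul_D_eq_smul_D_inv S.x_ne_zero]
  have hx0 := zero_lt_one.trans hx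
  refine P.smul_D_mem ?_ ?_
  · rw [Valuation.map_neg, map_mul, map_div₀, map_mul, map_pow, map_pow, map_pow,
      P.valuation_aeval_of_one_lt hx gPoly_ne_zero, natDegree_gPoly, div_mul_eq_mul_div,
      mul_right_comm, ← pow_add, mul_div_right_comm]
    refine mul_le_one' ((div_le_one₀ (pow_pos hx0 _)).mpr (pow_le_pow_right₀ hx.le (by omega)))
      (pow_le_one₀ zero_le (S.valuation_y_of_infinity P hx))
  · rw [map_inv₀]
    exact (inv_lt_one_of_one_lt₀ hx).le

theorem diffForm_mem_of_unramified (S : IsArtinSchreier p ρ l f x y) (P : Place k F) {α : k}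
    (hα : P.ring.valuation (x - algebraMap k F α) < 1) (hne : ∀ i, α ≠ ρ i) (μ ν : ℕ) :
    diffForm p ρ l x y μ ν ∈ regularDifferentialsAt P := by
  have hx := P.valuation_le_one_of_sub hα
  refine P.smul_D_mem ?_ hx
  rw [map_div₀, P.valuation_aeval_of_centre hα (eval_gPoly_ne_zero hne _), div_one, map_mul,
    map_pow, map_pow]
  exact mul_le_one' (pow_le_one₀ zero_le hx)
    (pow_le_one₀ zero_le (S.valuation_y_of_unramified P hα hne))

/-- A regular form must be exhibited as h ds with h and s in the local ring, and x is no local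
parameter here. For s = T^A y^B, logarithmic differentiation and `smul_D_y` give T^(lᵢ+1) M y ds = s
ε dx with ε a unit. The exponent of h in the local parameter is then at least lᵢ(p-1-μ) + (p-1) - p
mᵢ, which is nonnegative because of the floor. -/
theorem diffForm_mem_of_ramified (S : IsArtinSchreier p ρ l f x y) (P : Place k F) {i : Fin r}
    (hi : P.ring.valuation (x - algebraMap k F (ρ i)) < 1) {μ ν : ℕ} (h1 : μ ≤ p - 1) :
    diffForm p ρ l x y μ ν ∈ regularDifferentialsAt P := by
  have hp := S.three_le
  have hx := P.valuation_le_one_of_sub hi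
  obtain ⟨A, B, σ, hAB, hσ, hσ0, hσ1, hT, hy⟩ := S.exists_parameter P hi
  have hg := S.valuation_gPoly P hi μ
  have hM := P.valuation_aeval_of_centre hi
    (eval_poleDenomErase_ne_zero (l := l) S.injective i)
  have hf := P.valuation_aeval_of_centre hi (S.eval_f_ne_zero i)
  have hDy := S.smul_D_y i
  have heq : P.ring.valuation ((y ^ p - y) * (x - algebraMap k F (ρ i)) ^ l i) = 1 := by
    have h4 : Polynomial.aeval x (poleDenom ρ l) = (x - algebraMap k F (ρ i)) ^ l i *
        Polynomial.aeval x (poleDenomErase ρ l i) := by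
      rw [← mul_poleDenomErase i]
      simp
    have h5 := congrArg P.ring.valuation S.equation_mul
    rwa [h4, ← mul_assoc, map_mul _ _ (Polynomial.aeval x (poleDenomErase ρ l i)), hM, hf,
      mul_one] at h5
  have hDT : KaehlerDifferential.D k F (x - algebraMap k F (ρ i)) =
      KaehlerDifferential.D k F x := by
    rw [map_sub, Derivation.map_algebraMap, sub_zero]
  have hM' := P.valuation_aeval_le_one hx (Polynomial.derivative (poleDenomErase ρ l i))
  have hf' := P.valuation_aeval_le_one hx (Polynomial.derivative f)
  set T := x - algebraMap k F (ρ i)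
  set M := Polynomial.aeval x (poleDenomErase ρ l i)
  have hl : P.ring.valuation (l i : F) = 1 := by
    rw [← map_natCast (algebraMap k F)]
    exact P.valuation_algebraMap (S.coe_l_ne_zero i)
  -- Modulo p the relation pA - lᵢB = 1 shows that B does not vanish in k. This makes B E the
  -- dominant unit term of ε.
  have hB : P.ring.valuation (B : F) = 1 := by
    rw [← map_intCast (algebraMap k F)]
    refine P.valuation_algebraMap fun h0 => ?_
    have h6 := congrArg (Int.cast : ℤ → k) hAB
    push_cast at h6
    rw [h0, CharP.cast_eq_zero] at h6
    simp at h6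
  have hA : P.ring.valuation (A : F) ≤ 1 := by
    rw [← map_intCast (algebraMap k F)]
    exact P.mem_ring_iff.mp (P.algebraMap_mem _)
  set E := (l i : F) * Polynomial.aeval x f + T * ((y ^ p - y) * T ^ l i *
    Polynomial.aeval x (Polynomial.derivative (poleDenomErase ρ l i)) -
      Polynomial.aeval x (Polynomial.derivative f))
  have hE : P.ring.valuation E = 1 := by
    have h7 : P.ring.valuation ((l i : F) * Polynomial.aeval x f) = 1 := by
      rw [map_mul, hl, hf, one_mul]
    rw [Valuation.map_add_eq_of_lt_left, h7]
    rw [h7, map_mul]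
    refine mul_lt_one_of_lt_of_le hi (Valuation.map_sub_le _ ?_ hf')
    rw [map_mul, heq, one_mul]
    exact hM'
  have hT0 : T ≠ 0 := by
    rw [← P.ring.valuation.ne_zero_iff, hT]
    exact zpow_ne_zero _ hσ0
  have hy0 : y ≠ 0 := by
    rw [← P.ring.valuation.ne_zero_iff, hy]
    exact zpow_ne_zero _ hσ0
  have hM0 : M ≠ 0 := by
    rw [← P.ring.valuation.ne_zero_iff, hM]
    exact one_ne_zero
  set ε := (A : F) * (T ^ l i * M * y) + B * E
  have hε : P.ring.valuation ε = 1 := by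
    have h7 : P.ring.valuation ((B : F) * E) = 1 := by rw [map_mul, hB, hE, one_mul]
    rw [Valuation.map_add_eq_of_lt_right, h7]
    rw [h7, map_mul]
    refine lt_of_le_of_lt (mul_le_of_le_one_left' hA) ?_
    rw [map_mul, map_mul, map_pow, hM, hT, hy, mul_one, ← zpow_natCast, ← zpow_mul,
      ← zpow_add₀ hσ0]
    have h8 : 0 < (p : ℤ) * l i + -l i := by
      have := S.l_pos i
      nlinarith
    obtain ⟨m, hm⟩ := Int.eq_ofNat_of_zero_le h8.le
    rw [hm, zpow_natCast]
    exact pow_lt_one₀ zero_le hσ1 (by omega)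
  have hε0 : ε ≠ 0 := by
    rw [← P.ring.valuation.ne_zero_iff, hε]
    exact one_ne_zero
  set s := T ^ A * y ^ B with hs
  have hs0 : s ≠ 0 := mul_ne_zero (zpow_ne_zero _ hT0) (zpow_ne_zero _ hy0)
  have hDs : (T ^ (l i + 1) * M * y) • KaehlerDifferential.D k F s =
      (s * ε) • KaehlerDifferential.D k F x := by
    rw [hs, Derivation.leibniz, Derivation.leibniz_zpow, Derivation.leibniz_zpow, hDT,
      zpow_sub_one₀ hT0, zpow_sub_one₀ hy0, ← Int.cast_smul_eq_zsmul F,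
      ← Int.cast_smul_eq_zsmul F]
    have h9 : (T ^ (l i + 1) * M * y) • (T ^ A • (B : F) • (y ^ B * y⁻¹) •
        KaehlerDifferential.D k F y) = (T ^ A * y ^ B * B) •
          ((T ^ (l i + 1) * M) • KaehlerDifferential.D k F y) := by
      rw [smul_smul, smul_smul, smul_smul, smul_smul]
      congr 1
      field_simp
    rw [smul_add, h9, hDy, smul_smul, smul_smul, smul_smul, smul_smul, ← add_smul]
    congr 1
    simp only [ε]
    field_simp
    ring
  have hform : diffForm p ρ l x y μ ν = (x ^ (ν - 1) * y ^ μ /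
      Polynomial.aeval x (gPoly p ρ l μ) * (s * ε)⁻¹ * (T ^ (l i + 1) * M * y)) •
        KaehlerDifferential.D k F s := by
    rw [mul_smul, hDs, smul_smul, diffForm, inv_mul_cancel_right₀ (mul_ne_zero hs0 hε0)]
  rw [hform]
  refine P.smul_D_mem ?_ (hσ ▸ hσ1.le)
  have h10 : P.ring.valuation (x ^ (ν - 1) * y ^ μ / Polynomial.aeval x (gPoly p ρ l μ) *
      (s * ε)⁻¹ * (T ^ (l i + 1) * M * y)) = P.ring.valuation x ^ (ν - 1) *
      σ ^ ((l i : ℤ) * (p - 1 - μ) + (p - 1) - p * mExp p l μ i) := by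
    simp only [map_mul, map_div₀, map_inv₀, map_pow]
    rw [← hσ, hε, hM, hg, hT, hy, mul_one, mul_one, mul_div_assoc, mul_assoc, mul_assoc]
    congr 1
    simp only [← zpow_natCast, ← zpow_mul]
    rw [div_eq_mul_inv, ← zpow_neg, ← zpow_neg_one, ← zpow_add₀ hσ0, ← zpow_add₀ hσ0,
      ← zpow_add₀ hσ0, ← zpow_add₀ hσ0]
    congr 1
    push_cast
    ring
  rw [h10]
  refine mul_le_one' (pow_le_one₀ zero_le hx) (zpow_le_one_of_le_one hσ1.le ?_)
  have h11 := (mul_mExp_le (l := l) (j := μ) (show 0 < p by omega) i).1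
  zify [h1, show 1 ≤ p by omega] at h11
  linarith

theorem diffForm_mem_H0 (S : IsArtinSchreier p ρ l f x y) (i : DiffIndex p l) :
    diffForm p ρ l x y i.1.1 i.1.2 ∈ H0 k F := by
  obtain ⟨⟨μ, ν⟩, h1, h2, h3, h4⟩ := i
  change μ ≤ p - 1 at h1
  change 2 ≤ tExp p l μ at h2
  change 1 ≤ ν at h3
  change ν ≤ tExp p l μ - 1 at h4
  change diffForm p ρ l x y μ ν ∈ H0 k F
  rw [H0, Submodule.mem_iInf]
  intro P
  rcases lt_or_ge 1 (P.ring.valuation x) with hx | hx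
  · exact S.diffForm_mem_of_infinity P hx h3 (by omega)
  obtain ⟨α, hα⟩ := S.exists_centre P hx
  by_cases hne : ∀ i, α ≠ ρ i
  · exact S.diffForm_mem_of_unramified P hα hne μ ν
  · push Not at hne
    obtain ⟨i, rfl⟩ := hne
    exact S.diffForm_mem_of_ramified P hα h1

end IsArtinSchreier

end Setup

theorem pow_sub_self_eq_prod {A : Type*} [CommRing A] {p : ℕ} [Fact p.Prime] (ψ : ZMod p →+* A)
    (z : A) : z ^ p - z = ∏ c : ZMod p, (z - ψ c) := by
  have hp := (Fact.out : p.Prime).one_lt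
  have hm : (Polynomial.X ^ p - Polynomial.X : (ZMod p)[X]).Monic :=
    Polynomial.monic_X_pow_sub (by
      rw [Polynomial.degree_X]
      exact_mod_cast hp)
  have hroots := FiniteField.roots_X_pow_card_sub_X (ZMod p)
  rw [ZMod.card] at hroots
  have h1 := Polynomial.prod_multiset_X_sub_C_of_monic_of_roots_card_eq hm (by
    rw [hroots, FiniteField.X_pow_card_sub_X_natDegree_eq _ hp]
    exact ZMod.card p)
  rw [hroots] at h1
  have h2 := congrArg (Polynomial.eval₂ ψ z) h1
  simp only [Polynomial.eval₂_sub, Polynomial.eval₂_X_pow, Polynomial.eval₂_X] at h2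
  rw [← h2]
  change Polynomial.eval₂ ψ z (∏ c : ZMod p, (Polynomial.X - Polynomial.C c)) = _
  rw [Polynomial.eval₂_finsetProd]
  simp

theorem orderTop_sub_coeff_zero_pos {k : Type*} [Field k] {η : LaurentSeries k}
    (h : 0 ≤ η.orderTop) : 0 < (η - algebraMap k _ (η.coeff 0)).orderTop := by
  have h1 : ((1 : ℤ) : WithTop ℤ) ≤ (η - algebraMap k _ (η.coeff 0)).orderTop := by
    rw [HahnSeries.le_orderTop_iff_forall]
    intro n hn
    have hn1 : n < 1 := by exact_mod_cast hn
    rw [algebraMap_laurentSeries, HahnSeries.coeff_sub]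
    rcases eq_or_ne n 0 with rfl | h0
    · simp
    · rw [HahnSeries.C_apply, HahnSeries.coeff_single_of_ne h0, sub_zero,
        HahnSeries.coeff_eq_zero_of_lt_orderTop]
      exact lt_of_lt_of_le (by exact_mod_cast (by omega : n < 0)) h
  exact lt_of_lt_of_le (by exact_mod_cast one_pos) h1

/-! ### Classification of the points at infinity -/

section Setup

variable {k F : Type*} [Field k] [Field F] [Algebra k F] [Algebra (RatFunc k) F]
  [IsScalarTower k (RatFunc k) F] [IsAlgClosed k]
  {p : ℕ} [Fact p.Prime] [CharP k p] {r : ℕ} {ρ : Fin r → k} {l : Fin r → ℕ} {f : k[X]} {x y : F}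
  {τ : RatFunc k →ₐ[k] LaurentSeries k} {φ : ZMod p → F →ₐ[k] LaurentSeries k}
  {η : LaurentSeries k}

theorem InfinityFamily.order_apply (h : InfinityFamily x y τ φ η) {b : RatFunc k} (hb : b ≠ 0) :
    (τ b).order = b.denom.natDegree - b.num.natDegree := by
  have hord : (τ RatFunc.X).order = -1 := by
    rw [h.apply_X, HahnSeries.order_single one_ne_zero]
  obtain ⟨h2, h3⟩ := order_aeval_of_order_eq_neg_one hord (RatFunc.num_ne_zero hb)
  obtain ⟨h4, h5⟩ := order_aeval_of_order_eq_neg_one hord (RatFunc.denom_ne_zero b)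
  rw [algHom_ratFunc_apply, order_div h2 h4, h3, h5]
  ring

/-- The value of `y` at the points at infinity. -/
def valueAtInfinity (p : ℕ) [Fact p.Prime] [CharP k p] (η : LaurentSeries k) (c : ZMod p) : k :=
  η.coeff 0 + ZMod.castHom (dvd_refl p) k c

theorem InfinityFamily.apply_sub_pos (h : InfinityFamily x y τ φ η) (c : ZMod p) :
    0 < (φ c (y - algebraMap k F (valueAtInfinity p η c))).orderTop := by
  have h1 : φ c (y - algebraMap k F (valueAtInfinity p η c)) =
      η - algebraMap k _ (η.coeff 0) := by
    rw [map_sub, h.apply_y, AlgHom.commutes, valueAtInfinity, map_add]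
    exact add_sub_add_right_eq_sub _ _ _
  rw [h1]
  exact orderTop_sub_coeff_zero_pos h.nonneg

theorem valueAtInfinity_injective (η : LaurentSeries k) :
    Function.Injective (valueAtInfinity p η) := fun _ _ hab =>
  (ZMod.castHom (dvd_refl p) k).injective (add_left_cancel hab)

namespace IsArtinSchreier

/-- At any pole of x the valuation on k(x) depends only on the degree; this compares an arbitrary
point with the embedding τ. -/
theorem valuation_algebraMap_of_infinity (S : IsArtinSchreier p ρ l f x y)
    (h : InfinityFamily x y τ φ η) (P : Place k F) (hx : 1 < P.ring.valuation x)
    {b : RatFunc k} (hb : b ≠ 0) :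
    P.ring.valuation (algebraMap (RatFunc k) F b) = (P.ring.valuation x)⁻¹ ^ (τ b).order := by
  rw [S.algebraMap_eq, map_div₀, P.valuation_aeval_of_one_lt hx (RatFunc.num_ne_zero hb),
    P.valuation_aeval_of_one_lt hx (RatFunc.denom_ne_zero b), h.order_apply hb, inv_zpow',
    neg_sub, zpow_sub₀ (zero_lt_one.trans hx).ne', zpow_natCast, zpow_natCast]

theorem valuation_algebraMap_le_one (S : IsArtinSchreier p ρ l f x y)
    (h : InfinityFamily x y τ φ η) (P : Place k F) (hx : 1 < P.ring.valuation x)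
    {b : RatFunc k} (hb : 0 ≤ (τ b).orderTop) :
    P.ring.valuation (algebraMap (RatFunc k) F b) ≤ 1 := by
  rcases eq_or_ne b 0 with rfl | hb0
  · simp
  rw [S.valuation_algebraMap_of_infinity h P hx hb0]
  exact zpow_le_one_of_le_one (inv_lt_one_of_one_lt₀ hx).le (HahnSeries.zero_le_orderTop_iff.mp hb)

theorem valuation_algebraMap_lt_one (S : IsArtinSchreier p ρ l f x y)
    (h : InfinityFamily x y τ φ η) (P : Place k F) (hx : 1 < P.ring.valuation x)
    {b : RatFunc k} (hb : 0 < (τ b).orderTop) :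
    P.ring.valuation (algebraMap (RatFunc k) F b) < 1 := by
  rcases eq_or_ne b 0 with rfl | hb0
  · simp
  rw [S.valuation_algebraMap_of_infinity h P hx hb0]
  rw [HahnSeries.zero_lt_orderTop_iff (by simpa using hb0)] at hb
  obtain ⟨m, hm⟩ := Int.eq_ofNat_of_zero_le hb.le
  rw [hm, zpow_natCast]
  exact pow_lt_one₀ zero_le (inv_lt_one_of_one_lt₀ hx) (by omega)

/-- With γ the constant term of η, the function y^p - y - (γ^p - γ) lies in k(x) and vanishes at
infinity. It factors as the product of the y - γ - c over the prime field, so one factor is not a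
unit. -/
theorem exists_valuation_sub_lt_one (S : IsArtinSchreier p ρ l f x y)
    (h : InfinityFamily x y τ φ η) (P : Place k F) (hx : 1 < P.ring.valuation x) :
    ∃ c, P.ring.valuation (y - algebraMap k F (valueAtInfinity p η c)) < 1 := by
  have : CharP F p := charP_of_injective_algebraMap (algebraMap k F).injective p
  have := charP_of_injective_algebraMap (algebraMap k (LaurentSeries k)).injective p
  set γ := η.coeff 0 with hγ
  set b := rhs f ρ l - algebraMap k _ (γ ^ p - γ) with hb
  have hη : η ^ p - η = τ (rhs f ρ l) := by
    have h1 := congrArg (φ 0) S.equation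
    rwa [map_sub, map_pow, h.apply_y, h.apply_algebraMap, map_zero, add_zero] at h1
  have hτb : 0 < (τ b).orderTop := by
    have h1 : τ b = (η - algebraMap k _ γ) ^ p - (η - algebraMap k _ γ) := by
      rw [hb, map_sub, ← hη, AlgHom.commutes, sub_pow_char, map_sub, map_pow]
      ring
    have h2 := orderTop_sub_coeff_zero_pos h.nonneg
    rw [← hγ] at h2
    rw [h1]
    refine lt_of_lt_of_le (lt_min ?_ h2) HahnSeries.min_orderTop_le_orderTop_sub
    obtain ⟨n, hn⟩ := Nat.exists_eq_succ_of_ne_zero (Fact.out : p.Prime).ne_zero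
    rw [hn, pow_succ', HahnSeries.orderTop_mul]
    refine add_pos_of_pos_of_nonneg h2 ?_
    exact pow_mem (mem_integralSeries.mpr h2.le) n
  have h1 := S.valuation_algebraMap_lt_one h P hx hτb
  have h2 : algebraMap (RatFunc k) F b =
      (y - algebraMap k F γ) ^ p - (y - algebraMap k F γ) := by
    rw [hb, map_sub, ← S.equation, ← IsScalarTower.algebraMap_apply, sub_pow_char, map_sub,
      map_pow]
    ring
  rw [h2, pow_sub_self_eq_prod ((algebraMap k F).comp (ZMod.castHom (dvd_refl p) k)),
    map_prod] at h1
  by_contra! h3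
  refine absurd h1 (not_lt.mpr (Finset.one_le_prod' fun c _ => ?_))
  have h4 := h3 c
  rw [valueAtInfinity, map_add, ← sub_sub] at h4
  exact h4

theorem infinityPlace_mem (S : IsArtinSchreier p ρ l f x y) (h : InfinityFamily x y τ φ η)
    (c : ZMod p) : S.infinityPlace h c ∈ fibreInfty k x :=
  (S.mem_nonunits_infinityPlace h).mpr (S.orderTop_inv_x_pos h c)

theorem valuation_infinityPlace_sub (S : IsArtinSchreier p ρ l f x y)
    (h : InfinityFamily x y τ φ η) (c : ZMod p) :
    (S.infinityPlace h c).ring.valuation (y - algebraMap k F (valueAtInfinity p η c)) < 1 :=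
  (S.mem_nonunits_infinityPlace h).mpr (h.apply_sub_pos c)

theorem infinityPlace_injective (S : IsArtinSchreier p ρ l f x y)
    (h : InfinityFamily x y τ φ η) : Function.Injective (S.infinityPlace h) := by
  intro c d hcd
  by_contra hne
  have h1 := S.valuation_infinityPlace_sub h d
  rw [← hcd, Place.valuation_sub_eq_one _ (S.valuation_infinityPlace_sub h c)
    fun h2 => hne (valueAtInfinity_injective η h2).symm] at h1
  exact lt_irrefl _ h1

/-- A function vanishing at all points at infinity but one. -/
def separator (y : F) (η : LaurentSeries k) (c : ZMod p) : F :=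
  ∏ d ∈ Finset.univ.erase c, (y - algebraMap k F (valueAtInfinity p η d))

theorem valuation_separator (P : Place k F) {c : ZMod p}
    (hc : P.ring.valuation (y - algebraMap k F (valueAtInfinity p η c)) < 1) :
    P.ring.valuation (separator y η c) = 1 := by
  rw [separator, map_prod]
  refine Finset.prod_eq_one fun d hd => ?_
  exact P.valuation_sub_eq_one hc fun h2 =>
    Finset.ne_of_mem_erase hd (valueAtInfinity_injective η h2)

theorem apply_sub_nonneg (h : InfinityFamily x y τ φ η) (c : ZMod p) (α : k) :
    φ c (y - algebraMap k F α) ∈ integralSeries k := by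
  rw [map_sub, h.apply_y, AlgHom.commutes]
  exact sub_mem (add_mem (mem_integralSeries.mpr h.nonneg)
    (mem_integralSeries.mpr (primeConst_nonneg p c))) (algebraMap_mem_integralSeries _)

theorem apply_separator_nonneg (h : InfinityFamily x y τ φ η) (c d : ZMod p) :
    φ d (separator y η c) ∈ integralSeries k := by
  rw [separator, map_prod]
  exact prod_mem fun _ _ => apply_sub_nonneg h d _

theorem apply_separator_pos (h : InfinityFamily x y τ φ η) {c d : ZMod p} (hcd : d ≠ c) :
    1 ≤ (φ d (separator y η c)).orderTop := by
  have h1 : 0 < (φ d (separator y η c)).orderTop := by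
    rw [separator, ← Finset.mul_prod_erase _ _ (Finset.mem_erase.mpr ⟨hcd, Finset.mem_univ d⟩),
      map_mul, HahnSeries.orderTop_mul]
    refine add_pos_of_pos_of_nonneg (h.apply_sub_pos d) ?_
    rw [map_prod]
    exact mem_integralSeries.mp (prod_mem fun _ _ => apply_sub_nonneg h d _)
  rcases eq_or_ne (φ d (separator y η c)) 0 with h0 | h0
  · rw [h0, HahnSeries.orderTop_zero]
    exact le_top
  · rw [HahnSeries.zero_lt_orderTop_iff h0] at h1
    exact (le_orderTop_iff_order h0 (n := 1)).mpr h1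

theorem exists_pow_separator_mul (h : InfinityFamily x y τ φ η) {c : ZMod p} {w : F}
    (hw : 0 ≤ (φ c w).orderTop) :
    ∃ N : ℕ, ∀ d, 0 ≤ (φ d (w * separator y η c ^ N)).orderTop := by
  -- The sum of all pole orders of w is at least each of them, and the separator vanishes at every
  -- point other than c.
  refine ⟨∑ d : ZMod p, (-(φ d w).order).toNat, fun d => ?_⟩
  set N := ∑ d : ZMod p, (-(φ d w).order).toNat with hN
  rw [map_mul, map_pow]
  rcases eq_or_ne d c with rfl | hd
  · exact mul_mem (mem_integralSeries.mpr hw) (pow_mem (apply_separator_nonneg h d d) N)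
  rcases eq_or_ne (φ d w) 0 with h0 | h0
  · rw [h0, zero_mul, HahnSeries.orderTop_zero]
    exact le_top
  have h1 := apply_separator_pos h hd
  rcases eq_or_ne (φ d (separator y η c) ^ N) 0 with h2 | h2
  · rw [h2, mul_zero, HahnSeries.orderTop_zero]
    exact le_top
  rw [HahnSeries.zero_le_orderTop_iff, HahnSeries.order_mul h0 h2, HahnSeries.order_pow,
    nsmul_eq_mul]
  have h3 : (-(φ d w).order).toNat ≤ N :=
    Finset.single_le_sum (f := fun d : ZMod p => (-(φ d w).order).toNat)
      (fun _ _ => Nat.zero_le _) (Finset.mem_univ d)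
  rcases eq_or_ne N 0 with h4 | h4
  · rw [h4]
    simp only [Nat.cast_zero, zero_mul, add_zero]
    omega
  have h5 : 1 ≤ (φ d (separator y η c)).order :=
    (le_orderTop_iff_order (pow_ne_zero_iff h4 |>.mp h2) (n := 1)).mp h1
  nlinarith [Int.self_le_toNat (-(φ d w).order)]

/-- A power of the separator makes w integral at all p points, so by interpolation its coefficients
are integral at infinity and the product lies in the ring of P. The separator is a unit at P, hence
w lies there too. -/
theorem infinityPlace_le (S : IsArtinSchreier p ρ l f x y) (h : InfinityFamily x y τ φ η)
    (P : Place k F) (hx : 1 < P.ring.valuation x) {c : ZMod p}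
    (hc : P.ring.valuation (y - algebraMap k F (valueAtInfinity p η c)) < 1) :
    (S.infinityPlace h c).ring ≤ P.ring := by
  intro w hw
  obtain ⟨N, hN⟩ := exists_pow_separator_mul h ((S.mem_infinityPlace h).mp hw)
  obtain ⟨a, ha⟩ := S.exists_sum_eq (w * separator y η c ^ N)
  have h1 : P.ring.valuation (w * separator y η c ^ N) ≤ 1 := by
    rw [← P.mem_ring_iff, ha]
    refine sum_mem fun j hj => mul_mem ?_ (pow_mem (P.mem_ring_iff.mpr
      (S.valuation_y_of_infinity P hx)) j)
    rw [ha] at hN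
    exact P.mem_ring_iff.mpr (S.valuation_algebraMap_le_one h P hx
      (h.le_orderTop (N := 0) hN (Finset.mem_range.mp hj)))
  rwa [map_mul, map_pow, valuation_separator P hc, one_pow, mul_one, ← P.mem_ring_iff] at h1

theorem fibreInfty_eq (S : IsArtinSchreier p ρ l f x y) (h : InfinityFamily x y τ φ η) :
    fibreInfty k x = Set.range (S.infinityPlace h) := by
  refine Set.Subset.antisymm (fun P hP => ?_) ?_
  · have hx := P.one_lt_of_mem_fibreInfty S.x_ne_zero hP
    obtain ⟨c, hc⟩ := S.exists_valuation_sub_lt_one h P hx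
    have hle := S.infinityPlace_le h P hx hc
    refine ⟨c, Place.ext_ring (le_antisymm hle fun w hw => ?_)⟩
    by_contra hw'
    rw [S.mem_infinityPlace h, HahnSeries.zero_le_orderTop_iff] at hw'
    have hw0 : φ c w ≠ 0 := by
      intro h0
      simp [h0] at hw'
    have hφx : φ c x = HahnSeries.single (-1) 1 := by
      rw [S.apply_x (h.apply_algebraMap c), h.apply_X]
    -- If w has a pole at the embedded place, then x/w is regular there since x has a simple pole.
    -- The inclusion of rings then puts x = (x/w) w in the ring of P, although x has a pole at P.
    have h1 : x * w⁻¹ ∈ (S.infinityPlace h c).ring := by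
      rw [S.mem_infinityPlace h, HahnSeries.zero_le_orderTop_iff, map_mul, map_inv₀, hφx,
        HahnSeries.order_mul (by simp) (inv_ne_zero hw0), order_inv,
        HahnSeries.order_single one_ne_zero]
      omega
    have h2 := mul_mem (hle h1) hw
    rw [inv_mul_cancel_right₀ (by rintro rfl; simp at hw0), P.mem_ring_iff] at h2
    exact absurd h2 (not_le.mpr hx)
  · rintro _ ⟨c, rfl⟩
    exact S.infinityPlace_mem h c

theorem residueSumInfty_eq (S : IsArtinSchreier p ρ l f x y) (h : InfinityFamily x y τ φ η)
    (ω : Ω[F⁄k]) : residueSumInfty x ω = ∑ c, (pullback (φ c) ω).coeff 0 := by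
  rw [residueSumInfty, S.fibreInfty_eq h, finsum_mem_range (S.infinityPlace_injective h),
    finsum_eq_sum_of_fintype]
  refine Finset.sum_congr rfl fun c _ => ?_
  obtain ⟨u, rfl⟩ := S.exists_smul_D ω
  rw [smul_D_eq_smul_D_inv S.x_ne_zero]
  exact residue_placeOf (S.apply_inv_x h c) rfl

end IsArtinSchreier

end Setup

/-- In the binomial expansion the power sums of the prime field with exponent below p-1 vanish, so
only the top term with j = p-1 can survive. -/
theorem sum_add_pow_of_lt {A : Type*} [CommRing A] {p : ℕ} [Fact p.Prime]
    (ψ : ZMod p →+* A) (η : A) {j : ℕ} (hj : j ≤ p - 1) :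
    ∑ c : ZMod p, (η + ψ c) ^ j = if j = p - 1 then -1 else 0 := by
  have hp := (Fact.out : p.Prime).one_lt
  have hsum : ∀ m < p - 1, ∑ c : ZMod p, c ^ m = 0 := fun m hm =>
    FiniteField.sum_pow_lt_card_sub_one (ZMod p) m (by rwa [ZMod.card])
  have hsum' : ∑ c : ZMod p, c ^ (p - 1) = -1 := by
    have h1 : ∀ c : ZMod p, c ^ (p - 1) = 1 - if c = 0 then 1 else 0 := fun c => by
      split_ifs with h
      · rw [h, zero_pow (by omega), sub_self]
      · rw [ZMod.pow_card_sub_one_eq_one h, sub_zero]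
    rw [Finset.sum_congr rfl fun c _ => h1 c, Finset.sum_sub_distrib, Finset.sum_ite_eq']
    simp
  simp only [add_pow]
  rw [Finset.sum_comm]
  have hterm : ∀ m ∈ Finset.range (j + 1), ∑ c : ZMod p, η ^ m * ψ c ^ (j - m) * (j.choose m : A) =
      η ^ m * (j.choose m : A) * ψ (∑ c : ZMod p, c ^ (j - m)) := fun m _ => by
    rw [map_sum, Finset.mul_sum]
    refine Finset.sum_congr rfl fun c _ => ?_
    rw [map_pow]
    ring
  rw [Finset.sum_congr rfl hterm, Finset.sum_range_succ']
  rw [Finset.sum_eq_zero, zero_add, Nat.sub_zero]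
  · split_ifs with h
    · rw [h, hsum']
      simp
    · rw [hsum j (by omega)]
      simp
  · intro m hm
    rw [Finset.mem_range] at hm
    rw [hsum _ (by omega), map_zero, mul_zero]

/-- For j = p + i, the identity (η + c)^p = (η + c) + (η^p - η) reduces to exponents i + 1 and i.
Both are below p-1 because j ≤ 2p-3. -/
theorem sum_add_pow {A : Type*} [CommRing A] {p : ℕ} [Fact p.Prime] [CharP A p]
    (ψ : ZMod p →+* A) (η : A) {j : ℕ} (hj : j ≤ 2 * p - 3) :
    ∑ c : ZMod p, (η + ψ c) ^ j = if j = p - 1 then -1 else 0 := by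
  have hp := (Fact.out : p.Prime).two_le
  by_cases hjp : j ≤ p - 1
  · exact sum_add_pow_of_lt ψ η hjp
  rw [if_neg (by omega)]
  obtain ⟨i, rfl⟩ : ∃ i, j = p + i := ⟨j - p, by omega⟩
  have hterm : ∀ c : ZMod p, (η + ψ c) ^ (p + i) =
      (η + ψ c) ^ (i + 1) + (η ^ p - η) * (η + ψ c) ^ i := fun c => by
    rw [pow_add _ p, add_pow_char, ← map_pow, ZMod.pow_card, pow_succ]
    ring
  rw [Finset.sum_congr rfl fun c _ => hterm c, Finset.sum_add_distrib, ← Finset.mul_sum,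
    sum_add_pow_of_lt ψ η (by omega), sum_add_pow_of_lt ψ η (by omega), if_neg (by omega),
    if_neg (by omega), mul_zero, add_zero]

/-! ### The residue pairing and the dual bases -/

section Setup

variable {k F : Type*} [Field k] [Field F] [Algebra k F] [Algebra (RatFunc k) F]
  [IsScalarTower k (RatFunc k) F] [IsAlgClosed k]
  {p : ℕ} [Fact p.Prime] [CharP k p] {r : ℕ} {ρ : Fin r → k} {l : Fin r → ℕ} {f : k[X]} {x y : F}
  {τ : RatFunc k →ₐ[k] LaurentSeries k} {φ : ZMod p → F →ₐ[k] LaurentSeries k}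
  {η : LaurentSeries k}

/-- The pairing `(h, ω) ↦ ∑ Res (h ω)`, the sum of the residues given by a family of embeddings
in the Laurent series. -/
def residuePairing (φ : ZMod p → F →ₐ[k] LaurentSeries k) : F →ₗ[k] Ω[F⁄k] →ₗ[k] k :=
  LinearMap.mk₂ k (fun h ω => ∑ c, (pullback (φ c) (h • ω)).coeff 0)
    (fun a b ω => by simp [add_smul, Finset.sum_add_distrib])
    (fun t a ω => by simp [Finset.mul_sum])
    (fun a ω ω' => by simp [Finset.sum_add_distrib])
    (fun t a ω => by
      simp only [smul_comm a t, map_smul, HahnSeries.coeff_smul, Finset.smul_sum])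

theorem residuePairing_apply (h : F) (ω : Ω[F⁄k]) :
    residuePairing φ h ω = ∑ c, (pullback (φ c) (h • ω)).coeff 0 := rfl

/-- This excludes μ = p-1 from the indices of the differentials, which keeps j + μ within the range
2p-3 of `sum_add_pow`. -/
theorem tExp_pred (hp : 0 < p) : tExp p l (p - 1) = 0 := by
  refine Finset.sum_eq_zero fun i _ => ?_
  rw [mExp, Nat.sub_self, zero_mul, zero_add, Nat.div_eq_of_lt (by omega)]

theorem cocycle_eq_monomialFun {μ ν : ℕ} (hμ : 1 ≤ μ) :
    cocycle p ρ l x y μ ν = monomialFun p ρ l x y (μ - 1) (-(ν : ℤ)) := by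
  rw [cocycle, monomialFun, show p - 1 - (μ - 1) = p - μ by omega, zpow_neg, zpow_natCast]
  ring

namespace IsArtinSchreier

/-- The embeddings agree on k(x), so the sum over the points factors through the power sum of the η
+ c. When j + μ = p-1 the factors g_{p-1-j} and g_μ coincide and cancel, and only the monomial of
exponent n + ν in x remains. The sign from dx = -x² d(1/x) cancels the -1 of the power sum. -/
theorem residuePairing_monomialFun (S : IsArtinSchreier p ρ l f x y)
    (h : InfinityFamily x y τ φ η) {j : ℕ} (hj : j < p) (n : ℤ) {μ ν : ℕ} (hμ : μ + 2 ≤ p)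
    (hν : 1 ≤ ν) :
    residuePairing φ (monomialFun p ρ l x y j n) (diffForm p ρ l x y μ ν) =
      if j + μ = p - 1 ∧ n + ν = 0 then 1 else 0 := by
  have := charP_of_injective_algebraMap (algebraMap k (LaurentSeries k)).injective p
  have hφx : ∀ c, φ c x = HahnSeries.single (-1) 1 := fun c => by
    rw [S.apply_x (h.apply_algebraMap c), h.apply_X]
  have hg : ∀ c (P : k[X]), φ c (Polynomial.aeval x P) =
      Polynomial.aeval (HahnSeries.single (-1 : ℤ) (1 : k)) P := fun c P => by
    rw [← Polynomial.aeval_algHom_apply, hφx]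
  set s : LaurentSeries k := HahnSeries.single (-1 : ℤ) (1 : k) with hs
  have hs0 : s ≠ 0 := by simp [hs]
  set G : ℕ → LaurentSeries k := fun μ => Polynomial.aeval s (gPoly p ρ l μ) with hG
  have hG0 : ∀ μ, G μ ≠ 0 := fun μ => by
    rw [hG]
    exact (order_aeval_of_order_eq_neg_one (HahnSeries.order_single one_ne_zero) gPoly_ne_zero).1
  have hterm : ∀ c, pullback (φ c) (monomialFun p ρ l x y j n • diffForm p ρ l x y μ ν) =
      -(s ^ (n + ν) * (G (p - 1 - j) / G μ)) * (η + primeConst p c) ^ (j + μ) := fun c => by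
    rw [pullback_smul, diffForm, pullback_smul, S.pullback_D_x h, monomialFun]
    simp only [map_mul, map_div₀, map_pow, map_zpow₀, hφx, hg, h.apply_y]
    change _ = -(s ^ (n + ν) * (Polynomial.aeval s (gPoly p ρ l (p - 1 - j)) /
      Polynomial.aeval s (gPoly p ρ l μ))) * _
    obtain ⟨m, rfl⟩ : ∃ m, ν = m + 1 := ⟨ν - 1, by omega⟩
    rw [Nat.add_sub_cancel, zpow_add₀ hs0, zpow_natCast, pow_succ, pow_add]
    ring
  rw [residuePairing_apply, ← HahnSeries.coeff_sum, Finset.sum_congr rfl fun c _ => hterm c,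
    ← Finset.mul_sum, sum_add_pow _ _ (by omega)]
  by_cases h1 : j + μ = p - 1
  · rw [if_pos h1, show p - 1 - j = μ by omega, div_self (hG0 μ), mul_one, neg_mul_neg, mul_one,
      hs, RatFunc.single_zpow (-1), ← zpow_mul, ← RatFunc.single_zpow, HahnSeries.coeff_single]
    split_ifs <;> first | rfl | omega
  · rw [if_neg h1, mul_zero, if_neg fun h2 => h1 h2.1]
    rfl

theorem H0_le_span (S : IsArtinSchreier p ρ l f x y) : H0 k F ≤ Submodule.span k
    (Set.range fun i : DiffIndex p l => diffForm p ρ l x y i.1.1 i.1.2) := by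
  intro ω hω
  obtain ⟨u, rfl⟩ := S.exists_smul_D ω
  exact S.mem_span_diffForm hω

/-- A function regular at infinity times a regular form has no residues there. For a function
regular where x is finite, expansion in the spanning sets leaves only pairs with n ≥ 0 and ν ≥ 1, so
n + ν is never 0; this replaces the residue theorem. -/
theorem residuePairing_coboundaries (S : IsArtinSchreier p ρ l f x y)
    (h : InfinityFamily x y τ φ η) {w : F} (hw : w ∈ coboundaries k x) {ω : Ω[F⁄k]}
    (hω : ω ∈ H0 k F) : residuePairing φ w ω = 0 := by
  have hp := S.three_le
  suffices coboundaries k x ≤ LinearMap.ker ((residuePairing φ).flip ω) from this hw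
  refine sup_le (fun w hw => ?_) (fun w hw => ?_)
  · rw [LinearMap.mem_ker, LinearMap.flip_apply, residuePairing_apply]
    refine Finset.sum_eq_zero fun c _ => coeff_eq_zero_of_one_le ?_
    have h1 : S.infinityPlace h c ∈ (fibreZero k x)ᶜ := fun h2 => by
      have h3 := (S.infinityPlace h c).one_lt_of_mem_fibreInfty S.x_ne_zero
        (S.infinityPlace_mem h c)
      exact lt_asymm h3 ((S.infinityPlace h c).mem_nonunits_iff.mp h2)
    have h2 := one_le_orderTop_pullback (φ := φ c)
      (fun w hw => (S.mem_infinityPlace h).mp hw)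
      ((Submodule.mem_iInf _).mp hω (S.infinityPlace h c))
    rw [pullback_smul, HahnSeries.orderTop_mul]
    simpa using add_le_add ((S.mem_infinityPlace h).mp (hw _ h1)) h2
  · suffices Submodule.span k {w | ∃ j < p, ∃ n ∈ Set.Ici (0 : ℤ),
        w = monomialFun p ρ l x y j n} ≤ LinearMap.ker ((residuePairing φ).flip ω) from
      this (S.mem_span_of_regular hw)
    rw [Submodule.span_le]
    rintro _ ⟨j, hj, n, hn, rfl⟩
    suffices Submodule.span k (Set.range fun i : DiffIndex p l =>
        diffForm p ρ l x y i.1.1 i.1.2) ≤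
          LinearMap.ker (residuePairing φ (monomialFun p ρ l x y j n)) from
      this (S.H0_le_span hω)
    rw [Submodule.span_le]
    rintro _ ⟨⟨⟨μ, ν⟩, h1, h2, h3, h4⟩, rfl⟩
    change 2 ≤ tExp p l μ at h2
    have hμ : μ ≠ p - 1 := fun h5 => by
      rw [h5, tExp_pred (by omega)] at h2
      omega
    change μ ≤ p - 1 at h1
    change 1 ≤ ν at h3
    change residuePairing φ _ (diffForm p ρ l x y μ ν) = 0
    rw [S.residuePairing_monomialFun h hj n (by omega) h3, if_neg]
    rintro ⟨-, h6⟩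
    rw [Set.mem_Ici] at hn
    omega

theorem cocycle_mem_cocycles (S : IsArtinSchreier p ρ l f x y) (j : ClassIndex p l) :
    cocycle p ρ l x y j.1.1 j.1.2 ∈ cocycles k x := by
  obtain ⟨⟨μ, ν⟩, h1, h2, -⟩ := j
  change 1 ≤ μ at h1
  change μ ≤ p at h2
  change cocycle p ρ l x y μ ν ∈ cocycles k x
  rw [cocycle_eq_monomialFun h1]
  exact S.monomialFun_mem_cocycles (by omega) _

theorem residuePairing_cocycle (S : IsArtinSchreier p ρ l f x y)
    (h : InfinityFamily x y τ φ η) (i : DiffIndex p l) (j : ClassIndex p l) :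
    residuePairing φ (cocycle p ρ l x y j.1.1 j.1.2) (diffForm p ρ l x y i.1.1 i.1.2) =
      if i.1.1 = p - j.1.1 ∧ i.1.2 = j.1.2 then 1 else 0 := by
  have hp := S.three_le
  have hi : i.1.1 ≠ p - 1 := fun h5 => by
    have h2 := i.2.2.1
    rw [h5, tExp_pred (by omega)] at h2
    omega
  have hi1 := i.2.1
  have hj1 := j.2.1
  have hj2 := j.2.2.1
  rw [cocycle_eq_monomialFun hj1, S.residuePairing_monomialFun h (by omega) _ (by omega)
    i.2.2.2.1]
  exact if_congr (by omega) rfl rfl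

/-- The pairing of `H⁰(X, Ω_X)` and `H¹(X, O_X)` by the sum of the residues at infinity. -/
def cohomologyPairing (S : IsArtinSchreier p ρ l f x y) (h : InfinityFamily x y τ φ η) :
    H0 k F →ₗ[k] H1 k x →ₗ[k] k :=
  (Submodule.liftQ _ ((residuePairing φ).domRestrict₁₂ (cocycles k x) (H0 k F)) (by
    intro w hw
    ext ω
    exact S.residuePairing_coboundaries h hw ω.2)).flip

theorem cohomologyPairing_mk (S : IsArtinSchreier p ρ l f x y) (h : InfinityFamily x y τ φ η)
    (ω : H0 k F) (w : cocycles k x) : S.cohomologyPairing h ω (Submodule.Quotient.mk w) =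
      residuePairing φ (w : F) (ω : Ω[F⁄k]) := rfl

/-- The class `h_{μ,ν}`. -/
def cohomologyClass (S : IsArtinSchreier p ρ l f x y) (j : ClassIndex p l) : H1 k x :=
  Submodule.Quotient.mk ⟨cocycle p ρ l x y j.1.1 j.1.2, S.cocycle_mem_cocycles j⟩

/-- The differential `ω_{μ,ν}` as an element of `H⁰(X, Ω_X)`. -/
def regularForm (S : IsArtinSchreier p ρ l f x y) (i : DiffIndex p l) : H0 k F :=
  ⟨diffForm p ρ l x y i.1.1 i.1.2, S.diffForm_mem_H0 i⟩

theorem cohomologyPairing_dual (S : IsArtinSchreier p ρ l f x y)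
    (h : InfinityFamily x y τ φ η) (i : DiffIndex p l) (j : ClassIndex p l) :
    S.cohomologyPairing h (S.regularForm i) (S.cohomologyClass j) =
      if i.1.1 = p - j.1.1 ∧ i.1.2 = j.1.2 then 1 else 0 :=
  S.residuePairing_cocycle h i j

/-- The classes with matching indices (p - μ, ν) provide a dual family of functionals. -/
theorem linearIndependent_regularForm (S : IsArtinSchreier p ρ l f x y) :
    LinearIndependent k S.regularForm := by
  obtain ⟨τ, φ, η, h⟩ := S.exists_infinityFamily
  have hp := S.three_le
  have he : ∀ i : DiffIndex p l, ∃ j : ClassIndex p l, j.1 = (p - i.1.1, i.1.2) := fun i => by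
    have h1 : p - (p - i.1.1) = i.1.1 := by have := i.2.1; omega
    refine ⟨⟨(p - i.1.1, i.1.2), ?_, ?_, ?_, i.2.2.2.1, ?_⟩, rfl⟩
    · have := i.2.1
      dsimp only
      omega
    · dsimp only
      omega
    · rw [h1]
      exact i.2.2.1
    · rw [h1]
      exact i.2.2.2.2
  choose e he using he
  refine LinearIndependent.of_pairwise_dual_eq_zero_one _
    (fun i => (S.cohomologyPairing h).flip (S.cohomologyClass (e i))) (fun i j hij => ?_)
    (fun i => ?_)
  · dsimp only
    rw [LinearMap.flip_apply, S.cohomologyPairing_dual, he, if_neg]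
    rintro ⟨h1, h2⟩
    have h3 := i.2.1
    refine hij (Subtype.ext (Prod.ext ?_ h2.symm))
    dsimp only at h1
    omega
  · rw [LinearMap.flip_apply, S.cohomologyPairing_dual, he, if_pos]
    have h3 := i.2.1
    dsimp only
    omega

theorem linearIndependent_cohomologyClass (S : IsArtinSchreier p ρ l f x y) :
    LinearIndependent k S.cohomologyClass := by
  obtain ⟨τ, φ, η, h⟩ := S.exists_infinityFamily
  have hp := S.three_le
  have he : ∀ j : ClassIndex p l, ∃ i : DiffIndex p l, i.1 = (p - j.1.1, j.1.2) := fun j => by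
    refine ⟨⟨(p - j.1.1, j.1.2), ?_, j.2.2.2.1, j.2.2.2.2⟩, rfl⟩
    have := j.2.1
    dsimp only
    omega
  choose e he using he
  refine LinearIndependent.of_pairwise_dual_eq_zero_one _
    (fun j => S.cohomologyPairing h (S.regularForm (e j))) (fun i j hij => ?_) (fun j => ?_)
  · dsimp only
    rw [S.cohomologyPairing_dual, he, if_neg]
    rintro ⟨h1, h2⟩
    have h3 := i.2.2.1
    have h4 := j.2.2.1
    refine hij (Subtype.ext (Prod.ext ?_ h2))
    dsimp only at h1
    omega
  · rw [S.cohomologyPairing_dual, he, if_pos ⟨rfl, rfl⟩]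

theorem span_regularForm (S : IsArtinSchreier p ρ l f x y) :
    ⊤ ≤ Submodule.span k (Set.range S.regularForm) := by
  intro ω _
  have h1 : (ω : Ω[F⁄k]) ∈ (Submodule.span k (Set.range S.regularForm)).map (H0 k F).subtype := by
    rw [Submodule.map_span, ← Set.range_comp]
    exact S.H0_le_span ω.2
  obtain ⟨ω', h2, h3⟩ := h1
  exact Subtype.ext h3 ▸ h2

/-- Exponents n ≥ 0 and n ≤ -t give coboundaries, from the two open sets respectively. The gap -t <
n < 0 is exactly the index range of the classes. -/
theorem mk_monomialFun_mem_span (S : IsArtinSchreier p ρ l f x y) {j : ℕ} (hj : j < p) (n : ℤ) :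
    (Submodule.Quotient.mk ⟨monomialFun p ρ l x y j n, S.monomialFun_mem_cocycles hj n⟩ :
      H1 k x) ∈ Submodule.span k (Set.range S.cohomologyClass) := by
  have hzero : monomialFun p ρ l x y j n ∈ coboundaries k x →
      (Submodule.Quotient.mk ⟨monomialFun p ρ l x y j n, S.monomialFun_mem_cocycles hj n⟩ :
        H1 k x) ∈ Submodule.span k (Set.range S.cohomologyClass) := fun h1 => by
    have h2 := (Submodule.Quotient.mk_eq_zero ((coboundaries k x).submoduleOf (cocycles k x))
      (x := ⟨monomialFun p ρ l x y j n, S.monomialFun_mem_cocycles hj n⟩)).mpr h1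
    rw [h2]
    exact zero_mem _
  by_cases h0 : 0 ≤ n
  · exact hzero (Submodule.mem_sup_right (S.monomialFun_mem_regular_infty hj h0))
  by_cases h1 : n ≤ -(tExp p l (p - 1 - j) : ℤ)
  · exact hzero (Submodule.mem_sup_left (S.monomialFun_mem_regular_zero hj h1))
  obtain ⟨ν, rfl⟩ : ∃ ν : ℕ, n = -(ν : ℤ) := ⟨(-n).toNat, by omega⟩
  have h2 : p - (j + 1) = p - 1 - j := by omega
  refine Submodule.subset_span ⟨⟨(j + 1, ν), ?_, ?_, ?_, ?_, ?_⟩, ?_⟩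
  · exact Nat.succ_pos j
  · exact hj
  · dsimp only
    rw [h2]
    omega
  · dsimp only
    omega
  · dsimp only
    rw [h2]
    omega
  · refine congrArg Submodule.Quotient.mk (Subtype.ext ?_)
    exact cocycle_eq_monomialFun (Nat.succ_pos j)

theorem span_cohomologyClass (S : IsArtinSchreier p ρ l f x y) :
    ⊤ ≤ Submodule.span k (Set.range S.cohomologyClass) := by
  intro w _
  obtain ⟨w, rfl⟩ := Submodule.Quotient.mk_surjective _ w
  -- The cocycles whose class lies in the span, viewed inside F, where the spanning statement for
  -- cocycles is formulated.
  set N := ((Submodule.span k (Set.range S.cohomologyClass)).comap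
    ((coboundaries k x).submoduleOf (cocycles k x)).mkQ).map (cocycles k x).subtype with hN
  have h1 : Submodule.span k {w | ∃ j < p, ∃ n ∈ (Set.univ : Set ℤ),
      w = monomialFun p ρ l x y j n} ≤ N := by
    rw [Submodule.span_le]
    rintro _ ⟨j, hj, n, -, rfl⟩
    exact ⟨_, S.mk_monomialFun_mem_span hj n, rfl⟩
  obtain ⟨w', h2, h3⟩ := h1 (S.mem_span_of_mem_cocycles w.2)
  exact (Subtype.ext h3 : w' = w) ▸ h2

theorem exists_dual_bases (S : IsArtinSchreier p ρ l f x y) :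
    ∃ (B : H0 k F →ₗ[k] H1 k x →ₗ[k] k)
      (bΩ : Module.Basis (DiffIndex p l) k (H0 k F))
      (bH : Module.Basis (ClassIndex p l) k (H1 k x)),
      (∀ (ω : H0 k F) (h : cocycles k x),
        B ω (Submodule.Quotient.mk h) = residueSumInfty x ((h : F) • (ω : Ω[F⁄k]))) ∧
      (∀ i : DiffIndex p l, (bΩ i : Ω[F⁄k]) = diffForm p ρ l x y i.1.1 i.1.2) ∧
      (∀ j : ClassIndex p l, ∃ hj : cocycle p ρ l x y j.1.1 j.1.2 ∈ cocycles k x,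
        bH j = Submodule.Quotient.mk ⟨cocycle p ρ l x y j.1.1 j.1.2, hj⟩) ∧
      (∀ (i : DiffIndex p l) (j : ClassIndex p l),
        B (bΩ i) (bH j) = if i.1.1 = p - j.1.1 ∧ i.1.2 = j.1.2 then 1 else 0) := by
  obtain ⟨τ, φ, η, h⟩ := S.exists_infinityFamily
  refine ⟨S.cohomologyPairing h,
    Module.Basis.mk S.linearIndependent_regularForm S.span_regularForm,
    Module.Basis.mk S.linearIndependent_cohomologyClass S.span_cohomologyClass,
    fun ω w => ?_, fun i => ?_, fun j => ⟨S.cocycle_mem_cocycles j, ?_⟩, fun i j => ?_⟩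
  · rw [S.cohomologyPairing_mk, S.residueSumInfty_eq h, residuePairing_apply]
  · rw [Module.Basis.mk_apply]
    rfl
  · rw [Module.Basis.mk_apply]
    rfl
  · rw [Module.Basis.mk_apply, Module.Basis.mk_apply, S.cohomologyPairing_dual]

end IsArtinSchreier

end Setup

/-! ### Traces of the powers of y -/

section Setup

variable {k F : Type*} [Field k] [Field F] [Algebra k F] [Algebra (RatFunc k) F]
  [IsScalarTower k (RatFunc k) F] [IsAlgClosed k]
  {p : ℕ} [Fact p.Prime] [CharP k p] {r : ℕ} {ρ : Fin r → k} {l : Fin r → ℕ} {f : k[X]} {x y : F}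

namespace IsArtinSchreier

theorem powerBasis_dim (S : IsArtinSchreier p ρ l f x y) : S.powerBasis.dim = p := by
  rw [← S.powerBasis.natDegree_minpoly, S.powerBasis_gen, S.minpoly_eq,
    natDegree_artinSchreierPoly (by have := S.three_le; omega)]

theorem pow_add_eq (S : IsArtinSchreier p ρ l f x y) (i : ℕ) :
    y ^ (p + i) = y ^ (i + 1) + rhs f ρ l • y ^ i := by
  rw [Algebra.smul_def, ← S.equation]
  ring

theorem repr_pow (S : IsArtinSchreier p ρ l f x y) {j : ℕ} (hj : j < p)
    (i : Fin S.powerBasis.dim) :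
    S.powerBasis.basis.repr (y ^ j) i = if j = i then 1 else 0 := by
  have h1 : y ^ j = S.powerBasis.basis ⟨j, S.powerBasis_dim.symm ▸ hj⟩ := by
    rw [S.powerBasis.basis_eq_pow, S.powerBasis_gen]
  rw [h1, Module.Basis.repr_self, Finsupp.single_apply]
  exact if_congr (by rw [Fin.ext_iff]) rfl rfl

/-- Multiplication by yʲ sends yⁱ to y^(i+j) if i + j < p, and otherwise to y^(m+1) plus a multiple
of y^m with m = i + j - p < i. A diagonal entry appears only if m + 1 = i, that is j = p-1 and i ≥
1; there are then p-1 entries equal to 1. -/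
theorem trace_pow_of_lt (S : IsArtinSchreier p ρ l f x y) {j : ℕ} (h1 : 1 ≤ j) (hj : j < p) :
    Algebra.trace (RatFunc k) F (y ^ j) = if j = p - 1 then -1 else 0 := by
  have hchar : CharP (RatFunc k) p :=
    charP_of_injective_algebraMap (algebraMap k (RatFunc k)).injective p
  have hterm : ∀ i : Fin S.powerBasis.dim,
      Algebra.leftMulMatrix S.powerBasis.basis (y ^ j) i i =
        if j = p - 1 then 1 - if (i : ℕ) = 0 then 1 else 0 else 0 := fun i => by
    have hi : (i : ℕ) < p := lt_of_lt_of_eq i.2 S.powerBasis_dim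
    rw [Algebra.leftMulMatrix_eq_repr_mul, S.powerBasis.basis_eq_pow, S.powerBasis_gen, ← pow_add]
    by_cases hij : j + i < p
    · rw [S.repr_pow hij, if_neg (by omega)]
      split_ifs <;> first | omega | simp
    · obtain ⟨m, hm⟩ : ∃ m, j + i = p + m := ⟨j + i - p, by omega⟩
      rw [hm, S.pow_add_eq, map_add, map_smul, Finsupp.add_apply, Finsupp.smul_apply,
        S.repr_pow (by omega), S.repr_pow (by omega), if_neg (show ¬ m = i by omega), smul_zero,
        add_zero]
      split_ifs <;> first | omega | simp
  rw [Algebra.trace_eq_matrix_trace S.powerBasis.basis, Matrix.trace]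
  simp only [Matrix.diag_apply, hterm]
  split_ifs with h2
  · have hp := S.three_le
    have h3 : ∑ i : Fin S.powerBasis.dim, (if (i : ℕ) = 0 then (1 : RatFunc k) else 0) = 1 := by
      rw [Finset.sum_eq_single ⟨0, by rw [S.powerBasis_dim]; omega⟩]
      · simp
      · intro b _ hb
        exact if_neg fun h => hb (Fin.ext h)
      · simp
    rw [Finset.sum_sub_distrib, h3, Finset.sum_const, Finset.card_univ, Fintype.card_fin,
      S.powerBasis_dim, nsmul_one, CharP.cast_eq_zero, zero_sub]
  · exact Finset.sum_const_zero

theorem trace_pow (S : IsArtinSchreier p ρ l f x y) {j : ℕ} (h1 : 1 ≤ j) (hj : j ≤ 2 * p - 3) :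
    Algebra.trace (RatFunc k) F (y ^ j) = if j = p - 1 then -1 else 0 := by
  have hp := S.three_le
  by_cases h2 : j < p
  · exact S.trace_pow_of_lt h1 h2
  obtain ⟨i, rfl⟩ : ∃ i, j = p + i := ⟨j - p, by omega⟩
  rw [S.pow_add_eq, map_add, map_smul, S.trace_pow_of_lt (by omega) (by omega),
    if_neg (by omega), if_neg (by omega), zero_add]
  -- For j = p the remaining term is the trace of 1, which is p = 0.
  rcases Nat.eq_zero_or_pos i with rfl | hi
  · have hchar : CharP (RatFunc k) p :=
      charP_of_injective_algebraMap (algebraMap k (RatFunc k)).injective p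
    have h3 := Algebra.trace_algebraMap_of_basis S.powerBasis.basis (1 : RatFunc k)
    rw [map_one, Fintype.card_fin, S.powerBasis_dim, nsmul_one, CharP.cast_eq_zero] at h3
    rw [pow_zero, h3, smul_zero]
  · rw [S.trace_pow_of_lt hi (by omega), if_neg (by omega), smul_zero]

end IsArtinSchreier

end Setup

end ArtinSchreierCurve

end

open ArtinSchreierCurve in
theorem mainTheorem4
    {k : Type*} [Field k] [IsAlgClosed k] (p : ℕ) [Fact p.Prime] [CharP k p] (hp : 3 ≤ p)
    (r : ℕ) (hr : 0 < r) (ρ : Fin r → k) (hρ : Function.Injective ρ)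
    (l : Fin r → ℕ) (hl : ∀ i, Nat.Coprime (l i) p)
    (f : Polynomial k) (hf0 : f.eval 0 ≠ 0)
    (hf : IsCoprime f (∏ i, (Polynomial.X - Polynomial.C (ρ i)) ^ l i))
    (hdeg : f.natDegree = ∑ i, l i)
    {F : Type*} [Field F] [Algebra k F] [Algebra (RatFunc k) F] [IsScalarTower k (RatFunc k) F]
    (x y : F) (hx : x = algebraMap (RatFunc k) F RatFunc.X)
    (hy : y ^ p - y = algebraMap (RatFunc k) F (rhs f ρ l))
    (hgen : IntermediateField.adjoin (RatFunc k) {y} = ⊤) :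
    (∀ j : ℕ, 1 ≤ j → j ≤ 2 * p - 3 →
      Algebra.trace (RatFunc k) F (y ^ j) = if j = p - 1 then -1 else 0) ∧
    ∃ (B : H0 k F →ₗ[k] H1 k x →ₗ[k] k)
      (bΩ : Module.Basis (DiffIndex p l) k (H0 k F))
      (bH : Module.Basis (ClassIndex p l) k (H1 k x)),
      (∀ (ω : H0 k F) (h : cocycles k x),
        B ω (Submodule.Quotient.mk h) = residueSumInfty x ((h : F) • (ω : Ω[F⁄k]))) ∧
      (∀ i : DiffIndex p l, (bΩ i : Ω[F⁄k]) = diffForm p ρ l x y i.1.1 i.1.2) ∧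
      (∀ j : ClassIndex p l, ∃ hj : cocycle p ρ l x y j.1.1 j.1.2 ∈ cocycles k x,
        bH j = Submodule.Quotient.mk ⟨cocycle p ρ l x y j.1.1 j.1.2, hj⟩) ∧
      (∀ (i : DiffIndex p l) (j : ClassIndex p l),
        B (bΩ i) (bH j) = if i.1.1 = p - j.1.1 ∧ i.1.2 = j.1.2 then 1 else 0) := by
  have S : IsArtinSchreier p ρ l f x y := ⟨hp, hr, hρ, hl, hf, hdeg, hx, hy, hgen⟩
  exact ⟨fun _ h1 hj => S.trace_pow h1 hj, S.exists_dual_bases⟩
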